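/- Let $\Gamma$ be a group of isometries of hyperbolic space $\mathbb{H}^3$ (for example, a discrete group for which $\mathbb{H}^3/\Gamma$ is a mixed-platonic orbifold), and let $\mathcal{P}$ be a $\Gamma$-invariant, locally finite, face-to-face tiling of $\mathbb{H}^3$ each of whose tiles is a regular ideal tetrahedron or a regular ideal octahedron. A collection $\mathcal{H}$ of closed horoballs is a \emph{packing} if distinct members have disjoint interiors. A packing $\mathcal{H}$ is \emph{maximal} if every packing $\mathcal{H}'$ such that each member of $\mathcal{H}$ is contained in a member of $\mathcal{H}'$ equals $\mathcal{H}$. For each tile $P$ there is a unique packing $\mathcal{H}_P$ by horoballs centered at ideal vertices of $P$ that is invariant under all self-isometries of $P$ and is maximal among packings by horoballs centered at ideal vertices of $P$. There is a unique $\Gamma$-invariant horoball packing $\mathcal{H}$ of $\mathbb{H}^3$ such that (1) the set of centers of horoballs of $\mathcal{H}$ is the set of ideal vertices of tiles of $\mathcal{P}$; and (2) for each tile $P$ of $\mathcal{P}$ and each ideal vertex $p$ of $P$, the horoball of $\mathcal{H}$ centered at $p$ belongs to $\mathcal{H}_P$. Moreover: (a) $\mathcal{H}$ is a maximal packing of $\mathbb{H}^3$.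 (b) The horoball of $\mathcal{H}$ centered at $p$ intersects a tile $P$ of $\mathcal{P}$ if and only if $p$ is an ideal vertex of $P$. (c) If, in the upper half-space model, $\mathcal{P}$ contains the regular ideal tetrahedron with ideal vertices $0,1,\infty,\tfrac12(1+i\sqrt3)$ or the regular ideal octahedron with ideal vertices $0,1,\infty,1+i,i,\tfrac12(1+i)$, then $\{(z,t) : t\ge 1\}$ belongs to $\mathcal{H}$. (d) Conversely, $\mathcal{P}$ is the unique (locally finite, face-to-face) tiling of $\mathbb{H}^3$ by ideal polyhedra (non-planar convex hulls of finitely many ideal points) whose set of edges is the set of geodesics joining the centers of tangent horoballs of $\mathcal{H}$ and whose set of two-dimensional faces is the set of convex hulls of the three geodesics joining the centers of triples of pairwise tangent horoballs of $\mathcal{H}$. -/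

import Mathlib

noncomputable section

/-- Hyperbolic 3-space, in the upper half-space model `{(z, t) | z ∈ ℂ, t > 0}`. -/
@[ext] structure H3 where
  z : ℂ
  t : ℝ
  t_pos : 0 < t

namespace H3

/-- The point `(z, s)` of the Euclidean 3-space `ℂ × ℝ`; used only to prove the triangle
inequality. -/
def toE (x : H3) : WithLp 2 (ℂ × ℝ) := WithLp.toLp 2 (x.z, x.t)

/-- The mirror image `(z, -t)` in Euclidean 3-space; used only to prove the triangle inequality. -/
def toE' (x : H3) : WithLp 2 (ℂ × ℝ) := WithLp.toLp 2 (x.z, -x.t)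

/-- The Euclidean distance between two points of the upper half-space. -/
def edist3 (x y : H3) : ℝ := √(‖x.z - y.z‖ ^ 2 + (x.t - y.t) ^ 2)

/-- The hyperbolic distance, `sinh (d(x, y) / 2) = |x - y| / (2 √(t(x) t(y)))`, equivalently
`cosh d(x, y) = 1 + |x - y|² / (2 t(x) t(y))`, with `|x - y|` the Euclidean distance. -/
instance : Dist H3 := ⟨fun x y => 2 * Real.arsinh (edist3 x y / (2 * √(x.t * y.t)))⟩

theorem dist_def (x y : H3) :
    dist x y = 2 * Real.arsinh (edist3 x y / (2 * √(x.t * y.t))) := rfl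

theorem edist3_eq (x y : H3) : edist3 x y = dist x.toE y.toE := by
  rw [WithLp.prod_dist_eq_of_L2]
  simp [edist3, toE, Complex.dist_eq, Real.dist_eq, sq_abs]

theorem edist3_sq (x y : H3) : edist3 x y ^ 2 = ‖x.z - y.z‖ ^ 2 + (x.t - y.t) ^ 2 :=
  Real.sq_sqrt (by positivity)

theorem dist_mirror (x y : H3) :
    dist x.toE y.toE' = √(‖x.z - y.z‖ ^ 2 + (x.t + y.t) ^ 2) := by
  rw [WithLp.prod_dist_eq_of_L2]
  simp [toE, toE', Complex.dist_eq, Real.dist_eq, sq_abs]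

theorem dist_mirror_comm (x y : H3) : dist x.toE y.toE' = dist y.toE x.toE' := by
  rw [dist_mirror, dist_mirror, norm_sub_rev, add_comm x.t]

theorem sinh_half_dist (x y : H3) :
    Real.sinh (dist x y / 2) = edist3 x y / (2 * √(x.t * y.t)) := by
  rw [dist_def, mul_div_cancel_left₀ _ two_ne_zero, Real.sinh_arsinh]

theorem cosh_half_dist (x y : H3) :
    Real.cosh (dist x y / 2) = dist x.toE y.toE' / (2 * √(x.t * y.t)) := by
  have hx := x.t_pos
  have hy := y.t_pos
  rw [← sq_eq_sq₀ (Real.cosh_pos _).le (by positivity), Real.cosh_sq', sinh_half_dist, div_pow,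
    div_pow, mul_pow, Real.sq_sqrt (by positivity), edist3_sq, dist_mirror,
    Real.sq_sqrt (by positivity)]
  field_simp
  ring

theorem dist_triangle' (a b c : H3) : dist a c ≤ dist a b + dist b c := by
  have ha := a.t_pos
  have hb := b.t_pos
  have hc := c.t_pos
  have hbb : dist b.toE b.toE' = 2 * b.t := by
    rw [dist_mirror, sub_self, norm_zero, ← two_mul]
    simp [Real.sqrt_sq (by positivity : (0 : ℝ) ≤ 2 * b.t)]
  have key := EuclideanGeometry.mul_dist_le_mul_dist_add_mul_dist a.toE b.toE c.toE b.toE'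
  rw [hbb] at key
  have h : Real.sinh (dist a c / 2) ≤ Real.sinh (dist a b / 2 + dist b c / 2) := by
    rw [Real.sinh_add, sinh_half_dist, sinh_half_dist, sinh_half_dist, cosh_half_dist,
      cosh_half_dist, dist_mirror_comm b c, edist3_eq, edist3_eq, edist3_eq,
      Real.sqrt_mul ha.le, Real.sqrt_mul ha.le, Real.sqrt_mul hb.le]
    have hB : √b.t * √b.t = b.t := Real.mul_self_sqrt hb.le
    have sa : 0 < √a.t := Real.sqrt_pos.2 ha
    have sb : 0 < √b.t := Real.sqrt_pos.2 hb
    have sc : 0 < √c.t := Real.sqrt_pos.2 hc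
    have e : dist a.toE b.toE / (2 * (√a.t * √b.t)) * (dist c.toE b.toE' / (2 * (√b.t * √c.t))) +
        dist a.toE b.toE' / (2 * (√a.t * √b.t)) * (dist b.toE c.toE / (2 * (√b.t * √c.t))) =
        (dist a.toE b.toE * dist c.toE b.toE' + dist b.toE c.toE * dist a.toE b.toE') /
          (2 * (√a.t * √c.t)) / (2 * b.t) := by
      generalize √a.t = u at *
      generalize √c.t = v at *
      generalize √b.t = w at *
      rw [← hB]
      field_simp
    rw [e, le_div_iff₀ (by positivity), div_mul_eq_mul_div]
    gcongr
  have := Real.sinh_le_sinh.1 h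
  linarith

/-- The hyperbolic metric; all topological notions in `H3` are those of this metric. -/
instance : MetricSpace H3 where
  dist_self x := by simp [dist_def, edist3]
  dist_comm x y := by
    rw [dist_def, dist_def, edist3, edist3, norm_sub_rev, mul_comm x.t, ← neg_sub y.t, neg_sq]
  dist_triangle := dist_triangle'
  eq_of_dist_eq_zero {x y} h := by
    have hx := x.t_pos
    have hy := y.t_pos
    have h0 : edist3 x y = 0 := by
      have h2 := sinh_half_dist x y
      rw [h, zero_div, Real.sinh_zero, eq_comm, div_eq_zero_iff] at h2
      exact h2.resolve_right (by positivity)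
    have h1 := edist3_sq x y
    rw [h0] at h1
    have hz : ‖x.z - y.z‖ ^ 2 = 0 := by nlinarith [sq_nonneg ‖x.z - y.z‖, sq_nonneg (x.t - y.t)]
    have ht : (x.t - y.t) ^ 2 = 0 := by nlinarith [sq_nonneg ‖x.z - y.z‖, sq_nonneg (x.t - y.t)]
    ext1
    · exact sub_eq_zero.1 (norm_eq_zero.1 (pow_eq_zero_iff two_ne_zero |>.1 hz))
    · exact sub_eq_zero.1 (pow_eq_zero_iff two_ne_zero |>.1 ht)

/-! ### Lines, planes and convexity -/

/-- The sphere at infinity of hyperbolic 3-space, `ℂ ∪ {∞}`. -/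
abbrev IdealPoint := OnePoint ℂ

/-- The complete geodesic with the given ideal endpoints: a vertical half-line if one of them is
`∞`, a half-circle orthogonal to `ℂ` otherwise. It is empty when the two endpoints agree. -/
def geodesicLine : IdealPoint → IdealPoint → Set H3
  | none, none => ∅
  | none, some b => {x | x.z = b}
  | some a, none => {x | x.z = a}
  | some a, some b =>
      {x | ∃ s : ℝ, x.z = a + s • (b - a) ∧ x.t ^ 2 = s * (1 - s) * ‖b - a‖ ^ 2}

/-- The geodesic segment between two points. -/
def segment (x y : H3) : Set H3 := {w | dist x w + dist w y = dist x y}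

/-- The equidistant set of two points. For `a ≠ b` these are exactly the geodesic planes. -/
def bisector (a b : H3) : Set H3 := {x | dist x a = dist x b}

def IsConvex (S : Set H3) : Prop := ∀ x ∈ S, ∀ y ∈ S, segment x y ⊆ S

/-- The smallest geodesically convex set containing `S`. -/
def hull (S : Set H3) : Set H3 := ⋂₀ {C | IsConvex C ∧ S ⊆ C}

/-- The convex hull of a set of ideal points: the hull of the geodesics joining them in pairs. -/
def idealHull (V : Set IdealPoint) : Set H3 := hull (⋃ p ∈ V, ⋃ q ∈ V, geodesicLine p q)

/-! ### Ideal polyhedra, their faces, and tilings -/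

/-- `P` is the convex hull of finitely many ideal points, not contained in a geodesic plane. -/
def IsIdealPolyhedron (P : Set H3) : Prop :=
  (∃ V : Set IdealPoint, V.Finite ∧ P = idealHull V) ∧ ¬ ∃ a b, a ≠ b ∧ P ⊆ bisector a b

/-- `p` is an ideal vertex of `P`: it belongs to a finite set of ideal points of which `P` is the
convex hull (such a set is unique, provided that `P` is not empty). -/
def IsIdealVertex (p : IdealPoint) (P : Set H3) : Prop :=
  P.Nonempty ∧ ∃ V : Set IdealPoint, V.Finite ∧ p ∈ V ∧ P = idealHull V

/-- `F` is a face (of any dimension, `P` itself included) of the convex set `P`: a non-empty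
convex subset that contains both endpoints of a segment in `P` as soon as it contains a point in
the interior of this segment. -/
def IsFace (F P : Set H3) : Prop :=
  F.Nonempty ∧ F ⊆ P ∧ IsConvex F ∧
    ∀ x ∈ P, ∀ y ∈ P, ∀ w ∈ F, w ∈ segment x y → w ≠ x → w ≠ y → x ∈ F ∧ y ∈ F

/-- `e` is an edge of the ideal polyhedron `P`: a face that is a geodesic. -/
def IsEdge (e P : Set H3) : Prop :=
  IsFace e P ∧ ∃ p q, p ≠ q ∧ e = geodesicLine p q

/-- `f` is a two-dimensional face of the ideal polyhedron `P`: a face that lies in a geodesic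
plane but not in a geodesic. -/
def IsTwoFace (f P : Set H3) : Prop :=
  IsFace f P ∧ (∃ a b, a ≠ b ∧ f ⊆ bisector a b) ∧ ¬ ∃ p q, f ⊆ geodesicLine p q

/-- A (face-to-face) tiling of hyperbolic 3-space by ideal polyhedra: a locally finite cover by
ideal polyhedra with disjoint interiors, any two of which are disjoint or meet in a common face. -/
structure IsIdealTiling (𝒯 : Set (Set H3)) : Prop where
  polyhedron : ∀ P ∈ 𝒯, IsIdealPolyhedron P
  cover : ⋃₀ 𝒯 = Set.univ
  locallyFinite : ∀ x : H3, ∃ U ∈ nhds x, {P ∈ 𝒯 | (P ∩ U).Nonempty}.Finite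
  disjoint_interiors : ∀ P ∈ 𝒯, ∀ Q ∈ 𝒯, P ≠ Q → Disjoint (interior P) (interior Q)
  face_to_face : ∀ P ∈ 𝒯, ∀ Q ∈ 𝒯, P ≠ Q → (P ∩ Q).Nonempty →
    IsFace (P ∩ Q) P ∧ IsFace (P ∩ Q) Q

def edgeSet (𝒯 : Set (Set H3)) : Set (Set H3) := {e | ∃ P ∈ 𝒯, IsEdge e P}

/-- The set of two-dimensional faces of the tiles. -/
def faceSet (𝒯 : Set (Set H3)) : Set (Set H3) := {f | ∃ P ∈ 𝒯, IsTwoFace f P}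

/-- The regular ideal tetrahedron in standard position, with ideal vertices `0`, `1`, `∞` and
`ω = (1 + i√3)/2`. -/
def stdTetrahedron : Set H3 :=
  idealHull {((0 : ℂ) : IdealPoint), ((1 : ℂ) : IdealPoint), OnePoint.infty,
    (((1 + Complex.I * (√3 : ℝ)) / 2 : ℂ) : IdealPoint)}

/-- The regular ideal octahedron in standard position, with ideal vertices `0`, `1`, `∞`, `1 + i`,
`i` and `(1 + i)/2`. -/
def stdOctahedron : Set H3 :=
  idealHull {((0 : ℂ) : IdealPoint), ((1 : ℂ) : IdealPoint), OnePoint.infty,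
    ((1 + Complex.I : ℂ) : IdealPoint), ((Complex.I : ℂ) : IdealPoint),
    (((1 + Complex.I) / 2 : ℂ) : IdealPoint)}

/-- Regular ideal tetrahedra are the isometric copies of the one in standard position. -/
def IsRegularIdealTetrahedron (P : Set H3) : Prop := ∃ g : H3 ≃ᵢ H3, P = g '' stdTetrahedron

/-- Regular ideal octahedra are the isometric copies of the one in standard position. -/
def IsRegularIdealOctahedron (P : Set H3) : Prop := ∃ g : H3 ≃ᵢ H3, P = g '' stdOctahedron

/-- A collection of subsets is invariant under a group of isometries. -/
def IsInvariant (Γ : Subgroup (H3 ≃ᵢ H3)) (𝒜 : Set (Set H3)) : Prop :=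
  ∀ γ ∈ Γ, ∀ A ∈ 𝒜, (γ : H3 → H3) '' A ∈ 𝒜

/-- The group of self-isometries of a set `P`. -/
def symmetryGroup (P : Set H3) : Subgroup (H3 ≃ᵢ H3) where
  carrier := {g | (g : H3 → H3) '' P = P}
  one_mem' := by simp
  mul_mem' {g h} hg hh := by
    have e : ((g * h : H3 ≃ᵢ H3) : H3 → H3) = g ∘ h := rfl
    simp only [Set.mem_ofPred_eq] at hg hh ⊢
    rw [e, Set.image_comp, hh, hg]
  inv_mem' {g} hg := by
    simp only [Set.mem_ofPred_eq] at hg ⊢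
    conv_lhs => rw [← hg]
    rw [← Set.image_comp]
    have e : ((g⁻¹ : H3 ≃ᵢ H3) : H3 → H3) ∘ g = id := by
      funext x
      exact g.symm_apply_apply x
    rw [e, Set.image_id]

/-! ### Horoballs and packings -/

/-- The horofunction of an ideal point, normalized as the Poisson kernel: `t` for `∞`, and
`t / (|z - a|² + t²)` for `a ∈ ℂ`. -/
def horofunction : IdealPoint → H3 → ℝ
  | none, x => x.t
  | some a, x => x.t / (‖x.z - a‖ ^ 2 + x.t ^ 2)

/-- For `r > 0`, the (closed) horoball centered at `p` with parameter `r`: the region above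
height `r` if `p = ∞`, and the Euclidean ball of diameter `1 / r` tangent to `ℂ` at `p`, without
`p`, otherwise. -/
def horoball (p : IdealPoint) (r : ℝ) : Set H3 := {x | r ≤ horofunction p x}

/-- `B` is a horoball centered at `p`. -/
def IsHoroballAt (p : IdealPoint) (B : Set H3) : Prop := ∃ r : ℝ, 0 < r ∧ B = horoball p r

/-- A horoball packing: a collection of horoballs with pairwise disjoint interiors. -/
def IsHoroballPacking (𝓗 : Set (Set H3)) : Prop :=
  (∀ B ∈ 𝓗, ∃ p, IsHoroballAt p B) ∧
    ∀ B ∈ 𝓗, ∀ B' ∈ 𝓗, B ≠ B' → Disjoint (interior B) (interior B')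

/-- The horoball packing `𝓗` is maximal: a packing `𝓗'` such that each member of `𝓗` is contained
in a member of `𝓗'` equals `𝓗`. -/
def IsMaximalPacking (𝓗 : Set (Set H3)) : Prop :=
  IsHoroballPacking 𝓗 ∧ ∀ 𝓗', IsHoroballPacking 𝓗' → (∀ B ∈ 𝓗, ∃ B' ∈ 𝓗', B ⊆ B') → 𝓗' = 𝓗

/-- All members of `𝓗` are horoballs centered at ideal vertices of `P`. -/
def IsCenteredAtVerticesOf (P : Set H3) (𝓗 : Set (Set H3)) : Prop :=
  ∀ B ∈ 𝓗, ∃ p, IsIdealVertex p P ∧ IsHoroballAt p B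

/-- `𝓗` is the symmetric packing of the tile `P`: a horoball packing by horoballs centered at
ideal vertices of `P`, invariant under all self-isometries of `P`, and maximal among the horoball
packings by horoballs centered at ideal vertices of `P`. -/
def IsSymmetricPackingOf (P : Set H3) (𝓗 : Set (Set H3)) : Prop :=
  IsHoroballPacking 𝓗 ∧ IsCenteredAtVerticesOf P 𝓗 ∧ IsInvariant (symmetryGroup P) 𝓗 ∧
    ∀ 𝓗', IsHoroballPacking 𝓗' → IsCenteredAtVerticesOf P 𝓗' →
      (∀ B ∈ 𝓗, ∃ B' ∈ 𝓗', B ⊆ B') → 𝓗' = 𝓗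

/-- `𝓗` is a `Γ`-invariant horoball packing whose centers are the ideal vertices of the tiles of
`𝒯` and which agrees with the symmetric packing of each tile. -/
structure IsPackingOfTiling (Γ : Subgroup (H3 ≃ᵢ H3)) (𝒯 𝓗 : Set (Set H3)) : Prop where
  packing : IsHoroballPacking 𝓗
  invariant : IsInvariant Γ 𝓗
  centers : {p | ∃ B ∈ 𝓗, IsHoroballAt p B} = {p | ∃ P ∈ 𝒯, IsIdealVertex p P}
  agrees : ∀ P ∈ 𝒯, ∀ p, IsIdealVertex p P → ∀ B ∈ 𝓗, IsHoroballAt p B →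
    ∃ 𝓗P, IsSymmetricPackingOf P 𝓗P ∧ B ∈ 𝓗P

/-- Two horoballs are tangent: they have exactly one point in common. -/
def AreTangent (B B' : Set H3) : Prop := ∃ x, B ∩ B' = {x}

/-- The geodesics joining the centers of two tangent members of `𝓗`. -/
def tangencyGeodesics (𝓗 : Set (Set H3)) : Set (Set H3) :=
  {e | ∃ B ∈ 𝓗, ∃ B' ∈ 𝓗, AreTangent B B' ∧
    ∃ p p', IsHoroballAt p B ∧ IsHoroballAt p' B' ∧ e = geodesicLine p p'}

/-- The ideal triangles spanned by the centers of three pairwise tangent members of `𝓗`. -/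
def tangencyTriangles (𝓗 : Set (Set H3)) : Set (Set H3) :=
  {f | ∃ B₁ ∈ 𝓗, ∃ B₂ ∈ 𝓗, ∃ B₃ ∈ 𝓗,
    AreTangent B₁ B₂ ∧ AreTangent B₁ B₃ ∧ AreTangent B₂ B₃ ∧
    ∃ p₁ p₂ p₃, IsHoroballAt p₁ B₁ ∧ IsHoroballAt p₂ B₂ ∧ IsHoroballAt p₃ B₃ ∧
      f = hull (geodesicLine p₁ p₂ ∪ geodesicLine p₁ p₃ ∪ geodesicLine p₂ p₃)}

end H3

end

/-! Everything is transported to Minkowski 4-space. A point becomes a unit future vector, a horoball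
becomes a null vector `n` (its points are those with `lor n (vec x) ≤ 1`), an ideal polyhedron
becomes the slice of the cone generated by null vectors at its vertices, and an isometry becomes a
Lorentz map. Two horoballs have disjoint interiors exactly when `lor n m ≥ 2`, and they are tangent
when the product is 2. The symmetric packing of a regular ideal tetrahedron is then a set of four
null vectors with all products 2. That of an octahedron has six, with product 4 for opposite
vertices and 2 otherwise. `IsRegular` records what both configurations share, and the rest of the
argument no longer distinguishes them.

The heart is that two tiles with a common ideal vertex put the same horoball there. Inside a tile,
the horoball of a vertex meets only those proper faces that have this vertex
(`IsRegular.mem_of_hb_inter`), and a triangular face determines its three null vectors, because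
three mutual products equal to 2 leave no freedom of scale (`IsClique.eq_of_cell_eq`). A path that
stays in the horoball and avoids all edges, as a generic one does, crosses from tile to tile through
triangles only, so the null vector is carried along (`mem_verts_of_path`). Hence a horoball of the
packing meets exactly the tiles that have its center as a vertex, which is (b).

The rest follows locally. Two overlapping horoballs share a point, and a tile containing that point
has both as vertices, so the union of the symmetric packings is a packing. Each member is tangent to
another, so none can grow; each point of a tile is close to a horoball of that tile, so none can be
added. A point of tangency lies in a tile having both centers as vertices, which identifies the
edges. For three mutually tangent horoballs, a tile entered from one tangency point in the direction
of the third center must have all three centers (`exists_tile_of_triple`), which identifies the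
triangles.

Finally, the faces determine the tiling. A tile of another tiling with the same faces cannot cross a
face of a given tile, so it lies inside a given tile. If it were smaller, it would be spanned by
some vertices of an octahedron and have a face through the center of that octahedron, where the
given tiling has no face. -/

noncomputable section

namespace H3

/-! ### The hyperboloid model -/

/-- Minkowski 4-space, in coordinates adapted to the upper half-space: the Hermitian matrix with
diagonal `(a, b)` and off-diagonal entry `w` is `(a, b, w)`. -/
abbrev Mink := ℝ × ℝ × ℂ

/-- The Lorentz form, the polarization of the determinant. -/
def lor (u w : Mink) : ℝ :=
  (u.1 * w.2.1 + u.2.1 * w.1) / 2 - (u.2.2.re * w.2.2.re + u.2.2.im * w.2.2.im)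

theorem lor_comm (u w : Mink) : lor u w = lor w u := by simp only [lor]; ring

theorem lor_add_left (u v w : Mink) : lor (u + v) w = lor u w + lor v w := by
  simp [lor]; ring

theorem lor_add_right (u v w : Mink) : lor u (v + w) = lor u v + lor u w := by
  simp [lor]; ring

theorem lor_sub_left (u v w : Mink) : lor (u - v) w = lor u w - lor v w := by
  simp [lor]; ring

theorem lor_sub_right (u v w : Mink) : lor u (v - w) = lor u v - lor u w := by
  simp [lor]; ring

theorem lor_smul_left (c : ℝ) (u w : Mink) : lor (c • u) w = c * lor u w := by
  simp [lor]; ring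

theorem lor_smul_right (c : ℝ) (u w : Mink) : lor u (c • w) = c * lor u w := by
  simp [lor]; ring

theorem lor_zero_left (w : Mink) : lor 0 w = 0 := by simp [lor]

theorem lor_zero_right (w : Mink) : lor w 0 = 0 := by simp [lor]

/-- The Lorentz form as a bilinear form. -/
def lorForm : LinearMap.BilinForm ℝ Mink :=
  LinearMap.mk₂ ℝ lor lor_add_left lor_smul_left lor_add_right lor_smul_right

theorem lorForm_apply (u w : Mink) : lorForm u w = lor u w := rfl

theorem lor_sum_left {ι : Type*} (s : Finset ι) (f : ι → Mink) (w : Mink) :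
    lor (∑ i ∈ s, f i) w = ∑ i ∈ s, lor (f i) w := by
  simp only [← lorForm_apply, map_sum, LinearMap.sum_apply]

theorem lor_sum_right {ι : Type*} (s : Finset ι) (f : ι → Mink) (w : Mink) :
    lor w (∑ i ∈ s, f i) = ∑ i ∈ s, lor w (f i) := by
  simp only [← lorForm_apply, map_sum]

theorem lor_eq_zero_of_forall {u : Mink} (h : ∀ w, lor u w = 0) : u = 0 := by
  have h1 := h (1, 0, 0)
  have h2 := h (0, 1, 0)
  have h3 := h (0, 0, 1)
  have h4 := h (0, 0, Complex.I)
  simp [lor] at h1 h2 h3 h4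
  exact Prod.ext h2 (Prod.ext h1 (Complex.ext h3 h4))

theorem continuous_lor_right (u : Mink) : Continuous fun w => lor u w := by
  unfold lor; fun_prop

theorem continuous_lor_self : Continuous fun w : Mink => lor w w := by
  unfold lor; fun_prop

/-- The point of the hyperboloid `lor u u = 1` that corresponds to a point of `H3`. -/
def vec (x : H3) : Mink := ((‖x.z‖ ^ 2 + x.t ^ 2) / x.t, 1 / x.t, (1 / x.t : ℝ) • x.z)

/-- A consequence of `cosh d = 1 + 2 sinh² (d / 2)`. Through it, every metric statement becomes one
about the bilinear form. -/
theorem lor_vec_vec (x y : H3) : lor (vec x) (vec y) = Real.cosh (dist x y) := by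
  have hx := x.t_pos
  have hy := y.t_pos
  have h1 : Real.cosh (dist x y) = 1 + 2 * Real.sinh (dist x y / 2) ^ 2 := by
    have := Real.cosh_two_mul (dist x y / 2)
    rw [mul_div_cancel₀ _ two_ne_zero] at this
    rw [this, Real.cosh_sq']; ring
  rw [h1, sinh_half_dist, div_pow, mul_pow, Real.sq_sqrt (by positivity), edist3_sq,
    ← Complex.normSq_eq_norm_sq]
  simp only [lor, vec, ← Complex.normSq_eq_norm_sq, Complex.normSq_apply, Complex.sub_re,
    Complex.sub_im, Complex.smul_re, Complex.smul_im, smul_eq_mul]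
  field_simp
  ring

theorem lor_vec_self (x : H3) : lor (vec x) (vec x) = 1 := by simp [lor_vec_vec]

theorem lor_vec_pos (x y : H3) : 0 < lor (vec x) (vec y) := by
  rw [lor_vec_vec]; exact Real.cosh_pos _

theorem vec_injective : Function.Injective vec := by
  intro x y h
  have h1 : lor (vec x) (vec y) = 1 := by rw [h, lor_vec_self]
  rw [lor_vec_vec] at h1
  by_contra hne
  exact (Real.one_lt_cosh.2 (dist_pos.2 hne).ne').ne' h1

/-- Reversed Cauchy–Schwarz: the difference is minus the Lorentz square of the component of `u`
orthogonal to `vec x`, here written as an explicit sum of squares. -/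
theorem lor_self_le_sq (u : Mink) (x : H3) : lor u u ≤ lor u (vec x) ^ 2 := by
  obtain ⟨⟨p, q⟩, t, ht⟩ := x
  obtain ⟨a, b, ⟨c, d⟩⟩ := u
  have key : lor (a, b, ⟨c, d⟩) (vec ⟨⟨p, q⟩, t, ht⟩) ^ 2 - lor (a, b, ⟨c, d⟩) (a, b, ⟨c, d⟩) =
      ((a + b * (p ^ 2 + q ^ 2) - 2 * (c * p + d * q) - b * t ^ 2) / (2 * t)) ^ 2 +
        ((c - b * p) ^ 2 + (d - b * q) ^ 2) := by
    simp only [lor, vec, ← Complex.normSq_eq_norm_sq, Complex.normSq_apply, Complex.smul_re,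
      Complex.smul_im, smul_eq_mul]
    field_simp
    ring
  have : 0 ≤ ((a + b * (p ^ 2 + q ^ 2) - 2 * (c * p + d * q) - b * t ^ 2) / (2 * t)) ^ 2 +
        ((c - b * p) ^ 2 + (d - b * q) ^ 2) := by positivity
  linarith

/-- The Lorentz form is negative definite on the orthogonal complement of a point. -/
theorem eq_zero_of_lor_vec_eq_zero {u : Mink} {x : H3} (h : lor u (vec x) = 0)
    (h0 : 0 ≤ lor u u) : u = 0 := by
  obtain ⟨⟨p, q⟩, t, ht⟩ := x
  obtain ⟨a, b, ⟨c, d⟩⟩ := u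
  have key : lor (a, b, ⟨c, d⟩) (vec ⟨⟨p, q⟩, t, ht⟩) ^ 2 - lor (a, b, ⟨c, d⟩) (a, b, ⟨c, d⟩) =
      ((a + b * (p ^ 2 + q ^ 2) - 2 * (c * p + d * q) - b * t ^ 2) / (2 * t)) ^ 2 +
        ((c - b * p) ^ 2 + (d - b * q) ^ 2) := by
    simp only [lor, vec, ← Complex.normSq_eq_norm_sq, Complex.normSq_apply, Complex.smul_re,
      Complex.smul_im, smul_eq_mul]
    field_simp
    ring
  have e : lor (a, b, ⟨c, d⟩) (vec ⟨⟨p, q⟩, t, ht⟩) =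
      (a + b * (p ^ 2 + q ^ 2) - 2 * (c * p + d * q) + b * t ^ 2) / (2 * t) := by
    simp only [lor, vec, ← Complex.normSq_eq_norm_sq, Complex.normSq_apply, Complex.smul_re,
      Complex.smul_im, smul_eq_mul]
    field_simp
    ring
  rw [h] at key e
  have e1 : a + b * (p ^ 2 + q ^ 2) - 2 * (c * p + d * q) + b * t ^ 2 = 0 := by
    have := e.symm
    rw [div_eq_zero_iff] at this
    exact this.resolve_right (by positivity)
  have s1 := sq_nonneg ((a + b * (p ^ 2 + q ^ 2) - 2 * (c * p + d * q) - b * t ^ 2) / (2 * t))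
  have s2 := sq_nonneg (c - b * p)
  have s3 := sq_nonneg (d - b * q)
  have f1 : ((a + b * (p ^ 2 + q ^ 2) - 2 * (c * p + d * q) - b * t ^ 2) / (2 * t)) ^ 2 = 0 := by
    linarith
  have f2 : (c - b * p) ^ 2 = 0 := by linarith
  have f3 : (d - b * q) ^ 2 = 0 := by linarith
  have g1 := (div_eq_zero_iff.1 (pow_eq_zero_iff two_ne_zero |>.1 f1)).resolve_right
    (by positivity)
  have g2 := pow_eq_zero_iff two_ne_zero |>.1 f2
  have g3 := pow_eq_zero_iff two_ne_zero |>.1 f3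
  have hb : b = 0 := by
    have : b * t ^ 2 = 0 := by linarith
    exact (mul_eq_zero.1 this).resolve_right (by positivity)
  subst hb
  have hc : c = 0 := by linarith
  have hd : d = 0 := by linarith
  subst hc hd
  have ha : a = 0 := by linarith
  subst ha
  rfl

/-! ### Causal, timelike and null vectors -/

/-- The closed future cone. -/
def IsCausal (u : Mink) : Prop := 0 ≤ u.1 ∧ 0 ≤ u.2.1 ∧ 0 ≤ lor u u

/-- The open future cone. -/
def IsTime (u : Mink) : Prop := 0 < u.2.1 ∧ 0 < lor u u

/-- The punctured boundary of the future cone. -/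
def IsNull (u : Mink) : Prop := IsCausal u ∧ lor u u = 0 ∧ u ≠ 0

/-- Cauchy–Schwarz bounds the square of the off-diagonal product by `a b a' b'`, and the inequality
of arithmetic and geometric means bounds this by the square of `(a b' + b a') / 2`. -/
theorem IsCausal.lor_nonneg {u w : Mink} (hu : IsCausal u) (hw : IsCausal w) : 0 ≤ lor u w := by
  obtain ⟨a, b, ⟨c, d⟩⟩ := u
  obtain ⟨a', b', ⟨c', d'⟩⟩ := w
  obtain ⟨h1, h2, h3⟩ := hu
  obtain ⟨k1, k2, k3⟩ := hw
  simp only [lor] at *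
  have e1 : c ^ 2 + d ^ 2 ≤ a * b := by nlinarith
  have e2 : c' ^ 2 + d' ^ 2 ≤ a' * b' := by nlinarith
  have e3 : (c * c' + d * d') ^ 2 ≤ (a * b) * (a' * b') := by
    calc (c * c' + d * d') ^ 2 ≤ (c ^ 2 + d ^ 2) * (c' ^ 2 + d' ^ 2) := by
          nlinarith [sq_nonneg (c * d' - d * c')]
      _ ≤ _ := by gcongr
  have e4 : (c * c' + d * d') ^ 2 ≤ ((a * b' + b * a') / 2) ^ 2 := by
    nlinarith [sq_nonneg (a * b' - b * a')]
  have := abs_le_of_sq_le_sq e4 (by positivity)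
  linarith [le_abs_self (c * c' + d * d')]

theorem IsCausal.add {u w : Mink} (hu : IsCausal u) (hw : IsCausal w) : IsCausal (u + w) := by
  refine ⟨add_nonneg hu.1 hw.1, add_nonneg hu.2.1 hw.2.1, ?_⟩
  have := hu.lor_nonneg hw
  have h1 := hu.2.2
  have h2 := hw.2.2
  rw [lor_add_left, lor_add_right, lor_add_right, lor_comm w u]
  linarith

theorem IsCausal.smul {u : Mink} (hu : IsCausal u) {c : ℝ} (hc : 0 ≤ c) : IsCausal (c • u) := by
  refine ⟨mul_nonneg hc hu.1, mul_nonneg hc hu.2.1, ?_⟩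
  rw [lor_smul_left, lor_smul_right]
  exact mul_nonneg hc (mul_nonneg hc hu.2.2)

theorem isCausal_zero : IsCausal 0 := by simp [IsCausal, lor]

theorem IsTime.causal {u : Mink} (hu : IsTime u) : IsCausal u := by
  refine ⟨?_, hu.1.le, hu.2.le⟩
  have h := hu.2
  simp only [lor] at h
  have : 0 < u.1 * u.2.1 := by nlinarith [mul_self_nonneg u.2.2.re, mul_self_nonneg u.2.2.im]
  exact (pos_of_mul_pos_left this hu.1.le).le

theorem IsCausal.time {u : Mink} (hu : IsCausal u) (h : 0 < lor u u) : IsTime u := by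
  refine ⟨hu.2.1.lt_of_ne ?_, h⟩
  intro h0
  simp only [lor, ← h0] at h
  nlinarith [mul_self_nonneg u.2.2.re, mul_self_nonneg u.2.2.im]

theorem isTime_vec (x : H3) : IsTime (vec x) :=
  ⟨one_div_pos.2 x.t_pos, by rw [lor_vec_self]; exact one_pos⟩

theorem IsTime.smul {u : Mink} (hu : IsTime u) {c : ℝ} (hc : 0 < c) : IsTime (c • u) := by
  refine ⟨mul_pos hc hu.1, ?_⟩
  rw [lor_smul_left, lor_smul_right]
  exact mul_pos hc (mul_pos hc hu.2)

theorem IsTime.add {u w : Mink} (hu : IsTime u) (hw : IsCausal w) : IsTime (u + w) := by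
  refine (hu.causal.add hw).time ?_
  have := hu.causal.lor_nonneg hw
  have h1 := hu.2
  have h2 := hw.2.2
  rw [lor_add_left, lor_add_right, lor_add_right, lor_comm w u]
  linarith

theorem isOpen_isTime : IsOpen {u | IsTime u} :=
  (isOpen_lt (f := fun _ => (0 : ℝ)) (g := fun u : Mink => u.2.1) continuous_const
    (by fun_prop)).inter (isOpen_lt continuous_const continuous_lor_self)

open Classical in
/-- The radial projection of the open future cone to the hyperboloid. -/
def nrm (u : Mink) : H3 :=
  if h : IsTime u then ⟨(1 / u.2.1 : ℝ) • u.2.2, √(lor u u) / u.2.1,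
    div_pos (Real.sqrt_pos.2 h.2) h.1⟩ else ⟨0, 1, one_pos⟩

theorem vec_eq_inv_smul {x : H3} {u : Mink} {r : ℝ} (hb : 0 < u.2.1) (hr : 0 < r)
    (hr2 : r ^ 2 = lor u u) (hz : x.z = (1 / u.2.1 : ℝ) • u.2.2) (ht : x.t = r / u.2.1) :
    vec x = r⁻¹ • u := by
  obtain ⟨a, b, w⟩ := u
  simp only at hb hz ht
  have h1 : (‖x.z‖ ^ 2 + x.t ^ 2) / x.t = r⁻¹ * a := by
    rw [hz, ht, ← Complex.normSq_eq_norm_sq, Complex.normSq_apply, Complex.smul_re,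
      Complex.smul_im, smul_eq_mul, smul_eq_mul]
    simp only [lor] at hr2
    field_simp
    rw [hr2]
    ring
  have h2 : 1 / x.t = r⁻¹ * b := by rw [ht]; field_simp
  have h3 : (1 / x.t : ℝ) • x.z = r⁻¹ • w := by
    rw [hz, ht, smul_smul]
    congr 1
    field_simp
  exact Prod.ext h1 (Prod.ext h2 h3)

theorem vec_nrm {u : Mink} (hu : IsTime u) : vec (nrm u) = (√(lor u u))⁻¹ • u := by
  apply vec_eq_inv_smul hu.1 (Real.sqrt_pos.2 hu.2) (Real.sq_sqrt hu.2.le)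
  · rw [nrm, dif_pos hu]
  · rw [nrm, dif_pos hu]

theorem vec_nrm' {u : Mink} (hu : IsTime u) : ∃ r : ℝ, 0 < r ∧ r ^ 2 = lor u u ∧
    u = r • vec (nrm u) :=
  ⟨√(lor u u), Real.sqrt_pos.2 hu.2, Real.sq_sqrt hu.2.le, by
    rw [vec_nrm hu, smul_inv_smul₀ (Real.sqrt_pos.2 hu.2).ne']⟩

theorem eq_of_smul_vec_eq {x y : H3} {r s : ℝ} (hr : 0 < r) (hs : 0 < s)
    (h : r • vec x = s • vec y) : x = y := by
  have h1 : r ^ 2 = s ^ 2 := by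
    have := congrArg (fun u => lor u u) h
    simp only [lor_smul_left, lor_smul_right, lor_vec_self] at this
    linarith
  have h2 : r = s := by rwa [sq_eq_sq₀ hr.le hs.le] at h1
  subst h2
  exact vec_injective (smul_right_injective _ hr.ne' h)

theorem nrm_smul_vec (x : H3) {r : ℝ} (hr : 0 < r) : nrm (r • vec x) = x := by
  obtain ⟨s, hs, -, h⟩ := vec_nrm' ((isTime_vec x).smul hr)
  exact (eq_of_smul_vec_eq hr hs h).symm

theorem nrm_vec (x : H3) : nrm (vec x) = x := by
  simpa using nrm_smul_vec x one_pos

theorem IsNull.causal {n : Mink} (h : IsNull n) : IsCausal n := h.1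

theorem IsNull.self {n : Mink} (h : IsNull n) : lor n n = 0 := h.2.1

theorem IsNull.ne_zero {n : Mink} (h : IsNull n) : n ≠ 0 := h.2.2

theorem IsNull.smul {n : Mink} (h : IsNull n) {c : ℝ} (hc : 0 < c) : IsNull (c • n) :=
  ⟨h.1.smul hc.le, by rw [lor_smul_left, lor_smul_right, h.self]; simp,
    smul_ne_zero hc.ne' h.ne_zero⟩

theorem IsNull.lor_vec_pos {n : Mink} (h : IsNull n) (x : H3) : 0 < lor n (vec x) :=
  (h.1.lor_nonneg (isTime_vec x).causal).lt_of_ne fun h0 =>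
    h.ne_zero (eq_zero_of_lor_vec_eq_zero h0.symm h.self.ge)

/-- The basic inequality between the heights of a point above two ideal points. -/
theorem IsNull.lor_le {n m : Mink} (hn : IsNull n) (hm : IsNull m) (x : H3) :
    lor n m ≤ 2 * lor n (vec x) * lor m (vec x) := by
  have h1 := hn.lor_vec_pos x
  have h2 := hm.lor_vec_pos x
  -- The weights give both null vectors the same product with `vec x`. Reversed Cauchy–Schwarz for
  -- their sum is the claim multiplied by a positive factor.
  have h := lor_self_le_sq (lor m (vec x) • n + lor n (vec x) • m) x
  simp only [lor_add_left, lor_add_right, lor_smul_left, lor_smul_right, hn.self, hm.self,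
    lor_comm m n] at h
  have : lor n (vec x) * lor m (vec x) * lor n m ≤
      lor n (vec x) * lor m (vec x) * (2 * lor n (vec x) * lor m (vec x)) := by nlinarith
  exact le_of_mul_le_mul_left this (mul_pos h1 h2)

/-- The equality case of `IsNull.lor_le`: the difference of the two sides is orthogonal to `vec x`
and has Lorentz square zero, so it vanishes by definiteness. -/
theorem IsNull.eq_of_lor_eq {n m : Mink} (hn : IsNull n) (hm : IsNull m) {x : H3}
    (h : lor n m = 2 * lor n (vec x) * lor m (vec x)) :
    lor m (vec x) • n + lor n (vec x) • m = (2 * lor n (vec x) * lor m (vec x)) • vec x := by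
  rw [← sub_eq_zero]
  apply eq_zero_of_lor_vec_eq_zero (x := x)
  · simp only [lor_add_left, lor_sub_left, lor_smul_left, lor_vec_self]
    ring
  · simp only [lor_add_left, lor_sub_left, lor_smul_left, lor_vec_self, lor_add_right,
      lor_sub_right, lor_smul_right, hn.self, hm.self, lor_comm m n, h, lor_comm (vec x)]
    apply le_of_eq
    ring

/-- Orthogonal null vectors are parallel. -/
theorem IsNull.parallel {n m : Mink} (hn : IsNull n) (hm : IsNull m) (h : lor n m = 0) :
    ∃ r : ℝ, 0 < r ∧ m = r • n := by
  let x : H3 := ⟨0, 1, one_pos⟩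
  have h1 := hn.lor_vec_pos x
  have h2 := hm.lor_vec_pos x
  refine ⟨lor m (vec x) / lor n (vec x), div_pos h2 h1, ?_⟩
  have : lor n (vec x) • m - lor m (vec x) • n = 0 := by
    apply eq_zero_of_lor_vec_eq_zero (x := x)
    · simp only [lor_sub_left, lor_smul_left]
      ring
    · simp only [lor_sub_left, lor_smul_left, lor_sub_right, lor_smul_right, hn.self, hm.self,
        lor_comm m n, h]
      simp
  rw [sub_eq_zero] at this
  rw [div_eq_inv_mul, mul_smul, ← this, inv_smul_smul₀ h1.ne']

theorem IsNull.lor_pos_or_parallel {n m : Mink} (hn : IsNull n) (hm : IsNull m) :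
    0 < lor n m ∨ ∃ r : ℝ, 0 < r ∧ m = r • n := by
  rcases (hn.1.lor_nonneg hm.1).lt_or_eq with h | h
  · exact Or.inl h
  · exact Or.inr (hn.parallel hm h.symm)

theorem isTime_add_of_lor_pos {n m : Mink} (hn : IsCausal n) (hm : IsCausal m)
    (h : 0 < lor n m) : IsTime (n + m) := by
  refine (hn.add hm).time ?_
  rw [lor_add_left, lor_add_right, lor_add_right, lor_comm m n]
  have := hn.2.2
  have := hm.2.2
  linarith

/-! ### Topology -/

/-- Four points of `H3` whose vectors span Minkowski space. -/
def framePt : Fin 4 → H3 :=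
  ![⟨0, 1, one_pos⟩, ⟨0, 2, two_pos⟩, ⟨1, 1, one_pos⟩, ⟨Complex.I, 1, one_pos⟩]

/-- The coordinates of a vector with respect to the vectors of `framePt`. -/
def frameCoord : Fin 4 → Mink →ₗ[ℝ] ℝ :=
  let f1 : Mink →ₗ[ℝ] ℝ := LinearMap.fst ℝ ℝ (ℝ × ℂ)
  let f2 : Mink →ₗ[ℝ] ℝ := LinearMap.fst ℝ ℝ ℂ ∘ₗ LinearMap.snd ℝ ℝ (ℝ × ℂ)
  let f3 : Mink →ₗ[ℝ] ℝ := Complex.reLm ∘ₗ LinearMap.snd ℝ ℝ ℂ ∘ₗ LinearMap.snd ℝ ℝ (ℝ × ℂ)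
  let f4 : Mink →ₗ[ℝ] ℝ := Complex.imLm ∘ₗ LinearMap.snd ℝ ℝ ℂ ∘ₗ LinearMap.snd ℝ ℝ (ℝ × ℂ)
  ![(1 / 3 : ℝ) • ((4 : ℝ) • f2 - f1 - (2 : ℝ) • f3 - (2 : ℝ) • f4),
    (2 / 3 : ℝ) • (f1 - f2 - f3 - f4), f3, f4]

theorem sum_frameCoord (u : Mink) : ∑ i, frameCoord i u • vec (framePt i) = u := by
  obtain ⟨a, b, w⟩ := u
  simp only [Fin.sum_univ_four, frameCoord, framePt, vec]
  refine Prod.ext ?_ (Prod.ext ?_ (Complex.ext ?_ ?_)) <;> simp <;> ring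

/-- The products with the four frame points are hyperbolic cosines of distances, hence continuous,
and the coordinates of a vector are fixed linear combinations of these products. -/
theorem continuous_vec : Continuous vec := by
  have h (i : Fin 4) : Continuous fun y => lor (vec (framePt i)) (vec y) := by
    simp only [lor_vec_vec]
    exact Real.continuous_cosh.comp (continuous_const.dist continuous_id)
  have h0 := h 0
  have h1 := h 1
  have h2 := h 2
  have h3 := h 3
  have e (u : Mink) : u = (
      (2 / 3 : ℝ) * (4 * lor (vec (framePt 0)) u - 2 * lor (vec (framePt 1)) u),
      (2 / 3 : ℝ) * (2 * lor (vec (framePt 1)) u - lor (vec (framePt 0)) u),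
      (⟨(2 / 3 : ℝ) * (lor (vec (framePt 0)) u + lor (vec (framePt 1)) u) -
          lor (vec (framePt 2)) u,
        (2 / 3 : ℝ) * (lor (vec (framePt 0)) u + lor (vec (framePt 1)) u) -
          lor (vec (framePt 3)) u⟩ : ℂ)) := by
    obtain ⟨a, b, w⟩ := u
    refine Prod.ext ?_ (Prod.ext ?_ (Complex.ext ?_ ?_)) <;> simp [framePt, vec, lor] <;> ring
  rw [show vec = _ from funext fun x => e (vec x)]
  refine Continuous.prodMk (by fun_prop) (Continuous.prodMk (by fun_prop) ?_)
  simp only [Complex.mk_eq_add_mul_I]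
  fun_prop

/-- The ball of radius `ε` about `x` is cut out by the linear condition `lor (vec x) u < cosh ε`. -/
theorem isInducing_vec : Topology.IsInducing vec := by
  rw [Topology.isInducing_iff_nhds]
  intro x
  refine le_antisymm (Filter.map_le_iff_le_comap.1 continuous_vec.continuousAt) ?_
  rw [Metric.nhds_basis_ball.ge_iff]
  intro ε hε
  refine ⟨{u | lor (vec x) u < Real.cosh ε}, ?_, ?_⟩
  · apply (isOpen_lt (continuous_lor_right _) continuous_const).mem_nhds
    simpa [lor_vec_self] using hε.ne'
  · intro y hy
    simp only [Set.mem_preimage, Set.mem_ofPred_eq, lor_vec_vec, Real.cosh_lt_cosh,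
      abs_of_pos hε, abs_of_nonneg dist_nonneg] at hy
    rwa [Metric.mem_ball']

theorem continuousOn_nrm : ContinuousOn nrm {u | IsTime u} := by
  rw [isInducing_vec.continuousOn_iff]
  have : ContinuousOn (fun u : Mink => (√(lor u u))⁻¹ • u) {u | IsTime u} := by
    have h : ContinuousOn (fun u : Mink => (√(lor u u))⁻¹) {u | IsTime u} :=
      ContinuousOn.inv₀ (Real.continuous_sqrt.comp continuous_lor_self).continuousOn ?_
    · exact h.smul continuousOn_id
    · exact fun u hu => (Real.sqrt_pos.2 hu.2).ne'
  exact this.congr fun u hu => vec_nrm hu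

theorem tendsto_perturb (x : H3) (u : Mink) :
    Filter.Tendsto (fun ε : ℝ => nrm (vec x + ε • u)) (nhds 0) (nhds x) := by
  have h1 : Filter.Tendsto nrm (nhds (vec x)) (nhds x) := by
    conv => arg 3; rw [← nrm_vec x]
    exact continuousOn_nrm.continuousAt (isOpen_isTime.mem_nhds (isTime_vec x))
  have h2 : Filter.Tendsto (fun ε : ℝ => vec x + ε • u) (nhds 0) (nhds (vec x)) := by
    have : Continuous fun ε : ℝ => vec x + ε • u := by fun_prop
    simpa using this.tendsto 0
  exact h1.comp h2

theorem eventually_isTime_perturb (x : H3) (u : Mink) :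
    ∀ᶠ ε : ℝ in nhds 0, IsTime (vec x + ε • u) := by
  have h2 : Filter.Tendsto (fun ε : ℝ => vec x + ε • u) (nhds 0) (nhds (vec x)) := by
    have : Continuous fun ε : ℝ => vec x + ε • u := by fun_prop
    simpa using this.tendsto 0
  exact h2 (isOpen_isTime.mem_nhds (isTime_vec x))

/-- Points close to `x` in any given direction. -/
theorem exists_perturb {x : H3} {U : Set H3} (hU : U ∈ nhds x) (u : Mink) {δ : ℝ} (hδ : 0 < δ) :
    ∃ ε, 0 < ε ∧ ε < δ ∧ ∃ y ∈ U, ∃ r : ℝ, 0 < r ∧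
      r ^ 2 = lor (vec x + ε • u) (vec x + ε • u) ∧ vec x + ε • u = r • vec y := by
  have h := (((tendsto_perturb x u).eventually_mem hU).and (eventually_isTime_perturb x u)).filter_mono
    (nhdsWithin_le_nhds (s := Set.Ioi 0))
  obtain ⟨ε, ⟨h1, h2⟩, h3⟩ := (h.and (Ioo_mem_nhdsGT hδ)).exists
  exact ⟨ε, h3.1, h3.2, _, h1, vec_nrm' h2⟩

/-! ### Isometries -/

/-- The linear map with the given values at the points of the frame. -/
def frameMap (f : H3 → H3) : Mink →ₗ[ℝ] Mink :=
  ∑ i, (frameCoord i).smulRight (vec (f (framePt i)))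

theorem frameMap_apply (f : H3 → H3) (u : Mink) :
    frameMap f u = ∑ i, frameCoord i u • vec (f (framePt i)) := by
  simp [frameMap]

/-- Agreement on the frame propagates to all points because products are preserved: the difference
of the two vectors is orthogonal to `vec (f x)` and has Lorentz square zero. -/
theorem frameMap_vec {f : H3 → H3} (hf : Isometry f) (x : H3) :
    frameMap f (vec x) = vec (f x) := by
  have key (x y : H3) : lor (vec (f x)) (vec (f y)) = lor (vec x) (vec y) := by
    rw [lor_vec_vec, lor_vec_vec, hf.dist_eq]
  have h1 (y : H3) : lor (frameMap f (vec x)) (vec (f y)) = lor (vec x) (vec y) := by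
    conv_rhs => rw [← sum_frameCoord (vec x)]
    simp only [frameMap_apply, lor_sum_left, lor_smul_left, key]
  have h2 : lor (frameMap f (vec x)) (frameMap f (vec x)) = 1 := by
    conv_lhs => arg 2; rw [frameMap_apply]
    simp only [lor_sum_right, lor_smul_right, h1]
    simp only [← lor_smul_right, ← lor_sum_right, sum_frameCoord, lor_vec_self]
  rw [← sub_eq_zero]
  apply eq_zero_of_lor_vec_eq_zero (x := f x)
  · rw [lor_sub_left, h1, lor_vec_self, lor_vec_self, sub_self]
  · rw [lor_sub_left, lor_sub_right, lor_sub_right, lor_comm (vec (f x)), h1, h2, lor_vec_self,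
      lor_vec_self]
    norm_num

/-- `L` is the Lorentz transformation induced by the isometry `g`. -/
def Induces (g : H3 ≃ᵢ H3) (L : Mink ≃ₗ[ℝ] Mink) : Prop :=
  (∀ x, L (vec x) = vec (g x)) ∧ ∀ u w, lor (L u) (L w) = lor u w

theorem exists_induces (g : H3 ≃ᵢ H3) : ∃ L, Induces g L := by
  have c (f k : H3 → H3) (hf : Isometry f) (hk : Isometry k) (h : ∀ x, f (k x) = x) (u : Mink) :
      frameMap f (frameMap k u) = u := by
    conv_rhs => rw [← sum_frameCoord u]
    rw [frameMap_apply k, map_sum]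
    simp only [map_smul, frameMap_vec hf, h]
  refine ⟨LinearEquiv.ofLinearMap (frameMap g) (frameMap g.symm)
    (LinearMap.ext <| c _ _ g.isometry g.symm.isometry g.apply_symm_apply)
    (LinearMap.ext <| c _ _ g.symm.isometry g.isometry g.symm_apply_apply), ?_, ?_⟩
  · exact frameMap_vec g.isometry
  · intro u w
    conv_rhs => rw [← sum_frameCoord u, ← sum_frameCoord w]
    simp only [LinearEquiv.coe_ofLinearMap, frameMap_apply, lor_sum_left, lor_sum_right,
      lor_smul_left, lor_smul_right, lor_vec_vec, g.isometry.dist_eq]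

/-- An involutive Lorentz transformation that preserves the future comes from an isometry. -/
theorem exists_isometry_of_involutive (L : Mink →ₗ[ℝ] Mink) (h1 : ∀ u, L (L u) = u)
    (h2 : ∀ u w, lor (L u) (L w) = lor u w) (h3 : ∀ x, IsTime (L (vec x))) :
    ∃ g : H3 ≃ᵢ H3, ∀ x, vec (g x) = L (vec x) := by
  have e (x : H3) : vec (nrm (L (vec x))) = L (vec x) := by
    rw [vec_nrm (h3 x), h2, lor_vec_self]; simp
  have e2 (x : H3) : nrm (L (vec (nrm (L (vec x))))) = x := by rw [e, h1, nrm_vec]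
  refine ⟨⟨⟨fun x => nrm (L (vec x)), fun x => nrm (L (vec x)), e2, e2⟩, ?_⟩, e⟩
  refine Isometry.of_dist_eq fun x y => ?_
  have : Real.cosh (dist (nrm (L (vec x))) (nrm (L (vec y)))) = Real.cosh (dist x y) := by
    rw [← lor_vec_vec, ← lor_vec_vec, e, e, h2]
  exact Real.cosh_injOn dist_nonneg dist_nonneg this

/-! ### Segments and convexity -/

/-- Equality in the triangle inequality becomes a conic combination, so convex sets of `H3` are
slices of convex cones. In one direction the coefficients are ratios of hyperbolic sines; the
corresponding combination of `x`, `y`, `w` is orthogonal to `w` with Lorentz square zero. In the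
other, the coefficients give `cosh` and `sinh` of both parts, and the addition formula recovers
`cosh (dist x y)`. -/
theorem mem_segment_iff {x y w : H3} :
    w ∈ segment x y ↔ ∃ α β : ℝ, 0 ≤ α ∧ 0 ≤ β ∧ vec w = α • vec x + β • vec y := by
  have ha : 0 ≤ Real.sinh (dist x w) := Real.sinh_nonneg_iff.2 dist_nonneg
  have hb : 0 ≤ Real.sinh (dist w y) := Real.sinh_nonneg_iff.2 dist_nonneg
  have hc : 0 ≤ Real.sinh (dist x y) := Real.sinh_nonneg_iff.2 dist_nonneg
  have ha2 := Real.cosh_sq (dist x w)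
  have hb2 := Real.cosh_sq (dist w y)
  have hc2 := Real.cosh_sq (dist x y)
  have la := lor_vec_vec x w
  have lb := lor_vec_vec w y
  have lc := lor_vec_vec x y
  constructor
  · intro h
    have h : dist x w + dist w y = dist x y := h
    rcases (dist_nonneg (x := x) (y := y)).eq_or_lt with h0 | h0
    · have : dist x w = 0 := by
        linarith [dist_nonneg (x := x) (y := w), dist_nonneg (x := w) (y := y)]
      exact ⟨1, 0, zero_le_one, le_rfl, by rw [dist_eq_zero.1 this]; simp⟩
    have hs : 0 < Real.sinh (dist x y) := Real.sinh_pos_iff.2 h0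
    have e1 : Real.sinh (dist x y) = Real.sinh (dist x w) * Real.cosh (dist w y) +
        Real.cosh (dist x w) * Real.sinh (dist w y) := by rw [← h, Real.sinh_add]
    have e2 : Real.cosh (dist x y) = Real.cosh (dist x w) * Real.cosh (dist w y) +
        Real.sinh (dist x w) * Real.sinh (dist w y) := by rw [← h, Real.cosh_add]
    refine ⟨Real.sinh (dist w y) / Real.sinh (dist x y),
      Real.sinh (dist x w) / Real.sinh (dist x y), by positivity, by positivity, ?_⟩
    have key : Real.sinh (dist w y) • vec x + Real.sinh (dist x w) • vec y -
        Real.sinh (dist x y) • vec w = 0 := by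
      apply eq_zero_of_lor_vec_eq_zero (x := w)
      · simp only [lor_sub_left, lor_add_left, lor_smul_left, lor_vec_self, la, lor_comm (vec y), lb,
          e1]
        ring
      · simp only [lor_sub_left, lor_add_left, lor_smul_left, lor_sub_right, lor_add_right,
          lor_smul_right, lor_vec_self, la, lor_comm (vec y), lor_comm (vec w) (vec x), lb, lc, e1,
          e2]
        apply le_of_eq
        generalize Real.sinh (dist w y) = p at *
        generalize Real.sinh (dist x w) = q at *
        generalize Real.cosh (dist w y) = P at *
        generalize Real.cosh (dist x w) = Q at *
        linear_combination q ^ 2 * hb2 + p ^ 2 * ha2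
    rw [sub_eq_zero] at key
    rw [div_eq_inv_mul, div_eq_inv_mul, mul_smul, mul_smul, ← smul_add, key, inv_smul_smul₀ hs.ne']
  · rintro ⟨α, β, hα, hβ, h⟩
    have k1 : Real.cosh (dist x w) = α + β * Real.cosh (dist x y) := by
      rw [← la, h, lor_add_right, lor_smul_right, lor_smul_right, lor_vec_self, lc]; ring
    have k2 : Real.cosh (dist w y) = α * Real.cosh (dist x y) + β := by
      rw [← lb, h, lor_add_left, lor_smul_left, lor_smul_left, lor_vec_self, lc]; ring
    have k3 : α ^ 2 + β ^ 2 + 2 * α * β * Real.cosh (dist x y) = 1 := by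
      have := lor_vec_self w
      rw [h] at this
      simp only [lor_add_left, lor_smul_left, lor_add_right, lor_smul_right, lor_vec_self,
        lor_comm (vec y), lc] at this
      linarith
    have k4 : Real.sinh (dist x w) = β * Real.sinh (dist x y) := by
      rw [← sq_eq_sq₀ ha (by positivity)]
      linear_combination -ha2 + β ^ 2 * hc2 + (Real.cosh (dist x w) + (α + β * Real.cosh (dist x y))) * k1 + k3
    have k5 : Real.sinh (dist w y) = α * Real.sinh (dist x y) := by
      rw [← sq_eq_sq₀ hb (by positivity)]
      linear_combination -hb2 + α ^ 2 * hc2 + (Real.cosh (dist w y) + (α * Real.cosh (dist x y) + β)) * k2 + k3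
    have k6 : Real.cosh (dist x w + dist w y) = Real.cosh (dist x y) := by
      rw [Real.cosh_add, k1, k2, k4, k5]
      linear_combination Real.cosh (dist x y) * k3 - α * β * hc2
    exact Real.cosh_injOn (add_nonneg dist_nonneg dist_nonneg) dist_nonneg k6

theorem IsConvex.mem_of_smul {C : Set H3} (hC : IsConvex C) {x y w : H3} (hx : x ∈ C) (hy : y ∈ C)
    {r α β : ℝ} (hr : 0 < r) (hα : 0 ≤ α) (hβ : 0 ≤ β) (h : r • vec w = α • vec x + β • vec y) :
    w ∈ C := by
  refine hC x hx y hy (mem_segment_iff.2 ⟨r⁻¹ * α, r⁻¹ * β, by positivity, by positivity, ?_⟩)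
  rw [mul_smul, mul_smul, ← smul_add, ← h, inv_smul_smul₀ hr.ne']

theorem isConvex_of {C : Set H3} (h : ∀ x ∈ C, ∀ y ∈ C, ∀ w : H3, ∀ α β : ℝ, 0 ≤ α → 0 ≤ β →
    vec w = α • vec x + β • vec y → w ∈ C) : IsConvex C := by
  intro x hx y hy w hw
  obtain ⟨α, β, hα, hβ, e⟩ := mem_segment_iff.1 hw
  exact h x hx y hy w α β hα hβ e

theorem hull_subset {S C : Set H3} (hC : IsConvex C) (h : S ⊆ C) : hull S ⊆ C :=
  Set.sInter_subset_of_mem ⟨hC, h⟩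

/-! ### Cones and the cells they cut out -/

/-- The convex cone generated by a finite set. -/
def cone (V : Finset Mink) : Set Mink :=
  {u | ∃ c : Mink → ℝ, (∀ n, 0 ≤ c n) ∧ u = ∑ n ∈ V, c n • n}

/-- The part of hyperbolic space that lies in the cone generated by `V`. -/
def cell (V : Finset Mink) : Set H3 := {x | vec x ∈ cone V}

theorem zero_mem_cone (V : Finset Mink) : (0 : Mink) ∈ cone V :=
  ⟨0, fun _ => le_rfl, by simp⟩

theorem add_mem_cone {V : Finset Mink} {u w : Mink} (hu : u ∈ cone V) (hw : w ∈ cone V) :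
    u + w ∈ cone V := by
  obtain ⟨c, hc, rfl⟩ := hu
  obtain ⟨d, hd, rfl⟩ := hw
  exact ⟨c + d, fun n => add_nonneg (hc n) (hd n), by simp [add_smul, Finset.sum_add_distrib]⟩

theorem smul_mem_cone {V : Finset Mink} {u : Mink} (hu : u ∈ cone V) {r : ℝ} (hr : 0 ≤ r) :
    r • u ∈ cone V := by
  obtain ⟨c, hc, rfl⟩ := hu
  exact ⟨fun n => r * c n, fun n => mul_nonneg hr (hc n), by simp [Finset.smul_sum, mul_smul]⟩

theorem sum_mem_cone {ι : Type*} {V : Finset Mink} {s : Finset ι} {f : ι → Mink}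
    (h : ∀ i ∈ s, f i ∈ cone V) : ∑ i ∈ s, f i ∈ cone V :=
  Finset.sum_induction f (· ∈ cone V) (fun _ _ => add_mem_cone) (zero_mem_cone V) h

theorem mem_cone_of_mem {V : Finset Mink} {n : Mink} (hn : n ∈ V) : n ∈ cone V := by
  classical
  refine ⟨fun m => if m = n then 1 else 0, fun m => by dsimp only; split_ifs <;> norm_num, ?_⟩
  simp [ite_smul, hn]

theorem cone_subset {V W : Finset Mink} (h : ∀ n ∈ V, n ∈ cone W) : cone V ⊆ cone W := by
  rintro u ⟨c, hc, rfl⟩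
  exact sum_mem_cone fun n hn => smul_mem_cone (h n hn) (hc n)

theorem cone_mono {V W : Finset Mink} (h : V ⊆ W) : cone V ⊆ cone W :=
  cone_subset fun _ hn => mem_cone_of_mem (h hn)

theorem cell_mono {V W : Finset Mink} (h : V ⊆ W) : cell V ⊆ cell W := fun _ hx => cone_mono h hx

theorem cell_subset {V W : Finset Mink} (h : ∀ n ∈ V, n ∈ cone W) : cell V ⊆ cell W :=
  fun _ hx => cone_subset h hx

theorem mem_cell_of_smul {V : Finset Mink} {x : H3} {r : ℝ} (hr : 0 < r)
    (h : r • vec x ∈ cone V) : x ∈ cell V := by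
  have := smul_mem_cone h (inv_nonneg.2 hr.le)
  rwa [inv_smul_smul₀ hr.ne'] at this

theorem mem_cone_pair {n m u : Mink} (h : n ≠ m) :
    u ∈ cone {n, m} ↔ ∃ α β : ℝ, 0 ≤ α ∧ 0 ≤ β ∧ u = α • n + β • m := by
  constructor
  · rintro ⟨c, hc, rfl⟩
    exact ⟨c n, c m, hc n, hc m, Finset.sum_pair h⟩
  · rintro ⟨α, β, hα, hβ, rfl⟩
    exact add_mem_cone (smul_mem_cone (mem_cone_of_mem (by simp)) hα)
      (smul_mem_cone (mem_cone_of_mem (by simp)) hβ)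

theorem isConvex_cell (V : Finset Mink) : IsConvex (cell V) :=
  isConvex_of fun x hx y hy w α β hα hβ h => by
    change vec w ∈ cone V
    rw [h]
    exact add_mem_cone (smul_mem_cone hx hα) (smul_mem_cone hy hβ)

theorem cone_image (L : Mink ≃ₗ[ℝ] Mink) (V : Finset Mink) :
    cone (V.image L) = L '' cone V := by
  ext u
  constructor
  · rintro ⟨c, hc, rfl⟩
    refine ⟨∑ n ∈ V, c (L n) • n, ⟨fun n => c (L n), fun n => hc _, rfl⟩, ?_⟩
    rw [Finset.sum_image fun a _ b _ h => L.injective h, map_sum]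
    simp
  · rintro ⟨_, ⟨c, hc, rfl⟩, rfl⟩
    rw [map_sum]
    exact sum_mem_cone fun n hn => by
      rw [map_smul]
      exact smul_mem_cone (mem_cone_of_mem (Finset.mem_image_of_mem _ hn)) (hc n)

theorem Induces.image_cell {g : H3 ≃ᵢ H3} {L : Mink ≃ₗ[ℝ] Mink} (h : Induces g L)
    (V : Finset Mink) : g '' cell V = cell (V.image L) := by
  ext x
  obtain ⟨y, rfl⟩ := g.surjective x
  rw [g.injective.mem_set_image]
  change _ ↔ vec (g y) ∈ cone _
  rw [cone_image, ← h.1, L.injective.mem_set_image]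
  rfl

/-- Only the time direction is at stake, and it is detected by the products with points, which stay
positive. The point `(0, 1)` gives `a + b > 0`; together with `a b ≥ 0` this makes both diagonal
entries nonnegative. -/
theorem Induces.isNull {g : H3 ≃ᵢ H3} {L : Mink ≃ₗ[ℝ] Mink} (h : Induces g L) {n : Mink}
    (hn : IsNull n) : IsNull (L n) := by
  have h0 : lor (L n) (L n) = 0 := by rw [h.2, hn.self]
  have hne : L n ≠ 0 := by simpa using hn.ne_zero
  refine ⟨?_, h0, hne⟩
  have hpos (x : H3) : 0 < lor (L n) (vec x) := by
    obtain ⟨y, rfl⟩ := g.surjective x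
    rw [← h.1, h.2]
    exact hn.lor_vec_pos y
  generalize L n = u at *
  obtain ⟨a, b, ⟨p, q⟩⟩ := u
  have hab : a * b = p ^ 2 + q ^ 2 := by simp only [lor] at h0; linarith
  have h1 := hpos ⟨0, 1, one_pos⟩
  simp [lor, vec] at h1
  have hab' : 0 ≤ a * b := by rw [hab]; positivity
  refine ⟨?_, ?_, h0.ge⟩ <;> simp only <;> nlinarith

/-! ### Horoballs -/

/-- The horoball of a null vector. -/
def hb (n : Mink) : Set H3 := {x | lor n (vec x) ≤ 1}

theorem Induces.image_hb {g : H3 ≃ᵢ H3} {L : Mink ≃ₗ[ℝ] Mink} (h : Induces g L) (n : Mink) :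
    g '' hb n = hb (L n) := by
  ext x
  obtain ⟨y, rfl⟩ := g.surjective x
  rw [g.injective.mem_set_image]
  change _ ↔ lor (L n) (vec (g y)) ≤ 1
  rw [← h.1, h.2]
  rfl

theorem isOpen_lor_lt (n : Mink) : IsOpen {x : H3 | lor n (vec x) < 1} :=
  isOpen_lt ((continuous_lor_right n).comp continuous_vec) continuous_const

theorem IsNull.interior_hb {n : Mink} (hn : IsNull n) :
    interior (hb n) = {x | lor n (vec x) < 1} := by
  apply Set.Subset.antisymm
  · intro x hx
    have hx0 : x ∈ hb n := interior_subset hx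
    have hx1 : lor n (vec x) ≤ 1 := hx0
    refine hx1.lt_of_ne fun h1 => ?_
    -- Subtracting `ε n` leaves the product with `n` equal to 1 and lowers the squared length to `1
    -- - 2 ε`, so the normalized point lies outside the horoball.
    obtain ⟨ε, hε, hε1, y, hy, r, hr, hr2, e⟩ :=
      exists_perturb (mem_interior_iff_mem_nhds.1 hx) (-n) one_pos
    have h2 : lor n (vec x + ε • -n) = 1 := by
      rw [lor_add_right, h1, smul_neg, ← neg_smul, lor_smul_right, hn.self]; ring
    have h3 : r ^ 2 = 1 - 2 * ε := by
      rw [hr2]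
      simp only [smul_neg, ← neg_smul, lor_add_left, lor_add_right, lor_smul_left, lor_smul_right,
        lor_vec_self, hn.self, lor_comm (vec x) n, h1]
      ring
    rw [e, lor_smul_right] at h2
    have h4 : lor n (vec y) ≤ 1 := hy
    nlinarith
  · exact interior_maximal (fun x (hx : lor n (vec x) < 1) => hx.le) (isOpen_lor_lt n)

/-- The geodesic from `n` to `m` consists of the `α n + β m` with `2 α β lor n m = 1`. Product `s`
with `n` means `β = s / lor n m`, and then `α = 1 / (2 s)`. The two heights always multiply to `lor
n m / 2`. -/
theorem IsNull.exists_geodesic_point {n m : Mink} (hn : IsNull n) (hm : IsNull m)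
    (h : 0 < lor n m) {s : ℝ} (hs : 0 < s) :
    ∃ x, lor n (vec x) = s ∧ lor m (vec x) = lor n m / (2 * s) ∧
      ∃ α β : ℝ, 0 < α ∧ 0 < β ∧ vec x = α • n + β • m := by
  have ht : lor ((1 / (2 * s)) • n + (s / lor n m) • m) ((1 / (2 * s)) • n + (s / lor n m) • m)
      = 1 := by
    simp only [lor_add_left, lor_add_right, lor_smul_left, lor_smul_right, hn.self, hm.self,
      lor_comm m n]
    field_simp
    ring
  have hT : IsTime ((1 / (2 * s)) • n + (s / lor n m) • m) :=
    ((hn.causal.smul (by positivity)).add (hm.causal.smul (by positivity))).time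
      (by rw [ht]; exact one_pos)
  refine ⟨nrm ((1 / (2 * s)) • n + (s / lor n m) • m), ?_, ?_, _, _, ?_, ?_,
    by rw [vec_nrm hT, ht, Real.sqrt_one, inv_one, one_smul]⟩
  · rw [vec_nrm hT, ht, Real.sqrt_one, inv_one, one_smul, lor_add_right, lor_smul_right,
      lor_smul_right, hn.self]
    field_simp
    ring
  · rw [vec_nrm hT, ht, Real.sqrt_one, inv_one, one_smul, lor_add_right, lor_smul_right,
      lor_smul_right, hm.self, lor_comm m n]
    field_simp
    ring
  · positivity
  · positivity

theorem IsNull.exists_transverse {n : Mink} (hn : IsNull n) : ∃ m, IsNull m ∧ 0 < lor n m := by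
  have h1 : IsNull ((1, 0, 0) : Mink) := by
    refine ⟨?_, ?_, ?_⟩ <;> simp [IsCausal, lor]
  have h2 : IsNull ((0, 1, 0) : Mink) := by
    refine ⟨?_, ?_, ?_⟩ <;> simp [IsCausal, lor]
  rcases hn.lor_pos_or_parallel h1 with h | ⟨r, hr, e⟩
  · exact ⟨_, h1, h⟩
  · rcases hn.lor_pos_or_parallel h2 with h | ⟨s, hs, e'⟩
    · exact ⟨_, h2, h⟩
    · have k1 := congrArg Prod.fst e
      have k2 := congrArg Prod.fst e'
      simp only [Prod.smul_fst, smul_eq_mul] at k1 k2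
      rcases mul_eq_zero.1 k2.symm with h | h
      · exact absurd h hs.ne'
      · rw [h, mul_zero] at k1
        exact absurd k1 one_ne_zero

theorem IsNull.exists_lor_eq {n : Mink} (hn : IsNull n) {s : ℝ} (hs : 0 < s) :
    ∃ x, lor n (vec x) = s := by
  obtain ⟨m, hm, h⟩ := hn.exists_transverse
  obtain ⟨x, hx, -⟩ := hn.exists_geodesic_point hm h hs
  exact ⟨x, hx⟩

theorem IsNull.of_hb_subset {n m : Mink} (hn : IsNull n) (hm : IsNull m) (h : hb n ⊆ hb m) :
    ∃ r : ℝ, 0 < r ∧ r ≤ 1 ∧ m = r • n := by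
  rcases hn.lor_pos_or_parallel hm with h0 | ⟨r, hr, rfl⟩
  -- A point on the geodesic, inside `hb n` and so near its center that the product with `m` is at
  -- least 2.
  · have hs : 0 < min 1 (lor n m / 4) := by positivity
    obtain ⟨x, h1, h2, -⟩ := hn.exists_geodesic_point hm h0 hs
    have h3 : lor m (vec x) ≤ 1 := h (show lor n (vec x) ≤ 1 by rw [h1]; exact min_le_left _ _)
    rw [h2, div_le_one (by positivity)] at h3
    linarith [min_le_right 1 (lor n m / 4)]
  · refine ⟨r, hr, ?_, rfl⟩
    obtain ⟨x, hx⟩ := hn.exists_lor_eq one_pos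
    have := h (show lor n (vec x) ≤ 1 by rw [hx])
    change lor (r • n) (vec x) ≤ 1 at this
    rwa [lor_smul_left, hx, mul_one] at this

theorem IsNull.hb_injective {n m : Mink} (hn : IsNull n) (hm : IsNull m) (h : hb n = hb m) :
    n = m := by
  obtain ⟨r, hr, hr1, e⟩ := hn.of_hb_subset hm h.subset
  obtain ⟨s, hs, hs1, e'⟩ := hm.of_hb_subset hn h.symm.subset
  rw [e, smul_smul] at e'
  have h1 : s * r = 1 := by
    by_contra hne
    have : (1 - s * r) • n = 0 := by rw [sub_smul, one_smul, ← e', sub_self]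
    rcases smul_eq_zero.1 this with h | h
    · exact hne (by linarith)
    · exact hn.ne_zero h
  have : r = 1 := by nlinarith
  rw [e, this, one_smul]

/-- If the product is less than 2 and the centers differ, the geodesic point with both heights equal
to `√(lor n m / 2) < 1` is in both interiors; concentric horoballs always overlap. The converse is
`IsNull.lor_le`. -/
theorem IsNull.disjoint_interior_iff {n m : Mink} (hn : IsNull n) (hm : IsNull m) :
    Disjoint (interior (hb n)) (interior (hb m)) ↔ 2 ≤ lor n m := by
  rw [hn.interior_hb, hm.interior_hb]
  constructor
  · intro hd
    replace hd (x : H3) (h1 : lor n (vec x) < 1) : ¬ lor m (vec x) < 1 :=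
      fun h2 => Set.disjoint_left.1 hd h1 h2
    by_contra! hlt
    rcases hn.lor_pos_or_parallel hm with h0 | ⟨r, hr, rfl⟩
    · have hs : 0 < √(lor n m / 2) := Real.sqrt_pos.2 (by positivity)
      have hs2 : √(lor n m / 2) ^ 2 = lor n m / 2 := Real.sq_sqrt (by positivity)
      obtain ⟨x, h1, h2, -⟩ := hn.exists_geodesic_point hm h0 hs
      have hs1 : √(lor n m / 2) < 1 := by nlinarith
      refine hd x (by rwa [h1]) ?_
      rw [h2, div_lt_one (by positivity)]
      nlinarith
    · obtain ⟨x, hx⟩ := hn.exists_lor_eq (s := min (1 / 2) (1 / (2 * r))) (by positivity)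
      have k1 := min_le_left (1 / 2) (1 / (2 * r))
      have k2 := min_le_right (1 / 2) (1 / (2 * r))
      refine hd x (by linarith) ?_
      · simp only [lor_smul_left, hx]
        calc r * min (1 / 2) (1 / (2 * r)) ≤ r * (1 / (2 * r)) := by gcongr
          _ < 1 := by field_simp; norm_num
  · intro h
    rw [Set.disjoint_left]
    intro x h1 h2
    simp only [Set.mem_ofPred_eq] at h1 h2
    have := hn.lor_le hm x
    have p1 := hn.lor_vec_pos x
    have p2 := hm.lor_vec_pos x
    nlinarith

/-- For a point `α x + β y` of a segment, unit length reads `α² + β² + 2 α β cosh d = 1`. Hence `α +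
β ≤ 1`, and the linear bound defining the horoball persists. -/
theorem isConvex_hb (n : Mink) : IsConvex (hb n) := by
  refine isConvex_of fun x hx y hy w α β hα hβ h => ?_
  have hx : lor n (vec x) ≤ 1 := hx
  have hy : lor n (vec y) ≤ 1 := hy
  have e := lor_vec_self w
  rw [h] at e
  simp only [lor_add_left, lor_add_right, lor_smul_left, lor_smul_right, lor_vec_self,
    lor_comm (vec y)] at e
  have h1 : 1 ≤ lor (vec x) (vec y) := by rw [lor_vec_vec]; exact Real.one_le_cosh _
  change lor n (vec w) ≤ 1
  rw [h, lor_add_right, lor_smul_right, lor_smul_right]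
  have : (α + β) ^ 2 ≤ 1 := by nlinarith [mul_nonneg hα hβ]
  have : α + β ≤ 1 := by nlinarith
  nlinarith

/-- A common point attains equality in `IsNull.lor_le` with both heights 1, which forces it to be
the normalization of `n + m`. -/
theorem IsNull.areTangent {n m : Mink} (hn : IsNull n) (hm : IsNull m) (h : lor n m = 2) :
    AreTangent (hb n) (hb m) := by
  obtain ⟨x, h1, h2, -⟩ := hn.exists_geodesic_point hm (by rw [h]; norm_num) one_pos
  have h2' : lor m (vec x) = 1 := by rw [h2, h]; norm_num
  have e (y : H3) (ha : lor n (vec y) ≤ 1) (hb : lor m (vec y) ≤ 1) : n + m = (2 : ℝ) • vec y := by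
    have k := hn.lor_le hm y
    have p1 := hn.lor_vec_pos y
    have p2 := hm.lor_vec_pos y
    have q1 : lor n (vec y) = 1 := by nlinarith
    have q2 : lor m (vec y) = 1 := by nlinarith
    have := hn.eq_of_lor_eq hm (x := y) (by rw [q1, q2, h]; norm_num)
    simpa [q1, q2] using this
  refine ⟨x, Set.eq_singleton_iff_unique_mem.2 ⟨⟨h1.le, h2'.le⟩, fun y hy => ?_⟩⟩
  exact eq_of_smul_vec_eq two_pos two_pos ((e y hy.1 hy.2).symm.trans (e x h1.le h2'.le))

theorem IsNull.not_areTangent_self {n : Mink} (hn : IsNull n) : ¬ AreTangent (hb n) (hb n) := by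
  rintro ⟨x, hx⟩
  rw [Set.inter_self] at hx
  obtain ⟨y, hy⟩ := hn.exists_lor_eq (s := 1) one_pos
  obtain ⟨z, hz⟩ := hn.exists_lor_eq (s := 1 / 2) (by norm_num)
  have h1 : y ∈ hb n := hy.le
  have h2 : z ∈ hb n := by change lor n (vec z) ≤ 1; rw [hz]; norm_num
  rw [hx] at h1 h2
  rw [Set.mem_singleton_iff] at h1 h2
  rw [h1] at hy
  rw [h2] at hz
  linarith

/-! ### Ideal points -/

/-- The normalized null vector of an ideal point. -/
def nv : IdealPoint → Mink
  | none => (1, 0, 0)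
  | some a => (‖a‖ ^ 2, 1, a)

theorem isNull_nv (p : IdealPoint) : IsNull (nv p) := by
  rcases p with _ | a
  · refine ⟨?_, ?_, ?_⟩ <;> simp [IsCausal, lor, nv]
  · have h : lor (nv (some a)) (nv (some a)) = 0 := by
      simp only [lor, nv, ← Complex.normSq_eq_norm_sq, Complex.normSq_apply]
      ring
    refine ⟨⟨?_, ?_, h.ge⟩, h, ?_⟩
    · simp [nv]
    · simp [nv]
    · simp [nv]

theorem eq_of_smul_nv {p q : IdealPoint} {r : ℝ} (h : nv p = r • nv q) : p = q := by
  rcases p with _ | a <;> rcases q with _ | b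
  · rfl
  · have h1 := congrArg (fun u => u.2.1) h
    have h2 := congrArg (fun u => u.1) h
    simp only [nv, Prod.smul_fst, Prod.smul_snd, smul_eq_mul, mul_one] at h1 h2
    rw [← h1, zero_mul] at h2
    exact absurd h2 one_ne_zero
  · have h1 := congrArg (fun u => u.2.1) h
    simp [nv] at h1
  · have h1 := congrArg (fun u => u.2.1) h
    have h2 := congrArg (fun u => u.2.2) h
    simp only [nv, Prod.smul_snd, Prod.smul_fst, smul_eq_mul, mul_one] at h1 h2
    rw [← h1, one_smul] at h2
    rw [h2]

theorem nv_injective : Function.Injective nv := fun _ _ h =>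
  eq_of_smul_nv (r := 1) (by rw [h, one_smul])

theorem lor_nv_pos {p q : IdealPoint} (h : p ≠ q) : 0 < lor (nv p) (nv q) := by
  rcases (isNull_nv p).lor_pos_or_parallel (isNull_nv q) with h' | ⟨r, -, e⟩
  · exact h'
  · exact absurd (eq_of_smul_nv e).symm h

theorem IsNull.exists_nv {n : Mink} (hn : IsNull n) : ∃ p, ∃ r : ℝ, 0 < r ∧ n = r • nv p := by
  obtain ⟨⟨h1, h2, -⟩, h3, h4⟩ := hn
  obtain ⟨a, b, w⟩ := n
  simp only at h1 h2
  have e : a * b = w.re ^ 2 + w.im ^ 2 := by simp only [lor] at h3; linarith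
  rcases h2.eq_or_lt with rfl | hb
  · have hw : w = 0 := by
      apply Complex.ext <;> simp <;> nlinarith [sq_nonneg w.re, sq_nonneg w.im]
    subst hw
    have ha : 0 < a := h1.lt_of_ne fun h => h4 (by rw [← h]; rfl)
    exact ⟨OnePoint.infty, a, ha, by
      change _ = a • ((1, 0, 0) : Mink)
      simp⟩
  · refine ⟨((b⁻¹ • w : ℂ) : IdealPoint), b, hb, ?_⟩
    change _ = b • ((‖b⁻¹ • w‖ ^ 2, 1, b⁻¹ • w) : Mink)
    refine Prod.ext ?_ (Prod.ext ?_ ?_)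
    · simp only [Prod.smul_fst, smul_eq_mul, norm_smul, mul_pow, ← Complex.normSq_eq_norm_sq,
        Complex.normSq_apply, Real.norm_eq_abs, sq_abs]
      field_simp
      linarith
    · simp
    · simp [hb.ne']

theorem horofunction_eq (p : IdealPoint) (x : H3) :
    horofunction p x = 1 / (2 * lor (nv p) (vec x)) := by
  have ht := x.t_pos
  rcases p with _ | a
  · simp only [horofunction, lor, nv, vec]
    simp
    ring
  · simp only [horofunction, lor, nv, vec, ← Complex.normSq_eq_norm_sq, Complex.normSq_apply,
      Complex.sub_re, Complex.sub_im, Complex.smul_re, Complex.smul_im, smul_eq_mul]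
    rw [div_eq_div_iff]
    · field_simp
      ring
    · have : 0 < x.t ^ 2 := by positivity
      nlinarith [mul_self_nonneg (x.z.re - a.re), mul_self_nonneg (x.z.im - a.im)]
    · have := (isNull_nv (some a)).lor_vec_pos x
      simp only [lor, nv, vec, ← Complex.normSq_eq_norm_sq, Complex.normSq_apply,
        Complex.smul_re, Complex.smul_im, smul_eq_mul] at this
      linarith

theorem horoball_eq_hb (p : IdealPoint) (r : ℝ) :
    horoball p r = hb ((2 * r) • nv p) := by
  ext x
  have := (isNull_nv p).lor_vec_pos x
  change r ≤ horofunction p x ↔ lor _ _ ≤ 1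
  rw [horofunction_eq, lor_smul_left, le_div_iff₀ (by positivity)]
  constructor <;> intro h <;> linarith

theorem isHoroballAt_iff {p : IdealPoint} {B : Set H3} :
    IsHoroballAt p B ↔ ∃ r : ℝ, 0 < r ∧ B = hb (r • nv p) := by
  constructor
  · rintro ⟨r, hr, rfl⟩
    exact ⟨2 * r, by positivity, horoball_eq_hb p r⟩
  · rintro ⟨r, hr, rfl⟩
    refine ⟨r / 2, by positivity, ?_⟩
    rw [horoball_eq_hb]
    congr 2
    ring

theorem isHoroballAt_hb_iff {p : IdealPoint} {n : Mink} (hn : IsNull n) :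
    IsHoroballAt p (hb n) ↔ ∃ r : ℝ, 0 < r ∧ n = r • nv p := by
  rw [isHoroballAt_iff]
  refine exists_congr fun r => and_congr_right fun hr => ⟨fun h => ?_, fun h => by rw [h]⟩
  exact hn.hb_injective ((isNull_nv p).smul hr) h

theorem cell_geodesic {n m : Mink} (h : n ≠ m) {x : H3} :
    x ∈ cell {n, m} ↔ ∃ α β : ℝ, 0 ≤ α ∧ 0 ≤ β ∧ vec x = α • n + β • m :=
  mem_cone_pair h

theorem mem_geodesicLine_some_none {a : ℂ} {x : H3} :
    x.z = a ↔ ∃ α β : ℝ, 0 ≤ α ∧ 0 ≤ β ∧ vec x = α • nv (some a) + β • nv none := by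
  have ht := x.t_pos
  constructor
  · intro h
    refine ⟨1 / x.t, x.t, by positivity, ht.le, ?_⟩
    refine Prod.ext ?_ (Prod.ext ?_ ?_)
    · simp [vec, nv, h]; field_simp
    · simp [vec, nv]
    · simp [vec, nv, h]
  · rintro ⟨α, β, -, -, h⟩
    have h1 := congrArg (fun u => u.2.1) h
    have h2 := congrArg (fun u => u.2.2) h
    simp only [vec, nv, Prod.snd_add, Prod.smul_snd, Prod.smul_fst, Prod.fst_add, smul_eq_mul,
      mul_one, mul_zero, add_zero, smul_zero] at h1 h2
    rw [h1] at h2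
    have hα : α ≠ 0 := by rw [← h1]; positivity
    exact smul_right_injective _ hα h2

theorem geodesicLine_eq {p q : IdealPoint} (h : p ≠ q) :
    geodesicLine p q = cell {nv p, nv q} := by
  ext x
  rw [cell_geodesic (nv_injective.ne h)]
  have ht := x.t_pos
  rcases p with _ | a <;> rcases q with _ | b
  · exact absurd rfl h
  · change x.z = b ↔ _
    rw [mem_geodesicLine_some_none]
    constructor <;> rintro ⟨α, β, hα, hβ, e⟩ <;> exact ⟨β, α, hβ, hα, by rw [e, add_comm]⟩
  · exact mem_geodesicLine_some_none
  · have hab : a ≠ b := fun e => h (by rw [e])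
    have hn : 0 < ‖b - a‖ ^ 2 := by
      have := norm_pos_iff.2 (sub_ne_zero.2 hab.symm)
      positivity
    -- Along the half-circle `‖z‖² + t²` is affine in `s`. This is the first coordinate of the
    -- vector up to the factor `t`, so the half-circle is a planar slice.
    have key (s : ℝ) : ‖a + s • (b - a)‖ ^ 2 + s * (1 - s) * ‖b - a‖ ^ 2 =
        (1 - s) * ‖a‖ ^ 2 + s * ‖b‖ ^ 2 := by
      simp only [← Complex.normSq_eq_norm_sq, Complex.normSq_apply, Complex.add_re, Complex.add_im,
        Complex.smul_re, Complex.smul_im, Complex.sub_re, Complex.sub_im, smul_eq_mul]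
      ring
    constructor
    · rintro ⟨s, hz, hs⟩
      have hs0 : 0 < s * (1 - s) := by
        by_contra! hle
        nlinarith [pow_pos ht 2]
      have h0 : 0 ≤ s := by nlinarith
      have h1 : 0 ≤ 1 - s := by nlinarith
      refine ⟨(1 - s) / x.t, s / x.t, by positivity, by positivity, ?_⟩
      refine Prod.ext ?_ (Prod.ext ?_ ?_)
      · simp only [vec, nv, Prod.fst_add, Prod.smul_fst, smul_eq_mul]
        rw [hs, hz, key]
        ring
      · simp only [vec, nv, Prod.fst_add, Prod.snd_add, Prod.smul_fst, Prod.smul_snd, smul_eq_mul]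
        ring
      · simp only [vec, nv, Prod.snd_add, Prod.smul_snd]
        rw [hz]
        apply Complex.ext <;> simp <;> ring
    · rintro ⟨α, β, hα, hβ, e⟩
      have h1 := congrArg (fun u => u.1) e
      have h2 := congrArg (fun u => u.2.1) e
      have h3 := congrArg (fun u => u.2.2) e
      simp only [vec, nv, Prod.snd_add, Prod.smul_snd, Prod.smul_fst, Prod.fst_add, smul_eq_mul,
        mul_one] at h1 h2 h3
      have hα' : α * x.t = 1 - β * x.t := by
        have : x.t * (1 / x.t) = 1 := by field_simp
        rw [h2] at this
        linarith
      have hz : x.z = a + (β * x.t) • (b - a) := by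
        have : x.t • ((1 / x.t : ℝ) • x.z) = x.z := by rw [smul_smul]; field_simp; simp
        rw [← this, h3, smul_add, smul_smul, smul_smul, mul_comm x.t α, hα']
        module
      refine ⟨β * x.t, hz, ?_⟩
      have h4 : ‖x.z‖ ^ 2 + x.t ^ 2 = (α * x.t) * ‖a‖ ^ 2 + (β * x.t) * ‖b‖ ^ 2 := by
        rw [div_eq_iff ht.ne'] at h1
        linarith
      have := key (β * x.t)
      rw [← hz] at this
      rw [hα'] at h4
      linarith

theorem geodesicLine_self (p : IdealPoint) : geodesicLine p p = ∅ := by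
  rcases p with _ | a
  · rfl
  · ext x
    simp only [Set.mem_empty_iff_false, iff_false]
    rintro ⟨s, -, h⟩
    have := x.t_pos
    simp at h
    linarith

/-! ### Hulls of ideal points -/

theorem IsConvex.sum_mem {C : Set H3} (hC : IsConvex C) {ι : Type*} {s : Finset ι}
    (hs : s.Nonempty) {f : ι → Mink}
    (h : ∀ i ∈ s, ∃ r : ℝ, 0 < r ∧ ∃ y ∈ C, f i = r • vec y) :
    ∃ r : ℝ, 0 < r ∧ ∃ y ∈ C, ∑ i ∈ s, f i = r • vec y := by
  refine Finset.sum_induction_nonempty f (fun u => ∃ r : ℝ, 0 < r ∧ ∃ y ∈ C, u = r • vec y)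
    ?_ hs h
  rintro _ _ ⟨r, hr, x, hx, rfl⟩ ⟨s, hs, y, hy, rfl⟩
  have hT : IsTime (r • vec x + s • vec y) :=
    ((isTime_vec x).smul hr).add ((isTime_vec y).causal.smul hs.le)
  obtain ⟨q, hq, -, e⟩ := vec_nrm' hT
  exact ⟨q, hq, _, hC.mem_of_smul hx hy hq hr.le hs.le e.symm, e⟩

/-- A finite set of pairwise non-parallel null vectors. -/
def IsRaySet (V : Finset Mink) : Prop :=
  (∀ n ∈ V, IsNull n) ∧ ∀ n ∈ V, ∀ m ∈ V, n ≠ m → 0 < lor n m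

theorem IsRaySet.mono {V W : Finset Mink} (hW : IsRaySet W) (h : V ⊆ W) : IsRaySet V :=
  ⟨fun n hn => hW.1 n (h hn), fun n hn m hm => hW.2 n (h hn) m (h hm)⟩

theorem isRaySet_image_nv (W : Finset IdealPoint) : IsRaySet (W.image nv) := by
  constructor
  · intro n hn
    obtain ⟨p, -, rfl⟩ := Finset.mem_image.1 hn
    exact isNull_nv p
  · intro n hn m hm hne
    obtain ⟨p, -, rfl⟩ := Finset.mem_image.1 hn
    obtain ⟨q, -, rfl⟩ := Finset.mem_image.1 hm
    exact lor_nv_pos fun h => hne (by rw [h])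

theorem sum_filter_pos {V : Finset Mink} {c : Mink → ℝ} (hc : ∀ n, 0 ≤ c n) :
    ∑ n ∈ V with 0 < c n, c n • n = ∑ n ∈ V, c n • n := by
  rw [Finset.sum_filter]
  refine Finset.sum_congr rfl fun n _ => ?_
  split_ifs with h
  · rfl
  · rw [le_antisymm (not_lt.1 h) (hc n), zero_smul]

/-- A point in a cone of null vectors has at least two of them in its support. -/
theorem one_lt_card_of_vec_eq_sum {V : Finset Mink} (hV : ∀ n ∈ V, IsNull n) {c : Mink → ℝ}
    {x : H3} (h : vec x = ∑ n ∈ V, c n • n) : 1 < V.card := by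
  by_contra! hle
  have h1 := lor_vec_self x
  rcases Nat.le_one_iff_eq_zero_or_eq_one.1 hle with h0 | h0
  · rw [Finset.card_eq_zero.1 h0] at h
    rw [h] at h1
    simp [lor_zero_left] at h1
  · obtain ⟨n, rfl⟩ := Finset.card_eq_one.1 h0
    rw [h] at h1
    simp [lor_smul_left, lor_smul_right, (hV n (by simp)).self] at h1

theorem cell_nonempty_card {V : Finset Mink} (hV : ∀ n ∈ V, IsNull n) (h : (cell V).Nonempty) :
    1 < V.card := by
  obtain ⟨x, c, -, hx⟩ := h
  exact one_lt_card_of_vec_eq_sum hV hx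

/-- A point with coefficients `c` is, up to scale, the sum of the vectors `c n • n + c m • m` over
ordered pairs of distinct generators in its support. Each of these projects to a geodesic contained
in `S`, and convex sets absorb such sums. -/
theorem IsRaySet.hull_eq_cell {V : Finset Mink} (hV : IsRaySet V) {S : Set H3}
    (h1 : ∀ n ∈ V, ∀ m ∈ V, n ≠ m → cell {n, m} ⊆ S) (h2 : S ⊆ cell V) : hull S = cell V := by
  apply Set.Subset.antisymm (hull_subset (isConvex_cell V) h2)
  rintro x ⟨c, hc, hx⟩ C ⟨hC, hS⟩
  rw [← sum_filter_pos hc] at hx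
  set s := V.filter fun n => 0 < c n with hs
  have hsV : s ⊆ V := Finset.filter_subset _ _
  have hcard := one_lt_card_of_vec_eq_sum (fun n hn => hV.1 n (hsV hn)) hx
  have hpair (n) (hn : n ∈ s) (m) (hm : m ∈ s) (hne : n ≠ m) :
      ∃ r : ℝ, 0 < r ∧ ∃ y ∈ C, c n • n + c m • m = r • vec y := by
    have cn : 0 < c n := (Finset.mem_filter.1 hn).2
    have cm : 0 < c m := (Finset.mem_filter.1 hm).2
    have hT : IsTime (c n • n + c m • m) := by
      apply isTime_add_of_lor_pos ((hV.1 n (hsV hn)).causal.smul cn.le)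
        ((hV.1 m (hsV hm)).causal.smul cm.le)
      rw [lor_smul_left, lor_smul_right]
      have := hV.2 n (hsV hn) m (hsV hm) hne
      positivity
    obtain ⟨r, hr, -, e⟩ := vec_nrm' hT
    refine ⟨r, hr, _, hS (h1 n (hsV hn) m (hsV hm) hne (mem_cell_of_smul hr ?_)), e⟩
    rw [← e]
    exact (mem_cone_pair hne).2 ⟨_, _, cn.le, cm.le, rfl⟩
  have hne : s.offDiag.Nonempty := by
    obtain ⟨a, ha, b, hb, hab⟩ := Finset.one_lt_card.1 hcard
    exact ⟨(a, b), Finset.mem_offDiag.2 ⟨ha, hb, hab⟩⟩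
  obtain ⟨r, hr, y, hy, e⟩ := hC.sum_mem hne (f := fun p => c p.1 • p.1 + c p.2 • p.2)
    fun p hp => by
      obtain ⟨ha, hb, hab⟩ := Finset.mem_offDiag.1 hp
      exact hpair _ ha _ hb hab
  -- Each generator is the first entry of `card - 1` pairs and the second entry of as many.
  have hsum : ∑ p ∈ s.offDiag, (c p.1 • p.1 + c p.2 • p.2) =
      (2 * ((s.card : ℝ) - 1)) • vec x := by
    have e1 : ∑ p ∈ s ×ˢ s, (c p.1 • p.1 + c p.2 • p.2) = (2 * (s.card : ℝ)) • vec x := by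
      rw [Finset.sum_product]
      simp only [Finset.sum_add_distrib, Finset.sum_const, ← hx, ← Finset.smul_sum]
      rw [← Nat.cast_smul_eq_nsmul ℝ]
      module
    have e2 : ∑ p ∈ s.diag, (c p.1 • p.1 + c p.2 • p.2) = (2 : ℝ) • vec x := by
      rw [Finset.sum_diag, Finset.sum_add_distrib, ← hx]
      module
    rw [← Finset.diag_union_offDiag, Finset.sum_union (Finset.disjoint_diag_offDiag _), e2] at e1
    have : ∑ p ∈ s.offDiag, (c p.1 • p.1 + c p.2 • p.2) =
      (2 * (s.card : ℝ)) • vec x - (2 : ℝ) • vec x := by rw [← e1]; abel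
    rw [this]
    module
  have hc1 : (1 : ℝ) < s.card := by exact_mod_cast hcard
  rw [hsum] at e
  rwa [eq_of_smul_vec_eq (by linarith) hr e]

theorem idealHull_eq_cell {W : Set IdealPoint} (W' : Finset IdealPoint) (h : W = W') :
    idealHull W = cell (W'.image nv) := by
  subst h
  apply (isRaySet_image_nv W').hull_eq_cell
  · intro n hn m hm hne
    obtain ⟨p, hp, rfl⟩ := Finset.mem_image.1 hn
    obtain ⟨q, hq, rfl⟩ := Finset.mem_image.1 hm
    have hpq : p ≠ q := fun h => hne (by rw [h])
    rw [← geodesicLine_eq hpq]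
    intro x hx
    simp only [Set.mem_iUnion]
    exact ⟨p, hp, q, hq, hx⟩
  · intro x hx
    simp only [Set.mem_iUnion] at hx
    obtain ⟨p, hp, q, hq, hx⟩ := hx
    rcases eq_or_ne p q with rfl | hpq
    · rw [geodesicLine_self] at hx
      exact hx.elim
    · rw [geodesicLine_eq hpq] at hx
      refine cell_mono ?_ hx
      intro n hn
      simp only [Finset.mem_insert, Finset.mem_singleton] at hn
      rcases hn with rfl | rfl
      · exact Finset.mem_image_of_mem _ hp
      · exact Finset.mem_image_of_mem _ hq

/-! ### Extreme rays -/

/-- If `n` were parallel to no generator in `W`, all products `lor n k` would be positive, and some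
`K` would satisfy `lor u o ≤ K * lor n u` on the whole cone of `W`. This fails for `u = n + ε m` as
`ε` tends to 0: the left side stays above `lor n o`, while the right side is `K ε lor n m`. The
detour through `ε` is needed because `n` itself is not a point of the cell. -/
theorem IsRaySet.exists_parallel_of_cell_subset {V W : Finset Mink} (hV : IsRaySet V)
    (hW : ∀ n ∈ W, IsNull n) (h : cell V ⊆ cell W) {n m : Mink} (hn : n ∈ V) (hm : m ∈ V)
    (hne : n ≠ m) : ∃ n' ∈ W, ∃ r : ℝ, 0 < r ∧ n = r • n' := by
  have hN := hV.1 n hn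
  have hM := hV.1 m hm
  have hnm := hV.2 n hn m hm hne
  by_contra! hcon
  have hpos : ∀ k ∈ W, 0 < lor n k := by
    intro k hk
    rcases (hW k hk).lor_pos_or_parallel hN with h' | ⟨r, hr, e⟩
    · rwa [lor_comm]
    · exact absurd e (hcon k hk r hr)
  let o : H3 := ⟨0, 1, one_pos⟩
  have hoW (k) (hk : k ∈ W) : 0 < lor k (vec o) := (hW k hk).lor_vec_pos o
  -- a constant with `lor k o ≤ K * lor n k` on the generators
  let K : ℝ := ∑ k ∈ W, lor k (vec o) / lor n k
  have hK (k) (hk : k ∈ W) : lor k (vec o) ≤ K * lor n k := by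
    rw [← div_le_iff₀ (hpos k hk)]
    exact Finset.single_le_sum (f := fun k => lor k (vec o) / lor n k)
      (fun i hi => (div_pos (hoW i hi) (hpos i hi)).le) hk
  have hcone (u) (hu : u ∈ cone W) : lor u (vec o) ≤ K * lor n u := by
    obtain ⟨c, hc, rfl⟩ := hu
    rw [lor_sum_left, lor_sum_right, Finset.mul_sum]
    refine Finset.sum_le_sum fun k hk => ?_
    rw [lor_smul_left, lor_smul_right]
    nlinarith [hc k, hK k hk]
  have hmem (ε : ℝ) (hε : 0 < ε) : n + ε • m ∈ cone W := by
    have hT : IsTime (n + ε • m) := by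
      apply isTime_add_of_lor_pos hN.causal (hM.causal.smul hε.le)
      rw [lor_smul_right]
      positivity
    obtain ⟨r, hr, -, e⟩ := vec_nrm' hT
    have hx : nrm (n + ε • m) ∈ cell V := by
      apply mem_cell_of_smul hr
      rw [← e]
      exact add_mem_cone (mem_cone_of_mem hn) (smul_mem_cone (mem_cone_of_mem hm) hε.le)
    rw [e]
    exact smul_mem_cone (h hx) hr.le
  have hlim (ε : ℝ) (hε : 0 < ε) : lor n (vec o) ≤ K * lor n m * ε := by
    have h1 := hcone _ (hmem ε hε)
    simp only [lor_add_left, lor_add_right, lor_smul_left, lor_smul_right, hN.self] at h1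
    have h2 := hM.lor_vec_pos o
    nlinarith
  have ho := hN.lor_vec_pos o
  have hKm : 0 < K * lor n m := by nlinarith [hlim 1 one_pos]
  have := hlim (lor n (vec o) / (2 * (K * lor n m))) (by positivity)
  have e : K * lor n m * (lor n (vec o) / (2 * (K * lor n m))) = lor n (vec o) / 2 := by
    generalize K * lor n m = A at hKm
    field_simp
  linarith

/-! ### Faces -/

/-- The equation places `x` between `y` and `y'`. A face therefore absorbs `y` as soon as `P`
continues a little beyond `x` in the direction away from `y`. -/
theorem IsFace.mem_of_sub {F P : Set H3} (hF : IsFace F P) {x y y' : H3} (hx : x ∈ F)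
    (hy : y ∈ P) (hy' : y' ∈ P) {ε r : ℝ} (hε : 0 < ε) (hr : 0 < r)
    (h : vec x + ε • -vec y = r • vec y') : y ∈ F := by
  rcases eq_or_ne x y with rfl | hxy
  · exact hx
  have e : vec x = ε • vec y + r • vec y' := by rw [← h]; module
  have hxy' : x ≠ y' := by
    rintro rfl
    have e2 : (1 - r) • vec x = ε • vec y := by
      rw [sub_smul, one_smul, ← h]; module
    have h1 := congrArg (fun u => lor u (vec y)) e2
    simp only [lor_smul_left, lor_vec_self] at h1
    have h2 := lor_vec_pos x y
    have h3 : 0 < 1 - r := by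
      by_contra! hle
      nlinarith
    exact hxy (eq_of_smul_vec_eq h3 hε e2)
  exact (hF.2.2.2 y hy y' hy' x hx (mem_segment_iff.2 ⟨ε, r, hε.le, hr.le, e⟩) hxy hxy').1

theorem IsFace.eq_of_mem_interior {F P : Set H3} (hF : IsFace F P) {x : H3} (hx : x ∈ F)
    (hi : x ∈ interior P) : F = P := by
  refine hF.2.1.antisymm fun y hy => ?_
  obtain ⟨ε, hε, -, y', hy', r, hr, -, e⟩ :=
    exists_perturb (mem_interior_iff_mem_nhds.1 hi) (-vec y) one_pos
  exact hF.mem_of_sub hx hy hy' hε hr e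

theorem exists_pos_forall_mul_le {ι : Type*} (s : Finset ι) (c d : ι → ℝ)
    (hc : ∀ i ∈ s, 0 < c i) : ∃ δ : ℝ, 0 < δ ∧ ∀ ε, 0 < ε → ε < δ → ∀ i ∈ s, ε * d i ≤ c i := by
  have h : ∀ᶠ ε : ℝ in nhds 0, ∀ i ∈ s, ε * d i ≤ c i := by
    rw [Filter.eventually_all_finset]
    intro i hi
    have : Filter.Tendsto (fun ε : ℝ => ε * d i) (nhds 0) (nhds 0) := by
      have : Continuous fun ε : ℝ => ε * d i := by fun_prop
      simpa using this.tendsto 0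
    exact (this.eventually (gt_mem_nhds (hc i hi))).mono fun ε h => le_of_lt h
  obtain ⟨δ, hδ, h⟩ := Metric.eventually_nhds_iff.1 h
  refine ⟨δ, hδ, fun ε h0 h1 => h ?_⟩
  rwa [Real.dist_eq, sub_zero, abs_of_pos h0]

theorem sub_smul_mem_cone {V : Finset Mink} {c d : Mink → ℝ} {ε : ℝ}
    (h : ∀ n ∈ V, ε * d n ≤ c n) :
    ∑ n ∈ V, c n • n + ε • -(∑ n ∈ V, d n • n) ∈ cone V := by
  have : ∑ n ∈ V, c n • n + ε • -(∑ n ∈ V, d n • n) = ∑ n ∈ V, (c n - ε * d n) • n := by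
    rw [smul_neg, ← sub_eq_add_neg, Finset.smul_sum, ← Finset.sum_sub_distrib]
    refine Finset.sum_congr rfl fun n _ => ?_
    module
  rw [this]
  exact sum_mem_cone fun n hn => smul_mem_cone (mem_cone_of_mem hn) (by linarith [h n hn])

/-- All coefficients of `x` being positive, a small multiple of any `y` in the cone of `S` can be
subtracted from `x` without leaving that cone. -/
theorem IsFace.cell_support_subset {V : Finset Mink} {F : Set H3} (hF : IsFace F (cell V))
    {S : Finset Mink} (hS : S ⊆ V) {x : H3} (hx : x ∈ F) {c : Mink → ℝ} (hc : ∀ n ∈ S, 0 < c n)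
    (h : vec x = ∑ n ∈ S, c n • n) : cell S ⊆ F := by
  rintro y ⟨d, hd, hy⟩
  obtain ⟨δ, hδ, hδ'⟩ := exists_pos_forall_mul_le S c d hc
  obtain ⟨ε, hε, hεδ, y', -, r, hr, -, e⟩ :=
    exists_perturb (x := x) Filter.univ_mem (-vec y) hδ
  refine hF.mem_of_sub hx (cell_mono hS ⟨d, hd, hy⟩) (cell_mono hS ?_) hε hr e
  apply mem_cell_of_smul hr
  rw [← e, h, hy]
  exact sub_smul_mem_cone (hδ' ε hε hεδ)

/-- Every face of a cell is spanned by some of the generators. -/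
theorem IsFace.exists_eq_cell {V : Finset Mink} {F : Set H3} (hF : IsFace F (cell V)) :
    ∃ S ⊆ V, F = cell S ∧ ∃ x ∈ F, ∃ c : Mink → ℝ, (∀ n ∈ S, 0 < c n) ∧
      vec x = ∑ n ∈ S, c n • n := by
  classical
  -- The generators that occur with a positive coefficient in some representation of some point of
  -- `F`.
  set S := V.filter fun k => ∃ x ∈ F, ∃ c : Mink → ℝ, (∀ n, 0 ≤ c n) ∧ 0 < c k ∧
    vec x = ∑ n ∈ V, c n • n with hS
  have hSV : S ⊆ V := Finset.filter_subset _ _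
  have hsupp {x : H3} (hx : x ∈ F) {c : Mink → ℝ} (hc : ∀ n, 0 ≤ c n)
      (h : vec x = ∑ n ∈ V, c n • n) : vec x = ∑ n ∈ S, c n • n := by
    rw [h]
    refine (Finset.sum_subset hSV fun n hn hnS => ?_).symm
    rcases (hc n).eq_or_lt with h0 | h0
    · rw [← h0, zero_smul]
    · exact absurd (Finset.mem_filter.2 ⟨hn, x, hx, c, hc, h0, h⟩) hnS
  have hFS : F ⊆ cell S := by
    intro x hx
    obtain ⟨c, hc, h⟩ := hF.2.1 hx
    exact ⟨c, hc, hsupp hx hc h⟩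
  have hex : ∀ k : Mink, ∃ x : H3, ∃ c : Mink → ℝ, k ∈ S → x ∈ F ∧ (∀ n, 0 ≤ c n) ∧ 0 < c k ∧
      vec x = ∑ n ∈ V, c n • n := by
    intro k
    by_cases hk : k ∈ S
    · obtain ⟨-, x, hx, c, hc⟩ := Finset.mem_filter.1 hk
      exact ⟨x, c, fun _ => ⟨hx, hc⟩⟩
    · exact ⟨⟨0, 1, one_pos⟩, 0, fun h => absurd h hk⟩
  choose X C hXC using hex
  have hne : S.Nonempty := by
    rw [Finset.nonempty_iff_ne_empty]
    intro h0
    obtain ⟨x, hx⟩ := hF.1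
    obtain ⟨c, -, h⟩ := hFS hx
    have h1 := lor_vec_self x
    rw [h, h0] at h1
    simp [lor_zero_left] at h1
  -- Adding one witness for each `k ∈ S` produces a single point of `F` with all coefficients
  -- positive.
  obtain ⟨r, hr, x, hx, e⟩ := hF.2.2.1.sum_mem hne (f := fun k => vec (X k))
    fun k hk => ⟨1, one_pos, X k, (hXC k hk).1, by simp⟩
  have hx' : vec x = ∑ n ∈ S, (r⁻¹ * ∑ k ∈ S, C k n) • n := by
    have : vec x = r⁻¹ • ∑ k ∈ S, vec (X k) := by rw [e, inv_smul_smul₀ hr.ne']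
    rw [this]
    simp only [mul_smul, ← Finset.smul_sum, Finset.sum_smul]
    rw [Finset.sum_comm]
    congr 1
    exact Finset.sum_congr rfl fun k hk =>
      hsupp (hXC k hk).1 (hXC k hk).2.1 (hXC k hk).2.2.2
  have hpos : ∀ n ∈ S, 0 < r⁻¹ * ∑ k ∈ S, C k n := by
    intro n hn
    have : 0 < ∑ k ∈ S, C k n :=
      Finset.sum_pos' (fun k hk => (hXC k hk).2.1 n) ⟨n, hn, (hXC n hn).2.2.1⟩
    positivity
  refine ⟨S, hSV, hFS.antisymm ?_, x, hx, _, hpos, hx'⟩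
  exact hF.cell_support_subset hSV hx hpos hx'

/-- A supporting functional cuts out a face. -/
theorem isFace_cell_of_functional {V S : Finset Mink} (hS : S ⊆ V) (hne : (cell S).Nonempty)
    {e : Mink} (h0 : ∀ n ∈ S, lor n e = 0) (h1 : ∀ n ∈ V, n ∉ S → 0 < lor n e) :
    IsFace (cell S) (cell V) := by
  have hnn : ∀ n ∈ V, 0 ≤ lor n e := fun n hn => by
    by_cases h : n ∈ S
    · exact (h0 n h).ge
    · exact (h1 n hn h).le
  have hle : ∀ x ∈ cell V, 0 ≤ lor (vec x) e := by
    rintro x ⟨c, hc, h⟩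
    rw [h, lor_sum_left]
    refine Finset.sum_nonneg fun n hn => ?_
    rw [lor_smul_left]
    exact mul_nonneg (hc n) (hnn n hn)
  have hmem : ∀ x ∈ cell V, lor (vec x) e = 0 → x ∈ cell S := by
    rintro x ⟨c, hc, h⟩ hx
    refine ⟨c, hc, ?_⟩
    rw [h, lor_sum_left, Finset.sum_eq_zero_iff_of_nonneg] at hx
    · rw [h]
      refine (Finset.sum_subset hS fun n hn hnS => ?_).symm
      have := hx n hn
      rw [lor_smul_left] at this
      rw [(mul_eq_zero.1 this).resolve_right (h1 n hn hnS).ne', zero_smul]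
    · intro n hn
      rw [lor_smul_left]
      exact mul_nonneg (hc n) (hnn n hn)
  have hzero : ∀ x ∈ cell S, lor (vec x) e = 0 := by
    rintro x ⟨c, hc, h⟩
    rw [h, lor_sum_left]
    refine Finset.sum_eq_zero fun n hn => ?_
    rw [lor_smul_left, h0 n hn, mul_zero]
  refine ⟨hne, cell_mono hS, isConvex_cell S, ?_⟩
  intro x hx y hy w hw hseg hwx hwy
  obtain ⟨α, β, hα, hβ, e'⟩ := mem_segment_iff.1 hseg
  have hw0 := hzero w hw
  rw [e', lor_add_left, lor_smul_left, lor_smul_left] at hw0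
  have px := hle x hx
  have py := hle y hy
  have hα0 : 0 < α := by
    refine hα.lt_of_ne fun h => hwy ?_
    have hβ0 : 0 < β := by
      refine hβ.lt_of_ne fun h' => ?_
      have h1 := lor_vec_self w
      rw [e', ← h, ← h'] at h1
      simp [lor_zero_left] at h1
    refine eq_of_smul_vec_eq one_pos hβ0 ?_
    rw [e', ← h]
    simp
  have hβ0 : 0 < β := by
    refine hβ.lt_of_ne fun h => hwx ?_
    refine eq_of_smul_vec_eq one_pos hα0 ?_
    rw [e', ← h]
    simp
  exact ⟨hmem x hx (by nlinarith [mul_nonneg hα px, mul_nonneg hβ py]),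
    hmem y hy (by nlinarith [mul_nonneg hα px, mul_nonneg hβ py])⟩

/-! ### Planes and interiors -/

theorem mem_bisector_iff {a b x : H3} :
    x ∈ bisector a b ↔ lor (vec x) (vec a - vec b) = 0 := by
  rw [lor_sub_right, lor_vec_vec, lor_vec_vec, sub_eq_zero]
  exact ⟨fun h => by rw [show dist x a = dist x b from h],
    fun h => Real.cosh_injOn dist_nonneg dist_nonneg h⟩

/-- A linear hyperplane that meets `H3` is contained in a bisector. -/
theorem exists_bisector {e : Mink} (he : e ≠ 0) {x₀ : H3} (h0 : lor (vec x₀) e = 0) :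
    ∃ a b, a ≠ b ∧ ∀ x, lor (vec x) e = 0 → x ∈ bisector a b := by
  have h1 := eventually_isTime_perturb x₀ e
  have h2 : ∀ᶠ ε : ℝ in nhds 0, IsTime (vec x₀ + (-ε) • e) := by
    have : Filter.Tendsto (fun ε : ℝ => -ε) (nhds 0) (nhds 0) := by
      simpa using (continuous_neg (G := ℝ)).tendsto 0
    exact this.eventually h1
  obtain ⟨ε, ⟨k1, k2⟩, hε⟩ := (((h1.and h2).filter_mono (nhdsWithin_le_nhds (s := Set.Ioi 0))).and
    (self_mem_nhdsWithin (s := Set.Ioi (0 : ℝ)))).exists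
  have hε : 0 < ε := hε
  -- As `e` is orthogonal to `x₀`, the perturbations by `ε e` and `-ε e` have the same length. The
  -- difference of the two normalized points is thus a multiple of `e`, which makes their bisector
  -- the required plane.
  have hself (δ : ℝ) : lor (vec x₀ + δ • e) (vec x₀ + δ • e) = 1 + δ ^ 2 * lor e e := by
    simp only [lor_add_left, lor_add_right, lor_smul_left, lor_smul_right, lor_vec_self, h0,
      lor_comm e (vec x₀)]
    ring
  have e1 := vec_nrm k1
  have e2 := vec_nrm k2
  have hs : 0 < √(1 + ε ^ 2 * lor e e) := by
    rw [← hself]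
    exact Real.sqrt_pos.2 k1.2
  rw [hself] at e1
  rw [hself, neg_sq] at e2
  have e3 : vec (nrm (vec x₀ + ε • e)) - vec (nrm (vec x₀ + (-ε) • e)) =
      ((√(1 + ε ^ 2 * lor e e))⁻¹ * (2 * ε)) • e := by
    rw [e1, e2]; module
  refine ⟨nrm (vec x₀ + ε • e), nrm (vec x₀ + (-ε) • e), ?_, ?_⟩
  · intro h
    rw [h, sub_self] at e3
    exact smul_ne_zero (by positivity) he e3.symm
  · intro x hx
    rw [mem_bisector_iff, e3, lor_smul_right, hx, mul_zero]

theorem exists_lor_eq_linear (f : Mink →ₗ[ℝ] ℝ) : ∃ e, ∀ u, f u = lor u e := by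
  refine ⟨(2 * f (0, 1, 0), 2 * f (1, 0, 0), ⟨-f (0, 0, 1), -f (0, 0, Complex.I)⟩), fun u => ?_⟩
  obtain ⟨a, b, ⟨c, d⟩⟩ := u
  have : ((a, b, ⟨c, d⟩) : Mink) = a • ((1, 0, 0) : Mink) + b • ((0, 1, 0) : Mink) +
      c • ((0, 0, 1) : Mink) + d • ((0, 0, Complex.I) : Mink) := by
    refine Prod.ext ?_ (Prod.ext ?_ (Complex.ext ?_ ?_)) <;> simp
  rw [this]
  simp only [map_add, map_smul, lor, smul_eq_mul]
  simp
  ring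

theorem exists_orthogonal_of_span_ne_top {V : Finset Mink}
    (h : Submodule.span ℝ (V : Set Mink) ≠ ⊤) : ∃ e, e ≠ 0 ∧ ∀ n ∈ V, lor n e = 0 := by
  obtain ⟨f, hf, hle⟩ := Submodule.exists_le_ker_of_lt_top _ (lt_top_iff_ne_top.2 h)
  obtain ⟨e, he⟩ := exists_lor_eq_linear f
  refine ⟨e, ?_, fun n hn => ?_⟩
  · rintro rfl
    exact hf (LinearMap.ext fun u => by rw [he, lor_zero_right]; rfl)
  · rw [← he]
    exact hle (Submodule.subset_span hn)

theorem lor_eq_zero_of_mem_cell {V : Finset Mink} {e : Mink} (h : ∀ n ∈ V, lor n e = 0) {x : H3}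
    (hx : x ∈ cell V) : lor (vec x) e = 0 := by
  obtain ⟨c, -, h'⟩ := hx
  rw [h', lor_sum_left]
  exact Finset.sum_eq_zero fun n hn => by rw [lor_smul_left, h n hn, mul_zero]

theorem span_eq_top_of_not_planar {V : Finset Mink}
    (h : ¬ ∃ a b, a ≠ b ∧ cell V ⊆ bisector a b) : Submodule.span ℝ (V : Set Mink) = ⊤ := by
  by_contra hne
  obtain ⟨e, he, h0⟩ := exists_orthogonal_of_span_ne_top hne
  apply h
  by_cases hn : (cell V).Nonempty
  · obtain ⟨x₀, hx₀⟩ := hn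
    obtain ⟨a, b, hab, hb⟩ := exists_bisector he (lor_eq_zero_of_mem_cell h0 hx₀)
    exact ⟨a, b, hab, fun x hx => hb x (lor_eq_zero_of_mem_cell h0 hx)⟩
  · rw [Set.not_nonempty_iff_eq_empty.1 hn]
    refine ⟨⟨0, 1, one_pos⟩, ⟨0, 2, two_pos⟩, ?_, Set.empty_subset _⟩
    intro h
    have := congrArg H3.t h
    norm_num at this

theorem four_le_card_of_span {V : Finset Mink} (h : Submodule.span ℝ (V : Set Mink) = ⊤) :
    4 ≤ V.card := by
  have h1 := finrank_span_finset_le_card (R := ℝ) V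
  rw [Set.finrank, h, finrank_top] at h1
  simpa [Module.finrank_prod] using h1

/-- Around an interior point one can move in every direction of Minkowski space, so a normal vector
of the plane would be orthogonal to everything. -/
theorem not_planar_of_interior {P : Set H3} (h : (interior P).Nonempty) :
    ¬ ∃ a b, a ≠ b ∧ P ⊆ bisector a b := by
  rintro ⟨a, b, hab, hP⟩
  obtain ⟨x, hx⟩ := h
  have hx0 := mem_bisector_iff.1 (hP (interior_subset hx))
  have : vec a - vec b = 0 := by
    refine lor_eq_zero_of_forall fun u => ?_
    obtain ⟨ε, hε, -, y, hy, r, hr, -, e⟩ :=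
      exists_perturb (mem_interior_iff_mem_nhds.1 hx) u one_pos
    have h1 := congrArg (fun v => lor v (vec a - vec b)) e
    simp only [lor_add_left, lor_smul_left, hx0, mem_bisector_iff.1 (hP hy)] at h1
    rw [lor_comm]
    nlinarith
  exact hab (vec_injective (sub_eq_zero.1 this))

/-- The map from coefficients to vectors is a linear surjection in finite dimension, hence open, and
the strictly positive coefficients form an open set. -/
theorem mem_interior_cell {V : Finset Mink} (hV : Submodule.span ℝ (V : Set Mink) = ⊤) {x : H3}
    {c : Mink → ℝ} (hc : ∀ n ∈ V, 0 < c n) (h : vec x = ∑ n ∈ V, c n • n) :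
    x ∈ interior (cell V) := by
  classical
  let φ : (V → ℝ) →ₗ[ℝ] Mink := Fintype.linearCombination ℝ (fun n : V => (n : Mink))
  have hφ (c : V → ℝ) : φ c = ∑ n : V, c n • (n : Mink) := Fintype.linearCombination_apply ..
  have hsurj : Function.Surjective φ := by
    rw [← LinearMap.range_eq_top, Fintype.range_linearCombination, Subtype.range_coe_subtype]
    simpa using hV
  have hop : IsOpen (φ '' {c | ∀ n, 0 < c n}) := by
    apply φ.isOpenMap_of_finiteDimensional hsurj
    simp only [Set.ofPred_forall]
    exact isOpen_iInter_of_finite fun n => isOpen_lt continuous_const (continuous_apply n)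
  refine mem_interior.2 ⟨vec ⁻¹' (φ '' {c | ∀ n, 0 < c n}), ?_,
    hop.preimage continuous_vec, ⟨fun n => c n, fun n => hc n n.2, ?_⟩⟩
  · rintro y ⟨d, hd, hy⟩
    have hd : ∀ n, 0 < d n := hd
    refine ⟨fun n => if hn : n ∈ V then d ⟨n, hn⟩ else 0, fun n => ?_, ?_⟩
    · dsimp only
      split_ifs
      · exact (hd _).le
      · exact le_rfl
    · rw [← hy, hφ, ← Finset.sum_coe_sort V]
      exact Finset.sum_congr rfl fun n _ => by simp
  · rw [hφ, h, ← Finset.sum_coe_sort V]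

theorem cell_subset_closure_interior {V : Finset Mink}
    (hV : Submodule.span ℝ (V : Set Mink) = ⊤) : cell V ⊆ closure (interior (cell V)) := by
  rintro x ⟨c, hc, h⟩
  rw [mem_closure_iff_nhds]
  intro U hU
  obtain ⟨ε, hε, -, y, hy, r, hr, -, e⟩ := exists_perturb hU (∑ n ∈ V, n) one_pos
  refine ⟨y, hy, mem_interior_cell hV (c := fun n => r⁻¹ * (c n + ε)) (fun n _ => ?_) ?_⟩
  · have := hc n
    positivity
  · rw [← inv_smul_smul₀ hr.ne' (vec y), ← e, h]
    simp only [mul_smul, ← Finset.smul_sum, add_smul, Finset.sum_add_distrib]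
    rw [Finset.smul_sum (r := ε)]

/-- Generators have positive product with a base point `o`, so points of the cell near `x` have
bounded coefficients. Near `x` the cell is therefore contained in the preimage of a compact set of
conic combinations. -/
theorem isClosed_cell {V : Finset Mink} (hV : ∀ n ∈ V, IsNull n) : IsClosed (cell V) := by
  classical
  let o : H3 := ⟨0, 1, one_pos⟩
  refine isClosed_of_closure_subset fun x hx => ?_
  let R := lor (vec o) (vec x) + 1
  let φ : (V → ℝ) → Mink := fun c => ∑ n : V, c n • (n : Mink)
  have hφ : Continuous φ := by fun_prop
  let Q : Set (V → ℝ) := Set.univ.pi fun n => Set.Icc 0 (R / lor (vec o) n)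
  have hQ : IsCompact Q := isCompact_univ_pi fun n => isCompact_Icc
  have hcl : IsClosed (φ '' Q) := (hQ.image hφ).isClosed
  have hU : {y | lor (vec o) (vec y) < R} ∈ nhds x := by
    apply (isOpen_lt ((continuous_lor_right _).comp continuous_vec) continuous_const).mem_nhds
    simp [R]
  have hsub : cell V ∩ {y | lor (vec o) (vec y) < R} ⊆ vec ⁻¹' (φ '' Q) := by
    rintro y ⟨⟨c, hc, h⟩, hy⟩
    have hy : lor (vec o) (vec y) < R := hy
    refine ⟨fun n => c n, ?_, ?_⟩
    · rintro ⟨n, hn⟩ -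
      have hpos : 0 < lor (vec o) n := by rw [lor_comm]; exact (hV n hn).lor_vec_pos o
      refine ⟨hc n, ?_⟩
      rw [le_div_iff₀ hpos]
      refine le_trans ?_ hy.le
      rw [h, lor_sum_right]
      simp only [lor_smul_right]
      refine Finset.single_le_sum (f := fun k => c k * lor (vec o) k) (fun k hk => ?_) hn
      have : 0 < lor (vec o) k := by rw [lor_comm]; exact (hV k hk).lor_vec_pos o
      exact mul_nonneg (hc k) this.le
    · rw [h, ← Finset.sum_coe_sort V]
  have hx2 : x ∈ closure (cell V ∩ {y | lor (vec o) (vec y) < R}) := by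
    rw [mem_closure_iff_nhds] at hx ⊢
    intro U hU'
    obtain ⟨y, ⟨hy1, hy2⟩, hy3⟩ := hx _ (Filter.inter_mem hU' hU)
    exact ⟨y, hy1, hy3, hy2⟩
  obtain ⟨c, hc, h⟩ := closure_minimal hsub (hcl.preimage continuous_vec) hx2
  refine ⟨fun n => if hn : n ∈ V then c ⟨n, hn⟩ else 0, fun n => ?_, ?_⟩
  · dsimp only
    split_ifs with hn
    · exact (hc ⟨n, hn⟩ trivial).1
    · exact le_rfl
  · rw [← h, ← Finset.sum_coe_sort V]
    exact Finset.sum_congr rfl fun n _ => by simp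

theorem IsIdealPolyhedron.exists_eq_cell {P : Set H3} (h : IsIdealPolyhedron P) :
    ∃ V, P = cell V ∧ IsRaySet V ∧ Submodule.span ℝ (V : Set Mink) = ⊤ := by
  obtain ⟨⟨W, hW, e⟩, hp⟩ := h
  rw [idealHull_eq_cell hW.toFinset (by simp)] at e
  exact ⟨_, e, isRaySet_image_nv _, span_eq_top_of_not_planar (e ▸ hp)⟩

/-! ### Regular configurations of null vectors -/

/-- Pairwise tangent horoballs. -/
def IsClique (S : Finset Mink) : Prop := ∀ n ∈ S, ∀ m ∈ S, n ≠ m → lor n m = 2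

/-- The Lorentz reflection that exchanges `n` and `m` when `lor n m = 2`. -/
def reflect (n m : Mink) : Mink →ₗ[ℝ] Mink :=
  LinearMap.id + ((1 / 2 : ℝ) • lorForm (n - m)).smulRight (n - m)

theorem reflect_apply (n m u : Mink) : reflect n m u = u + (lor u (n - m) / 2) • (n - m) := by
  simp only [reflect, LinearMap.add_apply, LinearMap.id_apply, LinearMap.smulRight_apply,
    LinearMap.smul_apply, lorForm_apply, lor_comm u, smul_eq_mul]
  congr 2
  ring

/-- The common features of the sets of vertices of regular ideal tetrahedra and octahedra, each
vertex being represented by the null vector of its horoball in the symmetric packing. -/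
structure IsRegular (V : Finset Mink) : Prop where
  null : ∀ n ∈ V, IsNull n
  two_le : ∀ n ∈ V, ∀ m ∈ V, n ≠ m → 2 ≤ lor n m
  le_four : ∀ n ∈ V, ∀ m ∈ V, lor n m ≤ 4
  balanced : ∃ τ : ℝ, 0 < τ ∧ ∀ n ∈ V, lor n (∑ m ∈ V, m) = τ
  -- Every diagonal passes through the center of the tile.
  opposite : ∀ n ∈ V, ∀ m ∈ V, n ≠ m → lor n m ≠ 2 → ∃ l : ℝ, 0 < l ∧ ∑ k ∈ V, k = l • (n + m)
  extend : ∀ S ⊆ V, IsClique S → S ≠ V → ∃ T, S ⊆ T ∧ T ⊆ V ∧ IsClique T ∧ T.card = 3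
  span : Submodule.span ℝ (V : Set Mink) = ⊤
  reflect_mem : ∀ n ∈ V, ∀ m ∈ V, lor n m = 2 → ∀ k ∈ V, reflect n m k ∈ V
  connected : ∀ n ∈ V, ∀ m ∈ V, n = m ∨ lor n m = 2 ∨ ∃ k ∈ V, lor n k = 2 ∧ lor k m = 2
  -- A horoball tangent to those at both ends of an edge, and lying on the tile's side of the edge,
  -- overlaps the horoball of a vertex adjacent to both ends.
  triangle : ∀ n ∈ V, ∀ m ∈ V, lor n m = 2 → ∀ k, IsNull k → lor n k = 2 → lor m k = 2 →
    (∃ c : Mink → ℝ, (∀ j ∈ V, j ≠ n → j ≠ m → 0 ≤ c j) ∧ k = ∑ j ∈ V, c j • j) →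
    ∃ a ∈ V, lor n a = 2 ∧ lor m a = 2 ∧ lor k a < 2
  -- A full-dimensional polyhedron spanned by some but not all vertices has a facet that contains a
  -- diagonal, and so the center of the tile.
  subspan : ∀ S ⊆ V, S ≠ V → Submodule.span ℝ (S : Set Mink) = ⊤ →
    ∃ e, e ≠ 0 ∧ (∀ n ∈ S, 0 ≤ lor n e) ∧ ∃ n ∈ S, ∃ m ∈ S, ∃ k ∈ S, n ≠ m ∧ k ≠ n ∧ k ≠ m ∧
      lor n m ≠ 2 ∧ lor n e = 0 ∧ lor m e = 0 ∧ lor k e = 0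

namespace IsRegular

variable {V W : Finset Mink}

theorem raySet (hV : IsRegular V) : IsRaySet V :=
  ⟨hV.null, fun n hn m hm hne => by linarith [hV.two_le n hn m hm hne]⟩

theorem four_le (hV : IsRegular V) : 4 ≤ V.card := four_le_card_of_span hV.span

theorem eq_of_parallel (hV : IsRegular V) {n m : Mink} (hn : n ∈ V) (hm : m ∈ V) {r : ℝ}
    (h : n = r • m) : n = m := by
  by_contra hne
  have := hV.two_le n hn m hm hne
  rw [h, lor_smul_left, (hV.null m hm).self] at this
  linarith

end IsRegular

theorem geodesicLine_eq_cell {n m : Mink} {p q : IdealPoint} {r s : ℝ} (hr : 0 < r) (hs : 0 < s)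
    (hn : n = r • nv p) (hm : m = s • nv q) (hpq : p ≠ q) : geodesicLine p q = cell {n, m} := by
  rw [geodesicLine_eq hpq]
  have i1 : nv p = r⁻¹ • n := by rw [hn, inv_smul_smul₀ hr.ne']
  have i2 : nv q = s⁻¹ • m := by rw [hm, inv_smul_smul₀ hs.ne']
  apply Set.Subset.antisymm <;> apply cell_subset <;> intro k hk <;>
    simp only [Finset.mem_insert, Finset.mem_singleton] at hk <;> rcases hk with rfl | rfl
  · rw [i1]; exact smul_mem_cone (mem_cone_of_mem (by simp)) (by positivity)
  · rw [i2]; exact smul_mem_cone (mem_cone_of_mem (by simp)) (by positivity)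
  · rw [hn]; exact smul_mem_cone (mem_cone_of_mem (by simp)) hr.le
  · rw [hm]; exact smul_mem_cone (mem_cone_of_mem (by simp)) hs.le

theorem ne_of_lor_eq_two {n m : Mink} (hn : IsNull n) (h : lor n m = 2) : n ≠ m := by
  rintro rfl
  rw [hn.self] at h
  norm_num at h

theorem IsRaySet.cell_nonempty {V : Finset Mink} (hV : IsRaySet V) (h : 1 < V.card) :
    (cell V).Nonempty := by
  obtain ⟨n, hn, m, hm, hne⟩ := Finset.one_lt_card.1 h
  obtain ⟨r, hr, -, e⟩ := vec_nrm' (isTime_add_of_lor_pos (hV.1 n hn).causal (hV.1 m hm).causal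
    (hV.2 n hn m hm hne))
  refine ⟨nrm (n + m), mem_cell_of_smul hr ?_⟩
  rw [← e]
  exact add_mem_cone (mem_cone_of_mem hn) (mem_cone_of_mem hm)

/-- A clique of at least three null vectors is determined by its cell. -/
theorem IsClique.eq_of_cell_eq {S T : Finset Mink} (hS : IsRaySet S) (hT : IsRaySet T)
    (cS : IsClique S) (cT : IsClique T) (h3 : 2 < S.card) (h : cell S = cell T) : S = T := by
  have hsub : S ⊆ T := by
    intro n hn
    have hex (x : Mink) (hx : x ∈ S) : ∃ x' ∈ T, ∃ r : ℝ, 0 < r ∧ x = r • x' := by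
      obtain ⟨y, hy, hne⟩ := Finset.exists_mem_ne (by omega : 1 < S.card) x
      exact hS.exists_parallel_of_cell_subset hT.1 h.subset hx hy hne.symm
    have hmul {x y x' y' : Mink} (hx : x ∈ S) (hy : y ∈ S) (hne : x ≠ y) (hx' : x' ∈ T)
        (hy' : y' ∈ T) {r s : ℝ} (e : x = r • x') (e' : y = s • y') : r * s = 1 := by
      have hne' : x' ≠ y' := by
        rintro rfl
        have := cS x hx y hy hne
        rw [e, e', lor_smul_left, lor_smul_right, (hT.1 _ hx').self] at this
        norm_num at this
      have h1 := cS x hx y hy hne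
      rw [e, e', lor_smul_left, lor_smul_right, cT _ hx' _ hy' hne'] at h1
      linarith
    obtain ⟨a, ha, han⟩ := Finset.exists_mem_ne (by omega : 1 < S.card) n
    obtain ⟨b, hb, hbn⟩ := Finset.exists_mem_ne
      (by rw [Finset.card_erase_of_mem ha]; omega : 1 < (S.erase a).card) n
    obtain ⟨hba, hb⟩ := Finset.mem_erase.1 hb
    obtain ⟨n', hn', r, hr, en⟩ := hex n hn
    obtain ⟨a', ha', s, hs, ea⟩ := hex a ha
    obtain ⟨b', hb', t, ht, eb⟩ := hex b hb
    -- The scale factors satisfy `r s = r t = s t = 1`, so all are 1. With only two vectors a common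
    -- rescaling `r`, `r⁻¹` would remain possible.
    have h1 := hmul hn ha han.symm hn' ha' en ea
    have h2 := hmul hn hb hbn.symm hn' hb' en eb
    have h3 := hmul ha hb hba.symm ha' hb' ea eb
    have hst : s = t := by
      have : r * s = r * t := by rw [h1, h2]
      exact mul_left_cancel₀ hr.ne' this
    subst hst
    have hs1 : s = 1 := by nlinarith
    have hr1 : r = 1 := by rw [hs1, mul_one] at h1; exact h1
    rw [en, hr1, one_smul]
    exact hn'
  refine hsub.antisymm fun n hn => ?_
  obtain ⟨m, hm, hne⟩ := Finset.exists_mem_ne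
    (by have := Finset.card_le_card hsub; omega : 1 < T.card) n
  obtain ⟨n', hn', r, hr, e⟩ := hT.exists_parallel_of_cell_subset hS.1 h.symm.subset hn hm hne.symm
  by_contra hnS
  have hne' : n ≠ n' := by rintro rfl; exact hnS hn'
  have := hT.2 n hn n' (hsub hn') hne'
  rw [e, lor_smul_left, (hS.1 n' hn').self, mul_zero] at this
  exact lt_irrefl _ this

/-! ### Faces of a regular cell, and recovery of its null vectors -/

namespace IsRegular

variable {V W : Finset Mink}

theorem mem_interior_of_add (hV : IsRegular V) {x : H3} {u : Mink} (hu : u ∈ cone V) {δ : ℝ}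
    (hδ : 0 < δ) (h : vec x = u + δ • ∑ n ∈ V, n) : x ∈ interior (cell V) := by
  obtain ⟨c, hc, rfl⟩ := hu
  refine mem_interior_cell hV.span (c := fun n => c n + δ) (fun n _ => by linarith [hc n]) ?_
  rw [h]
  simp only [add_smul, Finset.sum_add_distrib]
  rw [Finset.smul_sum]

/-- The support contains a diagonal `n`, `m`. Splitting off `min (c n) (c m) • (n + m)` isolates a
positive multiple of the sum of all vertices, which has every coefficient positive. -/
theorem mem_interior_of_not_clique (hV : IsRegular V) {S : Finset Mink} (hS : S ⊆ V)
    (hcl : ¬ IsClique S) {x : H3} {c : Mink → ℝ} (hc : ∀ n ∈ S, 0 < c n)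
    (h : vec x = ∑ n ∈ S, c n • n) : x ∈ interior (cell V) := by
  unfold IsClique at hcl
  push Not at hcl
  obtain ⟨n, hn, m, hm, hne, h2⟩ := hcl
  obtain ⟨l, hl, hl'⟩ := hV.opposite n (hS hn) m (hS hm) hne h2
  have hε : 0 < min (c n) (c m) := lt_min (hc n hn) (hc m hm)
  refine hV.mem_interior_of_add (δ := min (c n) (c m) / l)
    (u := ∑ k ∈ S, (c k) • k - min (c n) (c m) • (n + m)) ?_ (by positivity) ?_
  · have hm' : m ∈ S.erase n := Finset.mem_erase.2 ⟨hne.symm, hm⟩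
    rw [← Finset.add_sum_erase S _ hn, ← Finset.add_sum_erase _ _ hm']
    have : c n • n + (c m • m + ∑ k ∈ (S.erase n).erase m, c k • k) -
        min (c n) (c m) • (n + m) = (c n - min (c n) (c m)) • n + ((c m - min (c n) (c m)) • m +
          ∑ k ∈ (S.erase n).erase m, c k • k) := by module
    rw [this]
    refine add_mem_cone (smul_mem_cone (mem_cone_of_mem (hS hn)) (by simp)) (add_mem_cone
      (smul_mem_cone (mem_cone_of_mem (hS hm)) (by simp)) (sum_mem_cone fun k hk => ?_))
    have hkS := Finset.mem_of_mem_erase (Finset.mem_of_mem_erase hk)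
    exact smul_mem_cone (mem_cone_of_mem (hS hkS)) (hc k hkS).le
  · rw [h, hl', smul_smul, div_mul_cancel₀ _ hl.ne', sub_add_cancel]

/-- A face contains a point with positive coefficients on exactly its spanning vertices. If these
are not a clique, that point is interior to the tile, and the face is the whole tile. -/
theorem face_cases (hV : IsRegular V) {F : Set H3} (hF : IsFace F (cell V)) :
    F = cell V ∨ ∃ S ⊆ V, S ≠ V ∧ IsClique S ∧ 1 < S.card ∧ F = cell S := by
  obtain ⟨S, hS, rfl, x, hx, c, hc, h⟩ := hF.exists_eq_cell
  by_cases hcl : IsClique S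
  · rcases eq_or_ne S V with rfl | hne
    · exact Or.inl rfl
    · exact Or.inr ⟨S, hS, hne, hcl, one_lt_card_of_vec_eq_sum (fun n hn => hV.null n (hS hn)) h,
        rfl⟩
  · exact Or.inl (hF.eq_of_mem_interior hx (hV.mem_interior_of_not_clique hS hcl hc h))

theorem lor_sum_clique (hV : IsRegular V) {S : Finset Mink} (hS : S ⊆ V) (cS : IsClique S)
    {n : Mink} (hn : n ∈ S) : lor n (∑ m ∈ S, m) = 2 * ((S.card : ℝ) - 1) := by
  rw [lor_sum_right, ← Finset.add_sum_erase S _ hn, (hV.null n (hS hn)).self,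
    Finset.sum_congr rfl fun m hm => cS n hn m (Finset.mem_of_mem_erase hm)
      (Finset.ne_of_mem_erase hm).symm, Finset.sum_const, Finset.card_erase_of_mem hn,
    nsmul_eq_mul, Nat.cast_sub (Finset.card_pos.2 ⟨n, hn⟩)]
  push_cast
  ring

theorem lt_lor_sum_of_notMem (hV : IsRegular V) {S : Finset Mink} (hS : S ⊆ V) {n : Mink}
    (hnV : n ∈ V) (hn : n ∉ S) : 2 * ((S.card : ℝ) - 1) < lor n (∑ m ∈ S, m) := by
  rw [lor_sum_right]
  have : ∑ m ∈ S, (2 : ℝ) ≤ ∑ m ∈ S, lor n m := Finset.sum_le_sum fun m hm =>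
    hV.two_le n hnV m (hS hm) (by rintro rfl; exact hn hm)
  rw [Finset.sum_const, nsmul_eq_mul] at this
  linarith

/-- A functional that supports the cone along a clique. -/
theorem exists_functional (hV : IsRegular V) {S : Finset Mink} (hS : S ⊆ V) (cS : IsClique S) :
    ∃ e, (∀ n ∈ S, lor n e = 0) ∧ ∀ n ∈ V, n ∉ S → 0 < lor n e := by
  obtain ⟨τ, hτ, hb⟩ := hV.balanced
  -- A vertex of the clique has product `2 (card S - 1)` with the sum of `S`, any other vertex at
  -- least `2 card S`. The multiple of the central vector subtracts the former value from both.
  refine ⟨∑ m ∈ S, m - (2 * ((S.card : ℝ) - 1) / τ) • ∑ m ∈ V, m, fun n hn => ?_,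
    fun n hnV hn => ?_⟩
  · rw [lor_sub_right, lor_smul_right, hb n (hS hn), hV.lor_sum_clique hS cS hn]
    field_simp
    ring
  · rw [lor_sub_right, lor_smul_right, hb n hnV, div_mul_cancel₀ _ hτ.ne']
    linarith [hV.lt_lor_sum_of_notMem hS hnV hn]

theorem isFace_of_clique (hV : IsRegular V) {S : Finset Mink} (hS : S ⊆ V) (cS : IsClique S)
    (h : 1 < S.card) : IsFace (cell S) (cell V) := by
  obtain ⟨e, h0, h1⟩ := hV.exists_functional hS cS
  exact isFace_cell_of_functional hS ((hV.raySet.mono hS).cell_nonempty h) h0 h1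

/-- The support of a boundary point is a clique, and is not all of `V`. The second restriction
matters for the tetrahedron, whose vertices form a clique. -/
theorem exists_triangle_of_notMem_interior (hV : IsRegular V) {x : H3} (hx : x ∈ cell V)
    (hi : x ∉ interior (cell V)) : ∃ T ⊆ V, IsClique T ∧ T.card = 3 ∧ x ∈ cell T := by
  obtain ⟨c, hc, h⟩ := hx
  rw [← sum_filter_pos hc] at h
  set S := V.filter fun n => 0 < c n
  have hSV : S ⊆ V := Finset.filter_subset _ _
  have hpos : ∀ n ∈ S, 0 < c n := fun n hn => (Finset.mem_filter.1 hn).2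
  have hcl : IsClique S := by
    by_contra hcl
    exact hi (hV.mem_interior_of_not_clique hSV hcl hpos h)
  have hne : S ≠ V := by
    intro hSV'
    rw [hSV'] at hpos h
    exact hi (mem_interior_cell hV.span hpos h)
  obtain ⟨T, hST, hTV, cT, hT⟩ := hV.extend S hSV hcl hne
  exact ⟨T, hTV, cT, hT, cell_mono hST ⟨c, hc, h⟩⟩

/-- A horoball of the configuration only meets the faces at its center. -/
theorem mem_of_hb_inter (hV : IsRegular V) {S : Finset Mink} (hS : S ⊆ V) (cS : IsClique S)
    {n : Mink} (hn : n ∈ V) {x : H3} (hx : x ∈ cell S) (hxn : x ∈ hb n) : n ∈ S := by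
  by_contra hnS
  have hxn : lor n (vec x) ≤ 1 := hxn
  obtain ⟨c, hc, h⟩ := hx
  -- Each product of `n` with `S` is at least 2, so the coefficients of `x` add up to at most 1/2.
  -- Products within `S` are at most 2, so `lor x x ≤ 2 (∑ c)² ≤ 1/2`, contrary to unit length.
  have h1 : 2 * ∑ m ∈ S, c m ≤ 1 := by
    refine le_trans ?_ hxn
    rw [h, lor_sum_right, Finset.mul_sum]
    refine Finset.sum_le_sum fun m hm => ?_
    rw [lor_smul_right]
    have := hV.two_le n hn m (hS hm) (by rintro rfl; exact hnS hm)
    nlinarith [hc m]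
  have h2 (m) (hm : m ∈ S) : lor m (vec x) ≤ 2 * ∑ k ∈ S, c k := by
    rw [h, lor_sum_right, Finset.mul_sum]
    refine Finset.sum_le_sum fun k hk => ?_
    rw [lor_smul_right]
    have : lor m k ≤ 2 := by
      rcases eq_or_ne m k with rfl | hne
      · rw [(hV.null m (hS hm)).self]; norm_num
      · exact (cS m hm k hk hne).le
    nlinarith [hc k]
  have h3 : 1 ≤ (∑ m ∈ S, c m) * (2 * ∑ k ∈ S, c k) := by
    have := lor_vec_self x
    rw [← this]
    conv_lhs => arg 1; rw [h]
    rw [lor_sum_left, Finset.sum_mul]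
    refine Finset.sum_le_sum fun m hm => ?_
    rw [lor_smul_left]
    exact mul_le_mul_of_nonneg_left (h2 m hm) (hc m)
  have h0 : 0 ≤ ∑ m ∈ S, c m := Finset.sum_nonneg fun m _ => hc m
  nlinarith

/-- Every point of a tile is close to one of its vertices. -/
theorem exists_lor_le_two (hV : IsRegular V) {x : H3} (hx : x ∈ cell V) :
    ∃ n ∈ V, lor n (vec x) ≤ 2 := by
  by_contra! hcon
  obtain ⟨c, hc, h⟩ := hx
  -- If all heights exceed 2, unit length bounds the sum of the coefficients by 1/2. Since products
  -- of vertices are at most 4, each height is then at most 2.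
  have h1 : 2 * ∑ m ∈ V, c m ≤ 1 := by
    rw [← lor_vec_self x]
    conv_rhs => arg 1; rw [h]
    rw [lor_sum_left, Finset.mul_sum]
    refine Finset.sum_le_sum fun m hm => ?_
    rw [lor_smul_left]
    nlinarith [hc m, hcon m hm]
  obtain ⟨n, hn⟩ : V.Nonempty := Finset.card_pos.1 (by have := hV.four_le; omega)
  have h2 : lor n (vec x) ≤ 4 * ∑ m ∈ V, c m := by
    rw [h, lor_sum_right, Finset.mul_sum]
    refine Finset.sum_le_sum fun m hm => ?_
    rw [lor_smul_right]
    nlinarith [hc m, hV.le_four n hn m hm]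
  linarith [hcon n hn]

theorem exists_triangle_mem (hV : IsRegular V) {n : Mink} (hn : n ∈ V) :
    ∃ T ⊆ V, IsClique T ∧ T.card = 3 ∧ n ∈ T := by
  obtain ⟨T, h1, h2, h3, h4⟩ := hV.extend {n} (by simpa using hn)
    (fun a ha b hb hne => by simp at ha hb; exact absurd (ha.trans hb.symm) hne)
    (fun h => by have := hV.four_le; rw [← h] at this; simp at this)
  exact ⟨T, h2, h3, h4, h1 (by simp)⟩

theorem cell_ne_of_card_lt (hV : IsRegular V) {T : Finset Mink} (hT : T ⊆ V)
    (h : T.card < V.card) : cell T ≠ cell V := by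
  intro he
  have : V ⊆ T := by
    intro n hn
    obtain ⟨m, hm, hne⟩ := Finset.exists_mem_ne (by have := hV.four_le; omega : 1 < V.card) n
    obtain ⟨n', hn', r, -, e⟩ := hV.raySet.exists_parallel_of_cell_subset
      (fun k hk => hV.null k (hT hk)) he.symm.subset hn hm hne.symm
    rwa [hV.eq_of_parallel hn (hT hn') e]
  exact absurd (Finset.card_le_card this) (not_le.2 h)

/-- Each vertex lies on a triangular face. This is also a proper face of the other cell, hence
spanned by a clique there, and it determines its null vectors. -/
theorem subset_of_cell_eq (hV : IsRegular V) (hW : IsRegular W) (h : cell V = cell W) :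
    V ⊆ W := by
  intro n hn
  obtain ⟨T, hT, cT, h3, hnT⟩ := hV.exists_triangle_mem hn
  have hF := hV.isFace_of_clique hT cT (by omega)
  rw [h] at hF
  rcases hW.face_cases hF with h' | ⟨S, hS, -, cS, -, e⟩
  · rw [← h] at h'
    exact absurd h' (hV.cell_ne_of_card_lt hT (by have := hV.four_le; omega))
  · rw [cT.eq_of_cell_eq (hV.raySet.mono hT) (hW.raySet.mono hS) cS (by omega) e] at hnT
    exact hS hnT

/-- The normalized vertices are determined by the tile. -/
theorem eq_of_cell_eq (hV : IsRegular V) (hW : IsRegular W) (h : cell V = cell W) : V = W :=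
  (hV.subset_of_cell_eq hW h).antisymm (hW.subset_of_cell_eq hV h.symm)

theorem isIdealVertex_iff (hV : IsRegular V) {p : IdealPoint} :
    IsIdealVertex p (cell V) ↔ ∃ n ∈ V, ∃ r : ℝ, 0 < r ∧ n = r • nv p := by
  classical
  constructor
  · rintro ⟨hne, W, hW, hp, e⟩
    rw [idealHull_eq_cell hW.toFinset (by simp)] at e
    have hR := isRaySet_image_nv hW.toFinset
    rw [e] at hne
    obtain ⟨m, hm, hne'⟩ := Finset.exists_mem_ne (cell_nonempty_card hR.1 hne) (nv p)
    obtain ⟨n, hn, r, hr, e'⟩ := hR.exists_parallel_of_cell_subset hV.null e.symm.subset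
      (Finset.mem_image_of_mem _ (hW.mem_toFinset.2 hp)) hm hne'.symm
    exact ⟨n, hn, r⁻¹, by positivity, by rw [e', inv_smul_smul₀ hr.ne']⟩
  · rintro ⟨n, hn, r, hr, e⟩
    refine ⟨hV.raySet.cell_nonempty (by have := hV.four_le; omega), ?_⟩
    have hex : ∀ k : Mink, ∃ q : IdealPoint, k ∈ V → ∃ s : ℝ, 0 < s ∧ k = s • nv q := by
      intro k
      by_cases hk : k ∈ V
      · obtain ⟨q, hq⟩ := (hV.null k hk).exists_nv
        exact ⟨q, fun _ => hq⟩
      · exact ⟨p, fun h => absurd h hk⟩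
    choose f hf using hex
    have hfp : f n = p := by
      obtain ⟨s, hs, e'⟩ := hf n hn
      refine eq_of_smul_nv (r := s⁻¹ * r) ?_
      rw [mul_smul, ← e, e', inv_smul_smul₀ hs.ne', ← e']
    refine ⟨(V.image f : Finset IdealPoint), Finset.finite_toSet _, ?_, ?_⟩
    · rw [← hfp]
      exact_mod_cast Finset.mem_image_of_mem _ hn
    · rw [idealHull_eq_cell _ rfl]
      apply Set.Subset.antisymm
      · apply cell_subset
        intro k hk
        obtain ⟨s, hs, e'⟩ := hf k hk
        rw [e']
        exact smul_mem_cone (mem_cone_of_mem (Finset.mem_image_of_mem _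
          (Finset.mem_image_of_mem _ hk))) hs.le
      · apply cell_subset
        intro k' hk'
        obtain ⟨q, hq, rfl⟩ := Finset.mem_image.1 hk'
        obtain ⟨k, hk, rfl⟩ := Finset.mem_image.1 hq
        obtain ⟨s, hs, e'⟩ := hf k hk
        have : nv (f k) = s⁻¹ • k := by conv_rhs => rw [e', inv_smul_smul₀ hs.ne']
        rw [this]
        exact smul_mem_cone (mem_cone_of_mem hk) (by positivity)

theorem isEdge_iff (hV : IsRegular V) {e : Set H3} :
    IsEdge e (cell V) ↔ ∃ n ∈ V, ∃ m ∈ V, lor n m = 2 ∧ e = cell {n, m} := by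
  constructor
  · rintro ⟨hF, p, q, hpq, e'⟩
    obtain ⟨S, hS, hc, hcard, rfl⟩ :
        ∃ S ⊆ V, (S = V ∨ IsClique S) ∧ 1 < S.card ∧ e = cell S := by
      rcases hV.face_cases hF with h | ⟨S, hS, -, cS, h1, h⟩
      · exact ⟨V, subset_rfl, Or.inl rfl, by have := hV.four_le; omega, h⟩
      · exact ⟨S, hS, Or.inr cS, h1, h⟩
    rw [geodesicLine_eq hpq] at e'
    have hpar (n) (hn : n ∈ S) : (∃ r : ℝ, 0 < r ∧ n = r • nv p) ∨ ∃ r : ℝ, 0 < r ∧ n = r • nv q := by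
      obtain ⟨m, hm, hne⟩ := Finset.exists_mem_ne hcard n
      obtain ⟨n', hn', h⟩ := (hV.raySet.mono hS).exists_parallel_of_cell_subset
        (fun k hk => by
          simp only [Finset.mem_insert, Finset.mem_singleton] at hk
          rcases hk with rfl | rfl <;> exact isNull_nv _) e'.subset hn hm hne.symm
      simp only [Finset.mem_insert, Finset.mem_singleton] at hn'
      rcases hn' with rfl | rfl
      · exact Or.inl h
      · exact Or.inr h
    have huniq {n m : Mink} (hn : n ∈ S) (hm : m ∈ S) {v : Mink} (h1 : ∃ r : ℝ, 0 < r ∧ n = r • v)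
        (h2 : ∃ r : ℝ, 0 < r ∧ m = r • v) : n = m := by
      obtain ⟨r, hr, rfl⟩ := h1
      obtain ⟨s, hs, e⟩ := h2
      refine (hV.eq_of_parallel (hS hm) (hS hn) (r := s * r⁻¹) ?_).symm
      rw [smul_smul, inv_mul_cancel_right₀ hr.ne', e]
    obtain ⟨n, hn, m, hm, hne⟩ := Finset.one_lt_card.1 hcard
    have hSeq : S = {n, m} := by
      apply Finset.Subset.antisymm
      · intro k hk
        simp only [Finset.mem_insert, Finset.mem_singleton]
        rcases hpar n hn with h1 | h1 <;> rcases hpar m hm with h2 | h2 <;>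
          rcases hpar k hk with h3 | h3
        all_goals first
          | exact absurd (huniq hn hm h1 h2) hne
          | exact Or.inl (huniq hk hn h3 h1)
          | exact Or.inr (huniq hk hm h3 h2)
      · intro k hk
        simp only [Finset.mem_insert, Finset.mem_singleton] at hk
        rcases hk with rfl | rfl <;> assumption
    rcases hc with rfl | cS
    · have := hV.four_le
      rw [hSeq, Finset.card_pair hne] at this
      omega
    · exact ⟨n, hS hn, m, hS hm, cS n hn m hm hne, by rw [hSeq]⟩
  · rintro ⟨n, hn, m, hm, h2, rfl⟩
    have hne := ne_of_lor_eq_two (hV.null n hn) h2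
    refine ⟨hV.isFace_of_clique ?_ ?_ (by rw [Finset.card_pair hne]; omega), ?_⟩
    · intro k hk
      simp only [Finset.mem_insert, Finset.mem_singleton] at hk
      rcases hk with rfl | rfl <;> assumption
    · intro a ha b hb hab
      simp only [Finset.mem_insert, Finset.mem_singleton] at ha hb
      rcases ha with rfl | rfl <;> rcases hb with rfl | rfl
      · exact absurd rfl hab
      · exact h2
      · rwa [lor_comm]
      · exact absurd rfl hab
    · obtain ⟨p, r, hr, e1⟩ := (hV.null n hn).exists_nv
      obtain ⟨q, s, hs, e2⟩ := (hV.null m hm).exists_nv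
      have hpq : p ≠ q := by
        rintro rfl
        rw [e1, e2, lor_smul_left, lor_smul_right, (isNull_nv p).self] at h2
        norm_num at h2
      exact ⟨p, q, hpq, (geodesicLine_eq_cell hr hs e1 e2 hpq).symm⟩

end IsRegular

/-- A cell with three generators is not contained in a geodesic. -/
theorem IsRaySet.not_subset_geodesicLine {T : Finset Mink} (hT : IsRaySet T) (h : 2 < T.card) :
    ¬ ∃ p q, cell T ⊆ geodesicLine p q := by
  rintro ⟨p, q, hs⟩
  rcases eq_or_ne p q with rfl | hpq
  · rw [geodesicLine_self] at hs
    obtain ⟨x, hx⟩ := hT.cell_nonempty (by omega)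
    exact hs hx
  rw [geodesicLine_eq hpq] at hs
  have hpar : ∀ n ∈ T, ∃ n' ∈ ({nv p, nv q} : Finset Mink), ∃ r : ℝ, 0 < r ∧ n = r • n' := by
    intro n hn
    obtain ⟨m, hm, hne⟩ := Finset.exists_mem_ne (by omega : 1 < T.card) n
    exact hT.exists_parallel_of_cell_subset (fun k hk => by
      simp only [Finset.mem_insert, Finset.mem_singleton] at hk
      rcases hk with rfl | rfl <;> exact isNull_nv _) hs hn hm hne.symm
  choose! f hf using hpar
  obtain ⟨n, hn, m, hm, hne, hnm⟩ := Finset.exists_ne_map_eq_of_card_lt_of_maps_to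
    (lt_of_le_of_lt Finset.card_le_two h) (fun n hn => (hf n hn).1)
  obtain ⟨r, hr, e1⟩ := (hf n hn).2
  obtain ⟨s, hs', e2⟩ := (hf m hm).2
  have := hT.2 n hn m hm hne
  have hnull : IsNull (f n) := by
    have := (hf n hn).1
    simp only [Finset.mem_insert, Finset.mem_singleton] at this
    rcases this with h | h <;> rw [h] <;> exact isNull_nv _
  rw [e1, e2, ← hnm, lor_smul_left, lor_smul_right, hnull.self] at this
  simp at this

theorem IsRegular.isTwoFace_iff {V : Finset Mink} (hV : IsRegular V) {f : Set H3} :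
    IsTwoFace f (cell V) ↔ ∃ T ⊆ V, IsClique T ∧ T.card = 3 ∧ f = cell T := by
  constructor
  · rintro ⟨hF, hpl, hg⟩
    rcases hV.face_cases hF with rfl | ⟨S, hS, hne, cS, h1, rfl⟩
    · have hi : (interior (cell V)).Nonempty := by
        obtain ⟨x, hx⟩ := hF.1
        exact closure_nonempty_iff.1 ⟨x, cell_subset_closure_interior hV.span hx⟩
      exact absurd hpl (not_planar_of_interior hi)
    · obtain ⟨T, hST, -, -, hT3⟩ := hV.extend S hS cS hne
      have hle := Finset.card_le_card hST
      refine ⟨S, hS, cS, ?_, rfl⟩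
      by_contra h3
      have h2 : S.card = 2 := by omega
      obtain ⟨n, m, hnm, rfl⟩ := Finset.card_eq_two.1 h2
      have hE := hV.isEdge_iff.2 ⟨n, hS (by simp), m, hS (by simp),
        cS n (by simp) m (by simp) hnm, rfl⟩
      obtain ⟨-, p, q, -, e⟩ := hE
      exact hg ⟨p, q, e.subset⟩
  · rintro ⟨T, hT, cT, h3, rfl⟩
    have hR := hV.raySet.mono hT
    refine ⟨hV.isFace_of_clique hT cT (by omega), ?_, hR.not_subset_geodesicLine (by omega)⟩
    obtain ⟨e, h0, h1⟩ := hV.exists_functional hT cT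
    have he : e ≠ 0 := by
      rintro rfl
      obtain ⟨n, hn, hnT⟩ := Finset.exists_mem_notMem_of_card_lt_card
        (by have := hV.four_le; omega : T.card < V.card)
      have := h1 n hn hnT
      rw [lor_zero_right] at this
      exact lt_irrefl _ this
    obtain ⟨x, hx⟩ := hR.cell_nonempty (by omega)
    obtain ⟨a, b, hab, h⟩ := exists_bisector he (lor_eq_zero_of_mem_cell h0 hx)
    exact ⟨a, b, hab, fun y hy => h y (lor_eq_zero_of_mem_cell h0 hy)⟩

/-! ### Reflections -/

theorem reflect_left {n m : Mink} (hn : IsNull n) (h : lor n m = 2) :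
    reflect n m n = m := by
  rw [reflect_apply, lor_sub_right, hn.self, h]
  module

theorem reflect_reflect {n m : Mink} (hn : IsNull n) (hm : IsNull m) (h : lor n m = 2) (u : Mink) :
    reflect n m (reflect n m u) = u := by
  rw [reflect_apply n m (reflect n m u), reflect_apply]
  have : lor (u + (lor u (n - m) / 2) • (n - m)) (n - m) = - lor u (n - m) := by
    rw [lor_add_left, lor_smul_left]
    have : lor (n - m) (n - m) = -4 := by
      rw [lor_sub_left, lor_sub_right, lor_sub_right, hn.self, hm.self, lor_comm m n, h]
      norm_num
    rw [this]
    ring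
  rw [this]
  module

theorem lor_reflect {n m : Mink} (hn : IsNull n) (hm : IsNull m) (h : lor n m = 2) (u w : Mink) :
    lor (reflect n m u) (reflect n m w) = lor u w := by
  have h4 : lor (n - m) (n - m) = -4 := by
    rw [lor_sub_left, lor_sub_right, lor_sub_right, hn.self, hm.self, lor_comm m n, h]
    norm_num
  simp only [reflect_apply, lor_add_left, lor_add_right, lor_smul_left, lor_smul_right, h4,
    lor_comm (n - m) w]
  ring

theorem exists_reflection {n m : Mink} (hn : IsNull n) (hm : IsNull m) (h : lor n m = 2) :
    ∃ g : H3 ≃ᵢ H3, ∃ L, Induces g L ∧ ∀ u, L u = reflect n m u := by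
  have hT (x : H3) : IsTime (reflect n m (vec x)) := by
    set u := reflect n m (vec x) with hu
    have h1 : lor u u = 1 := by rw [hu, lor_reflect hn hm h, lor_vec_self]
    have h2 : 0 < lor m u := by
      rw [← reflect_left hn h, hu, lor_reflect hn hm h]
      exact hn.lor_vec_pos x
    refine ⟨?_, by rw [h1]; exact one_pos⟩
    -- An image in the past would have a nonpositive product with `m`, whereas the reflection
    -- carries the positive product `lor n (vec x)` to `lor m u`.
    by_contra! hle
    have hneg : IsCausal (-u) := by
      have h3 : lor (-u) (-u) = 1 := by
        rw [← h1, ← neg_one_smul ℝ u, lor_smul_left, lor_smul_right]; ring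
      refine ⟨?_, by simpa using hle, by rw [h3]; exact zero_le_one⟩
      simp only [lor] at h1
      simp only [Prod.fst_neg, Left.nonneg_neg_iff]
      nlinarith [mul_self_nonneg u.2.2.re, mul_self_nonneg u.2.2.im]
    have := hm.causal.lor_nonneg hneg
    rw [← neg_one_smul ℝ u, lor_smul_right] at this
    linarith
  obtain ⟨g, hg⟩ := exists_isometry_of_involutive (reflect n m) (reflect_reflect hn hm h)
    (lor_reflect hn hm h) hT
  exact ⟨g, LinearEquiv.ofInvolutive (reflect n m) (reflect_reflect hn hm h),
    ⟨fun x => (hg x).symm, lor_reflect hn hm h⟩, fun _ => rfl⟩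

theorem IsRegular.exists_symmetry_adjacent {V : Finset Mink} (hV : IsRegular V) {n m : Mink}
    (hn : n ∈ V) (hm : m ∈ V) (h : lor n m = 2) :
    ∃ g ∈ symmetryGroup (cell V), ∃ L, Induces g L ∧ L n = m := by
  obtain ⟨g, L, hL, e⟩ := exists_reflection (hV.null n hn) (hV.null m hm) h
  refine ⟨g, ?_, L, hL, by rw [e, reflect_left (hV.null n hn) h]⟩
  have hVL : V.image L = V := by
    apply Finset.eq_of_subset_of_card_le
    · intro k hk
      obtain ⟨j, hj, rfl⟩ := Finset.mem_image.1 hk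
      rw [e]
      exact hV.reflect_mem n hn m hm h j hj
    · rw [Finset.card_image_of_injective _ L.injective]
  change g '' cell V = cell V
  rw [hL.image_cell, hVL]

theorem IsRegular.exists_symmetry {V : Finset Mink} (hV : IsRegular V) {n m : Mink}
    (hn : n ∈ V) (hm : m ∈ V) : ∃ g ∈ symmetryGroup (cell V), ∃ L, Induces g L ∧ L n = m := by
  rcases hV.connected n hn m hm with rfl | h | ⟨k, hk, h1, h2⟩
  · exact ⟨1, one_mem _, LinearEquiv.refl ℝ _, ⟨fun x => rfl, fun _ _ => rfl⟩, rfl⟩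
  · exact hV.exists_symmetry_adjacent hn hm h
  · obtain ⟨g, hg, L, hL, e⟩ := hV.exists_symmetry_adjacent hn hk h1
    obtain ⟨g', hg', L', hL', e'⟩ := hV.exists_symmetry_adjacent hk hm h2
    refine ⟨g' * g, mul_mem hg' hg, L.trans L', ⟨fun x => ?_, fun u w => ?_⟩, ?_⟩
    · rw [LinearEquiv.trans_apply, hL.1, hL'.1]; rfl
    · rw [LinearEquiv.trans_apply, LinearEquiv.trans_apply, hL'.2, hL.2]
    · rw [LinearEquiv.trans_apply, e, e']

/-! ### Tetrahedra and octahedra -/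

/-- The vertices of a regular ideal tetrahedron. -/
def IsTet (V : Finset Mink) : Prop :=
  Submodule.span ℝ (V : Set Mink) = ⊤ ∧ ∃ f : Fin 4 → Mink, V = Finset.univ.image f ∧
    (∀ i, IsNull (f i)) ∧ ∀ i j, i ≠ j → lor (f i) (f j) = 2

/-- The vertices of a regular ideal octahedron, in three pairs of opposite ones. -/
def IsOct (V : Finset Mink) : Prop :=
  Submodule.span ℝ (V : Set Mink) = ⊤ ∧ ∃ f : Fin 3 × Bool → Mink, V = Finset.univ.image f ∧
    (∀ p, IsNull (f p)) ∧ (∀ i j s t, i ≠ j → lor (f (i, s)) (f (j, t)) = 2) ∧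
    (∀ i s, lor (f (i, s)) (f (i, !s)) = 4) ∧ ∃ w, ∀ i s, f (i, s) + f (i, !s) = w

theorem span_image_eq_top {V : Finset Mink} (h : Submodule.span ℝ (V : Set Mink) = ⊤)
    (L : Mink ≃ₗ[ℝ] Mink) : Submodule.span ℝ ((V.image L : Finset Mink) : Set Mink) = ⊤ := by
  rw [Finset.coe_image]
  have := Submodule.span_image (s := (V : Set Mink)) L.toLinearMap
  rw [h, Submodule.map_top, LinearEquiv.range] at this
  exact this

theorem IsTet.image {V : Finset Mink} (hV : IsTet V) {g : H3 ≃ᵢ H3} {L : Mink ≃ₗ[ℝ] Mink}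
    (h : Induces g L) : IsTet (V.image L) := by
  obtain ⟨hs, f, rfl, hn, h2⟩ := hV
  exact ⟨span_image_eq_top hs L, L ∘ f, Finset.image_image, fun i => h.isNull (hn i),
    fun i j hij => (h.2 _ _).trans (h2 i j hij)⟩

theorem IsOct.image {V : Finset Mink} (hV : IsOct V) {g : H3 ≃ᵢ H3} {L : Mink ≃ₗ[ℝ] Mink}
    (h : Induces g L) : IsOct (V.image L) := by
  obtain ⟨hs, f, rfl, hn, h2, h4, w, hw⟩ := hV
  refine ⟨span_image_eq_top hs L, L ∘ f, Finset.image_image, fun i => h.isNull (hn i),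
    fun i j s t hij => (h.2 _ _).trans (h2 i j s t hij), fun i s => (h.2 _ _).trans (h4 i s),
    L w, fun i s => ?_⟩
  rw [← hw i s, map_add]
  rfl

theorem IsTet.isRegular {V : Finset Mink} (hV : IsTet V) : IsRegular V := by
  obtain ⟨hs, f, rfl, hn, h2⟩ := hV
  have hl (i j) : lor (f i) (f j) = if i = j then 0 else 2 := by
    split_ifs with h
    · rw [h, (hn j).self]
    · exact h2 i j h
  have hinj : Function.Injective f := by
    intro i j h
    by_contra hne
    have := h2 i j hne
    rw [h, (hn j).self] at this
    norm_num at this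
  have hsum (F : Mink → Mink) : ∑ n ∈ Finset.univ.image f, F n = ∑ i, F (f i) :=
    Finset.sum_image fun a _ b _ h => hinj h
  have hmem {p : Mink → Prop} : (∀ n ∈ Finset.univ.image f, p n) ↔ ∀ i, p (f i) := by simp
  have hcard : (Finset.univ.image f).card = 4 := by
    rw [Finset.card_image_of_injective _ hinj]; rfl
  refine ⟨hmem.2 hn, ?_, ?_, ⟨6, by norm_num, ?_⟩, ?_, ?_, hs, ?_, ?_, ?_, ?_⟩
  · simp only [hmem]
    exact fun i j hij => (h2 i j fun h => hij (by rw [h])).ge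
  · simp only [hmem]
    intro i j
    rw [hl]
    split_ifs <;> norm_num
  · simp only [hmem]
    intro i
    rw [hsum, lor_sum_right]
    simp only [hl]
    fin_cases i <;> simp [Fin.sum_univ_four] <;> norm_num
  · simp only [hmem]
    exact fun i j hij h => absurd (h2 i j fun h => hij (by rw [h])) h
  · intro S hS _ hne
    obtain ⟨d, hd, hdS⟩ := Finset.exists_of_ssubset (hS.ssubset_of_ne hne)
    refine ⟨(Finset.univ.image f).erase d, fun n hn => Finset.mem_erase.2
      ⟨fun h => hdS (h ▸ hn), hS hn⟩, Finset.erase_subset _ _, ?_, ?_⟩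
    · intro n hn m hm hne
      obtain ⟨i, -, rfl⟩ := Finset.mem_image.1 (Finset.mem_of_mem_erase hn)
      obtain ⟨j, -, rfl⟩ := Finset.mem_image.1 (Finset.mem_of_mem_erase hm)
      exact h2 i j fun h => hne (by rw [h])
    · rw [Finset.card_erase_of_mem hd, hcard]
  · simp only [hmem]
    intro i j hij k
    have hij' : i ≠ j := fun h => by rw [hl, if_pos h] at hij; norm_num at hij
    rw [reflect_apply, lor_sub_right, hl, hl]
    rcases eq_or_ne k i with rfl | hki
    · rw [if_pos rfl, if_neg hij']
      have : f k + ((0 - 2 : ℝ) / 2) • (f k - f j) = f j := by module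
      rw [this]
      simp
    rcases eq_or_ne k j with rfl | hkj
    · rw [if_pos rfl, if_neg hij'.symm]
      have : f k + ((2 - 0 : ℝ) / 2) • (f i - f k) = f i := by module
      rw [this]
      simp
    · rw [if_neg hki, if_neg hkj]
      simp
  · simp only [hmem]
    intro i j
    rcases eq_or_ne i j with rfl | h
    · exact Or.inl rfl
    · exact Or.inr (Or.inl (h2 i j h))
  · simp only [hmem]
    rintro i j hij k hk hik hjk ⟨c, hc, hkc⟩
    have hij' : i ≠ j := fun h => by rw [hl, if_pos h] at hij; norm_num at hij
    have hex : ∀ i j : Fin 4, i ≠ j → ∃ l p, i ≠ l ∧ i ≠ p ∧ j ≠ l ∧ j ≠ p ∧ l ≠ p ∧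
      (Finset.univ : Finset (Fin 4)) = {i, j, l, p} := by decide
    obtain ⟨l, p, il, ip, jl, jp, lp, hu⟩ := hex i j hij'
    have hc1 := hc l (fun h => il (hinj h).symm) (fun h => jl (hinj h).symm)
    have hc2 := hc p (fun h => ip (hinj h).symm) (fun h => jp (hinj h).symm)
    have hk' : k = c (f i) • f i + (c (f j) • f j + (c (f l) • f l + c (f p) • f p)) := by
      rw [hkc, hsum, hu, Finset.sum_insert (by simp [hij', il, ip]),
        Finset.sum_insert (by simp [jl, jp]), Finset.sum_pair lp]
    have e1 (x : Fin 4) : lor (f x) k = c (f i) * (if x = i then 0 else 2) +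
        (c (f j) * (if x = j then 0 else 2) + (c (f l) * (if x = l then 0 else 2) +
          c (f p) * (if x = p then 0 else 2))) := by
      rw [hk']
      simp only [lor_add_right, lor_smul_right, hl]
    have e2 : c (f i) * lor (f i) k + (c (f j) * lor (f j) k + (c (f l) * lor (f l) k +
        c (f p) * lor (f p) k)) = 0 := by
      rw [← hk.self]
      conv_rhs => arg 1; rw [hk']
      simp only [lor_add_left, lor_smul_left]
    have ei := e1 i
    have ej := e1 j
    have el := e1 l
    have ep := e1 p
    simp only [if_true, if_neg hij', if_neg il, if_neg ip, if_neg hij'.symm, if_neg jl, if_neg jp,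
      if_neg il.symm, if_neg jl.symm, if_neg lp, if_neg ip.symm, if_neg jp.symm, if_neg lp.symm]
      at ei ej el ep
    by_contra! hcon
    have q1 := hcon _ (Finset.mem_image_of_mem f (Finset.mem_univ l)) (h2 i l il) (h2 j l jl)
    have q2 := hcon _ (Finset.mem_image_of_mem f (Finset.mem_univ p)) (h2 i p ip) (h2 j p jp)
    rw [lor_comm] at q1 q2
    rw [hik] at ei e2
    rw [hjk] at ej e2
    generalize c (f i) = A at *
    generalize c (f j) = B at *
    generalize c (f l) = β at *
    generalize c (f p) = γ at *
    have hA : A = 1 - β - γ := by linarith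
    have hB : B = 1 - β - γ := by linarith
    -- Here `β`, `γ` are the nonnegative coefficients of `k` at the two vertices off the edge.
    -- Tangency at both ends gives `A = B = 1 - β - γ`, and nullity becomes `β² + β γ + γ² = 1`. Not
    -- overlapping either vertex means `2 β + γ ≤ 1` and `β + 2 γ ≤ 1`, so `β + γ ≤ 2/3`, which is
    -- incompatible.
    subst hA hB
    rw [el, ep] at e2
    have : β ^ 2 + β * γ + γ ^ 2 = 1 := by nlinarith
    nlinarith
  -- A proper subset has at most three vectors and cannot span, so the condition is vacuous for a
  -- tetrahedron.
  · intro S hS hne hsp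
    have := four_le_card_of_span hsp
    exact absurd (Finset.eq_of_subset_of_card_le hS (by rw [hcard]; exact this)) hne

theorem IsOct.isRegular {V : Finset Mink} (hV : IsOct V) : IsRegular V := by
  obtain ⟨hs, f, rfl, hn, h2, h4, w, hw⟩ := hV
  have hl (i j s t) : lor (f (i, s)) (f (j, t)) = if i = j then (if s = t then 0 else 4) else 2 := by
    split_ifs with h h'
    · rw [h, h', (hn _).self]
    · rw [← h, show t = !s by cases s <;> cases t <;> simp_all, h4]
    · exact h2 i j s t h
  have hinj : Function.Injective f := by
    rintro ⟨i, s⟩ ⟨j, t⟩ h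
    have h' := hl i j s t
    rw [h, (hn _).self] at h'
    split_ifs at h' with h1 h2
    · rw [h1, h2]
    · norm_num at h'
    · norm_num at h'
  have hsum (F : Mink → Mink) : ∑ n ∈ Finset.univ.image f, F n = ∑ i, F (f i) :=
    Finset.sum_image fun a _ b _ h => hinj h
  have hmem {p : Mink → Prop} : (∀ n ∈ Finset.univ.image f, p n) ↔ ∀ i s, p (f (i, s)) := by
    refine ⟨fun h i s => h _ (Finset.mem_image_of_mem _ (Finset.mem_univ _)), fun h n hn => ?_⟩
    obtain ⟨⟨i, s⟩, -, rfl⟩ := Finset.mem_image.1 hn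
    exact h i s
  have hcen : ∑ p, f p = (3 : ℝ) • w := by
    rw [Fintype.sum_prod_type]
    simp only [Fintype.sum_bool]
    have e : ∀ i, f (i, true) + f (i, false) = w := fun i => hw i true
    simp only [e, Finset.sum_const]
    rw [← Nat.cast_smul_eq_nsmul ℝ]
    simp
  have hlw (i s) : lor (f (i, s)) w = 4 := by
    rw [← hw i s, lor_add_right, (hn _).self, h4]
    norm_num
  refine ⟨?_, ?_, ?_, ⟨12, by norm_num, ?_⟩, ?_, ?_, hs, ?_, ?_, ?_, ?_⟩
  · simp only [hmem]
    exact fun i s => hn _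
  · simp only [hmem]
    intro i s j t hne
    rw [hl]
    split_ifs with h1 h2
    · exact absurd (by rw [h1, h2]) hne
    · norm_num
    · norm_num
  · simp only [hmem]
    intro i s j t
    rw [hl]
    split_ifs <;> norm_num
  · simp only [hmem]
    intro i s
    rw [hsum, hcen, lor_smul_right, hlw]
    norm_num
  · simp only [hmem]
    intro i s j t hne h
    rw [hl] at h
    split_ifs at h with h1 h2
    · exact absurd (by rw [h1, h2]) hne
    · refine ⟨3, by norm_num, ?_⟩
      rw [hsum, hcen, ← h1, show t = !s by cases s <;> cases t <;> simp_all, hw]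
    · exact absurd rfl h
  · classical
    intro S hS cS _
    -- A clique has at most one vertex in each opposite pair. Choosing one vertex from every pair,
    -- the one in `S` whenever there is one, completes it to a face.
    let σ : Fin 3 → Bool := fun i => decide (f (i, true) ∈ S)
    have hσ : Function.Injective fun i => f (i, σ i) := fun i j h => congrArg Prod.fst (hinj h)
    refine ⟨Finset.univ.image fun i => f (i, σ i), ?_, ?_, ?_, ?_⟩
    · intro n hnS
      obtain ⟨⟨i, s⟩, -, rfl⟩ := Finset.mem_image.1 (hS hnS)
      refine Finset.mem_image.2 ⟨i, Finset.mem_univ _, ?_⟩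
      have : σ i = s := by
        cases s
        · simp only [σ, decide_eq_false_iff_not]
          intro ht
          have := cS _ ht _ hnS (fun h => by simpa using hinj h)
          rw [hl] at this
          norm_num at this
        · simpa [σ] using hnS
      rw [this]
    · intro n hn
      obtain ⟨i, -, rfl⟩ := Finset.mem_image.1 hn
      exact Finset.mem_image_of_mem _ (Finset.mem_univ _)
    · intro n hn m hm hne
      obtain ⟨i, -, rfl⟩ := Finset.mem_image.1 hn
      obtain ⟨j, -, rfl⟩ := Finset.mem_image.1 hm
      exact h2 _ _ _ _ fun h => hne (by rw [h])
    · rw [Finset.card_image_of_injective _ hσ]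
      rfl
  · simp only [hmem]
    intro i s j t hij k u
    have hij' : i ≠ j := fun h => by
      rw [hl, if_pos h] at hij
      split_ifs at hij <;> norm_num at hij
    rw [reflect_apply, lor_sub_right, hl, hl]
    rcases eq_or_ne k i with rfl | hki
    · rw [if_pos rfl, if_neg hij']
      split_ifs with h
      · subst h
        have : f (k, u) + ((0 - 2 : ℝ) / 2) • (f (k, u) - f (j, t)) = f (j, t) := by module
        rw [this]
        exact Finset.mem_image_of_mem _ (Finset.mem_univ _)
      -- The vertex opposite to one end of the edge goes to the vertex opposite to the other end, as
      -- both pairs have the sum `w`.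
      · have e1 := hw k u
        have e2 := hw j t
        rw [show (!u) = s by cases s <;> cases u <;> simp_all] at e1
        have : f (k, u) + ((4 - 2 : ℝ) / 2) • (f (k, s) - f (j, t)) = f (j, !t) := by
          rw [← e1] at e2
          rw [← sub_eq_zero] at e2 ⊢
          rw [← neg_eq_zero, ← e2]
          module
        rw [this]
        exact Finset.mem_image_of_mem _ (Finset.mem_univ _)
    rcases eq_or_ne k j with rfl | hkj
    · rw [if_pos rfl, if_neg hij'.symm]
      split_ifs with h
      · subst h
        have : f (k, u) + ((2 - 0 : ℝ) / 2) • (f (i, s) - f (k, u)) = f (i, s) := by module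
        rw [this]
        exact Finset.mem_image_of_mem _ (Finset.mem_univ _)
      · have e1 := hw k u
        have e2 := hw i s
        rw [show (!u) = t by cases t <;> cases u <;> simp_all] at e1
        have : f (k, u) + ((2 - 4 : ℝ) / 2) • (f (i, s) - f (k, t)) = f (i, !s) := by
          rw [← e1] at e2
          rw [← sub_eq_zero] at e2 ⊢
          rw [← neg_eq_zero, ← e2]
          module
        rw [this]
        exact Finset.mem_image_of_mem _ (Finset.mem_univ _)
    · rw [if_neg hki, if_neg hkj]
      simp
  · simp only [hmem]
    intro i s j t
    rcases eq_or_ne i j with rfl | h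
    · obtain ⟨l, hl⟩ : ∃ l, l ≠ i := exists_ne i
      exact Or.inr (Or.inr ⟨f (l, true), Finset.mem_image_of_mem _ (Finset.mem_univ _),
        h2 _ _ _ _ hl.symm, h2 _ _ _ _ hl⟩)
    · exact Or.inr (Or.inl (h2 i j s t h))
  · simp only [hmem]
    rintro i s j t hij k hk hik hjk ⟨c, hc, hkc⟩
    have hij' : i ≠ j := fun h => by
      rw [hl, if_pos h] at hij
      split_ifs at hij <;> norm_num at hij
    have hex : ∀ i j : Fin 3, i ≠ j → ∃ l, i ≠ l ∧ j ≠ l ∧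
      (Finset.univ : Finset (Fin 3)) = {i, j, l} := by decide
    obtain ⟨l, il, jl, hu⟩ := hex i j hij'
    have hi' := h4 i s
    have hj' := h4 j t
    have bsum (s : Bool) (F : Bool → Mink) : ∑ b, F b = F s + F (!s) := by
      cases s <;> simp [add_comm]
    have hk' : k = c (f (i, s)) • f (i, s) + c (f (i, !s)) • f (i, !s) +
        (c (f (j, t)) • f (j, t) + c (f (j, !t)) • f (j, !t) +
          (c (f (l, true)) • f (l, true) + c (f (l, !true)) • f (l, !true))) := by
      rw [hkc, hsum, Fintype.sum_prod_type, hu, Finset.sum_insert (by simp [hij', il]),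
        Finset.sum_pair jl, bsum s, bsum t, bsum true]
    have e1 (x : Fin 3 × Bool) : lor (f x) k =
        c (f (i, s)) * lor (f x) (f (i, s)) + c (f (i, !s)) * lor (f x) (f (i, !s)) +
        (c (f (j, t)) * lor (f x) (f (j, t)) + c (f (j, !t)) * lor (f x) (f (j, !t)) +
          (c (f (l, true)) * lor (f x) (f (l, true)) +
            c (f (l, !true)) * lor (f x) (f (l, !true)))) := by
      conv_lhs => rw [hk']
      simp only [lor_add_right, lor_smul_right]
    have e2 : c (f (i, s)) * lor (f (i, s)) k + c (f (i, !s)) * lor (f (i, !s)) k +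
        (c (f (j, t)) * lor (f (j, t)) k + c (f (j, !t)) * lor (f (j, !t)) k +
          (c (f (l, true)) * lor (f (l, true)) k +
            c (f (l, !true)) * lor (f (l, !true)) k)) = 0 := by
      rw [← hk.self]
      conv_rhs => arg 1; rw [hk']
      simp only [lor_add_left, lor_smul_left]
    have c1 := hc i (!s) (fun h => by simpa using hinj h)
      (fun h => hij' (congrArg Prod.fst (hinj h)))
    have c2 := hc j (!t) (fun h => hij'.symm (congrArg Prod.fst (hinj h)))
      (fun h => by simpa using hinj h)
    have c3 (u) := hc l u (fun h => il.symm (congrArg Prod.fst (hinj h)))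
      (fun h => jl.symm (congrArg Prod.fst (hinj h)))
    have c4 := c3 true
    have c5 := c3 (!true)
    have h4' (i s) : lor (f (i, !s)) (f (i, s)) = 4 := by rw [lor_comm, h4]
    have g1 := e1 (i, s)
    have g2 := e1 (i, !s)
    have g3 := e1 (j, t)
    have g4 := e1 (j, !t)
    have g5 := e1 (l, true)
    have g6 := e1 (l, !true)
    simp only [(hn _).self, h4, h4', h2 i j _ _ hij', h2 i l _ _ il, h2 j i _ _ hij'.symm,
      h2 j l _ _ jl, h2 l i _ _ il.symm, h2 l j _ _ jl.symm] at g1 g2 g3 g4 g5 g6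
    by_contra! hcon
    have q1 := hcon _ (Finset.mem_image_of_mem f (Finset.mem_univ (l, true)))
      (h2 _ _ _ _ il) (h2 _ _ _ _ jl)
    have q2 := hcon _ (Finset.mem_image_of_mem f (Finset.mem_univ (l, !true)))
      (h2 _ _ _ _ il) (h2 _ _ _ _ jl)
    rw [lor_comm] at q1 q2
    rw [g1, g2, g3, g4, g5, g6] at e2
    rw [hik] at g1
    rw [hjk] at g3
    rw [g5] at q1
    rw [g6] at q2
    clear g2 g4 g5 g6 e1 hk' hkc hc hcon hik hjk
    generalize c (f (i, s)) = A at *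
    generalize c (f (i, !s)) = A' at *
    generalize c (f (j, t)) = B at *
    generalize c (f (j, !t)) = B' at *
    generalize c (f (l, true)) = C at *
    generalize c (f (l, !true)) = C' at *
    have hA : A = 1 - C - C' - 2 * B' - A' := by linarith
    have hB : B = 1 - C - C' - 2 * A' - B' := by linarith
    subst hA hB
    -- Eliminating `A` and `B` by the tangency conditions turns nullity of `k` into this identity.
    -- Not overlapping the two vertices adjacent to both ends bounds each bracket by 1/2, so the sum
    -- of squares is at most 1/2.
    have k1 : (C + A' + B') ^ 2 + (C' + A' + B') ^ 2 = 1 := by nlinarith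
    have k2 : C + A' + B' ≤ 1 / 2 := by linarith
    have k3 : C' + A' + B' ≤ 1 / 2 := by linarith
    have k4 : 0 ≤ C + A' + B' := by linarith
    have k5 : 0 ≤ C' + A' + B' := by linarith
    nlinarith
  · intro S hS hne hsp
    have hcard := four_le_card_of_span hsp
    obtain ⟨d, hd, hdS⟩ := Finset.exists_of_ssubset (hS.ssubset_of_ne hne)
    obtain ⟨⟨i, s⟩, -, rfl⟩ := Finset.mem_image.1 hd
    have hsw : lor (f (i, !s)) (f (i, s)) = 4 := by rw [lor_comm, h4]
    -- The plane through the four vertices other than the missing `f (i, s)` and its opposite; the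
    -- latter is on the positive side.
    refine ⟨f (i, s) - f (i, !s), ?_, ?_, ?_⟩
    · rw [sub_ne_zero]
      exact fun h => by simpa using hinj h
    · intro n hnS
      obtain ⟨⟨j, t⟩, -, rfl⟩ := Finset.mem_image.1 (hS hnS)
      rcases eq_or_ne j i with rfl | hji
      · have : t = !s := by
          rcases eq_or_ne t s with rfl | h
          · exact absurd hnS hdS
          · cases s <;> cases t <;> simp_all
        rw [this, lor_sub_right, hsw, (hn _).self]
        norm_num
      · rw [lor_sub_right, h2 _ _ _ _ hji, h2 _ _ _ _ hji, sub_self]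
    · have hex : ∀ i : Fin 3, ∃ j l, j ≠ i ∧ l ≠ i ∧ j ≠ l ∧ ∀ x, x = i ∨ x = j ∨ x = l := by
        decide
      obtain ⟨j, l, hji, hli, hjl, hx⟩ := hex i
      have h0 (x t) (hxi : x ≠ i) : lor (f (x, t)) (f (i, s) - f (i, !s)) = 0 := by
        rw [lor_sub_right, h2 _ _ _ _ hxi, h2 _ _ _ _ hxi, sub_self]
      have key (x y : Fin 3) (u : Bool) (hxi : x ≠ i) (hyi : y ≠ i) (hxy : x ≠ y)
          (k1 : f (x, true) ∈ S) (k2 : f (x, false) ∈ S) (k3 : f (y, u) ∈ S) :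
          ∃ n ∈ S, ∃ m ∈ S, ∃ k ∈ S, n ≠ m ∧ k ≠ n ∧ k ≠ m ∧ lor n m ≠ 2 ∧
            lor n (f (i, s) - f (i, !s)) = 0 ∧ lor m (f (i, s) - f (i, !s)) = 0 ∧
            lor k (f (i, s) - f (i, !s)) = 0 := by
        refine ⟨_, k1, _, k2, _, k3, fun h => by simpa using hinj h,
          fun h => hxy (congrArg Prod.fst (hinj h)).symm,
          fun h => hxy (congrArg Prod.fst (hinj h)).symm, ?_, h0 _ _ hxi, h0 _ _ hxi, h0 _ _ hyi⟩
        rw [hl]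
        norm_num
      -- A spanning `S` has at least four elements, at most one of them off the equatorial plane.
      -- The other three or more include an opposite pair and a further vertex.
      have hsub : S ⊆ {f (i, !s)} ∪ ((S ∩ {f (j, true), f (j, false)}) ∪
          (S ∩ {f (l, true), f (l, false)})) := by
        intro n hnS
        obtain ⟨⟨x, t⟩, -, rfl⟩ := Finset.mem_image.1 (hS hnS)
        simp only [Finset.mem_union, Finset.mem_inter, Finset.mem_insert, Finset.mem_singleton]
        rcases hx x with rfl | rfl | rfl
        · have : t = !s := by
            rcases eq_or_ne t s with rfl | h
            · exact absurd hnS hdS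
            · cases s <;> cases t <;> simp_all
          exact Or.inl (by rw [this])
        · cases t <;> simp [hnS]
        · cases t <;> simp [hnS]
      have hle := (Finset.card_le_card hsub).trans ((Finset.card_union_le _ _).trans
        (Nat.add_le_add_left (Finset.card_union_le _ _) _))
      rw [Finset.card_singleton] at hle
      have hc1 (a : Mink) : (S ∩ {a}).card = if a ∈ S then 1 else 0 := by
        split_ifs with h
        · rw [Finset.inter_singleton_of_mem h, Finset.card_singleton]
        · rw [Finset.inter_singleton_of_notMem h, Finset.card_empty]
      have hc2 (a b : Mink) : (S ∩ {a, b}).card ≤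
          (if a ∈ S then 1 else 0) + if b ∈ S then 1 else 0 := by
        rw [← hc1, ← hc1, Finset.insert_eq, Finset.inter_union_distrib_left]
        exact Finset.card_union_le _ _
      have cj := hc2 (f (j, true)) (f (j, false))
      have cl := hc2 (f (l, true)) (f (l, false))
      by_cases a1 : f (j, true) ∈ S <;> by_cases a2 : f (j, false) ∈ S <;>
        by_cases b1 : f (l, true) ∈ S <;> by_cases b2 : f (l, false) ∈ S
      all_goals first
        | exact key j l true hji hli hjl a1 a2 b1
        | exact key j l false hji hli hjl a1 a2 b2
        | exact key l j true hli hji hjl.symm b1 b2 a1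
        | exact key l j false hli hji hjl.symm b1 b2 a2
        | (exfalso
           simp only [a1, a2, b1, b2, if_true, if_false] at cj cl
           omega)

theorem idealHull_range {ι : Type*} [Fintype ι] (p : ι → IdealPoint) (r : ι → ℝ)
    (hr : ∀ i, 0 < r i) :
    idealHull (Set.range p) = cell (Finset.univ.image fun i => r i • nv (p i)) := by
  classical
  rw [idealHull_eq_cell (Finset.univ.image p) (by simp)]
  apply Set.Subset.antisymm <;> apply cell_subset
  · intro k hk
    obtain ⟨q, hq, rfl⟩ := Finset.mem_image.1 hk
    obtain ⟨i, -, rfl⟩ := Finset.mem_image.1 hq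
    rw [← inv_smul_smul₀ (hr i).ne' (nv (p i))]
    exact smul_mem_cone (mem_cone_of_mem (Finset.mem_image.2 ⟨i, Finset.mem_univ _, rfl⟩))
      (inv_nonneg.2 (hr i).le)
  · simp only [Finset.mem_image, Finset.mem_univ, true_and, forall_exists_index]
    rintro _ i rfl
    exact smul_mem_cone (mem_cone_of_mem (by simp)) (hr i).le

/-- The ideal vertices of the standard tetrahedron. -/
def tetPt : Fin 4 → IdealPoint :=
  ![((0 : ℂ) : IdealPoint), ((1 : ℂ) : IdealPoint), OnePoint.infty,
    (((1 + Complex.I * (√3 : ℝ)) / 2 : ℂ) : IdealPoint)]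

/-- The ideal vertices of the standard octahedron, in pairs of opposite ones. -/
def octPt (p : Fin 3 × Bool) : IdealPoint :=
  if p.2 then ![((0 : ℂ) : IdealPoint), ((1 : ℂ) : IdealPoint), OnePoint.infty] p.1 else
  ![((1 + Complex.I : ℂ) : IdealPoint), ((Complex.I : ℂ) : IdealPoint),
    (((1 + Complex.I) / 2 : ℂ) : IdealPoint)] p.1

theorem nv_infty : nv OnePoint.infty = (1, 0, 0) := rfl

theorem nv_coe (a : ℂ) : nv (a : IdealPoint) = (a.re ^ 2 + a.im ^ 2, 1, a) := by
  change ((‖a‖ ^ 2, 1, a) : Mink) = _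
  rw [← Complex.normSq_eq_norm_sq, Complex.normSq_apply, sq, sq]

theorem stdTetrahedron_eq : ∃ V, IsTet V ∧ stdTetrahedron = cell V ∧
    (2 : ℝ) • nv OnePoint.infty ∈ V := by
  refine ⟨Finset.univ.image fun i => (2 : ℝ) • nv (tetPt i), ⟨?_, _, rfl, ?_, ?_⟩, ?_, ?_⟩
  · by_contra h
    obtain ⟨⟨a, b, ⟨c, d⟩⟩, he, h0⟩ := exists_orthogonal_of_span_ne_top h
    have h (i) : lor ((2 : ℝ) • nv (tetPt i)) (a, b, ⟨c, d⟩) = 0 := h0 _ (by simp)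
    have h1 := h 0
    have h2 := h 1
    have h3 := h 2
    have h4 := h 3
    simp [tetPt, nv_coe, nv_infty, lor] at h1 h2 h3 h4
    subst h1 h3
    have hc : c = 0 := by linarith
    subst hc
    have hd : d = 0 := by simpa using h4
    subst hd
    exact he rfl
  · exact fun i => (isNull_nv _).smul two_pos
  · have h3 : (√3 : ℝ) ^ 2 = 3 := Real.sq_sqrt (by norm_num)
    intro i j hij
    rw [lor_smul_left, lor_smul_right]
    fin_cases i <;> fin_cases j <;> first | exact absurd rfl hij | skip
    all_goals simp [tetPt, nv_coe, nv_infty, lor]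
    all_goals try norm_num
    all_goals linarith
  · rw [← idealHull_range _ (fun _ => (2 : ℝ)) (fun _ => two_pos), stdTetrahedron]
    congr 1
    ext p
    constructor
    · rintro (rfl | rfl | rfl | rfl)
      exacts [⟨0, rfl⟩, ⟨1, rfl⟩, ⟨2, rfl⟩, ⟨3, rfl⟩]
    · rintro ⟨i, rfl⟩
      fin_cases i <;> simp [tetPt]
  · exact Finset.mem_image.2 ⟨2, Finset.mem_univ _, rfl⟩

theorem stdOctahedron_eq : ∃ V, IsOct V ∧ stdOctahedron = cell V ∧
    (2 : ℝ) • nv OnePoint.infty ∈ V := by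
  -- Weight 2 is height 1 at `∞` and Euclidean diameter 1 at the four corners of the square. At the
  -- center `(1 + i) / 2` of the square, tangency with the corner horoballs requires diameter 1/2,
  -- that is, weight 4.
  let r : Fin 3 × Bool → ℝ := fun p => if p = (2, false) then 4 else 2
  have hr (p) : 0 < r p := by simp only [r]; split_ifs <;> norm_num
  refine ⟨Finset.univ.image fun i => r i • nv (octPt i),
    ⟨?_, _, rfl, ?_, ?_, ?_, ((4, 4, 2 + 2 * Complex.I) : Mink), ?_⟩, ?_, ?_⟩
  · by_contra h
    obtain ⟨⟨a, b, ⟨c, d⟩⟩, he, h0⟩ := exists_orthogonal_of_span_ne_top h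
    have h (i) : lor (r i • nv (octPt i)) (a, b, ⟨c, d⟩) = 0 :=
      h0 _ (Finset.mem_image.2 ⟨i, Finset.mem_univ _, rfl⟩)
    have h1 := h (0, true)
    have h2 := h (1, true)
    have h3 := h (2, true)
    have h4 := h (1, false)
    simp [octPt, nv_coe, nv_infty, lor, r] at h1 h2 h3 h4
    subst h1 h3
    have hc : c = 0 := by linarith
    have hd : d = 0 := by linarith
    subst hc hd
    exact he rfl
  · exact fun i => (isNull_nv _).smul (hr _)
  · intro i j s t hij
    rw [lor_smul_left, lor_smul_right]
    fin_cases i <;> fin_cases j <;> first | exact absurd rfl hij | skip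
    all_goals cases s <;> cases t <;> simp [octPt, nv_coe, nv_infty, lor, r] <;> norm_num
  · intro i s
    rw [lor_smul_left, lor_smul_right]
    fin_cases i <;> cases s <;> simp [octPt, nv_coe, nv_infty, lor, r] <;> norm_num
  · intro i s
    refine Prod.ext ?_ (Prod.ext ?_ (Complex.ext ?_ ?_)) <;> fin_cases i <;> cases s <;>
      simp [octPt, nv_coe, nv_infty, r] <;> norm_num
  · rw [← idealHull_range _ r hr, stdOctahedron]
    congr 1
    ext p
    constructor
    · rintro (rfl | rfl | rfl | rfl | rfl | rfl)
      exacts [⟨(0, true), rfl⟩, ⟨(1, true), rfl⟩, ⟨(2, true), rfl⟩, ⟨(0, false), rfl⟩,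
        ⟨(1, false), rfl⟩, ⟨(2, false), rfl⟩]
    · rintro ⟨⟨i, s⟩, rfl⟩
      fin_cases i <;> cases s <;> simp [octPt]
  · exact Finset.mem_image.2 ⟨(2, true), Finset.mem_univ _, rfl⟩

/-! ### Tilings by regular ideal tetrahedra and octahedra -/

theorem exists_isRegular {P : Set H3}
    (h : IsRegularIdealTetrahedron P ∨ IsRegularIdealOctahedron P) :
    ∃ V, IsRegular V ∧ P = cell V := by
  rcases h with ⟨g, rfl⟩ | ⟨g, rfl⟩
  · obtain ⟨L, hL⟩ := exists_induces g
    obtain ⟨V, hV, e, -⟩ := stdTetrahedron_eq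
    exact ⟨V.image L, (hV.image hL).isRegular, by rw [e, hL.image_cell]⟩
  · obtain ⟨L, hL⟩ := exists_induces g
    obtain ⟨V, hV, e, -⟩ := stdOctahedron_eq
    exact ⟨V.image L, (hV.image hL).isRegular, by rw [e, hL.image_cell]⟩

open Classical in
/-- The null vectors of the horoballs of the symmetric packing of a tile. -/
def verts (P : Set H3) : Finset Mink :=
  if h : ∃ V, IsRegular V ∧ P = cell V then h.choose else ∅

theorem IsRegular.verts_cell {V : Finset Mink} (hV : IsRegular V) : verts (cell V) = V := by
  have h : ∃ W, IsRegular W ∧ cell V = cell W := ⟨V, hV, rfl⟩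
  rw [verts, dif_pos h]
  exact (hV.eq_of_cell_eq h.choose_spec.1 h.choose_spec.2).symm

/-- A tiling by tiles that are cells of regular configurations. -/
structure IsRegularTiling (𝒯 : Set (Set H3)) : Prop where
  tiling : IsIdealTiling 𝒯
  regular : ∀ P ∈ 𝒯, IsRegular (verts P)
  cell_verts : ∀ P ∈ 𝒯, cell (verts P) = P

theorem IsIdealTiling.isRegularTiling {𝒯 : Set (Set H3)} (h : IsIdealTiling 𝒯)
    (hr : ∀ P ∈ 𝒯, IsRegularIdealTetrahedron P ∨ IsRegularIdealOctahedron P) :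
    IsRegularTiling 𝒯 := by
  refine ⟨h, fun P hP => ?_, fun P hP => ?_⟩ <;>
    obtain ⟨V, hV, rfl⟩ := exists_isRegular (hr P hP) <;> rw [hV.verts_cell]
  exact hV

namespace IsIdealTiling

variable {𝒯 : Set (Set H3)}

theorem subset_closure_interior (h : IsIdealTiling 𝒯) {P : Set H3} (hP : P ∈ 𝒯) :
    P ⊆ closure (interior P) := by
  obtain ⟨V, rfl, -, hs⟩ := (h.polyhedron P hP).exists_eq_cell
  exact cell_subset_closure_interior hs

/-- A tile lies in the closure of its interior, so interior points of `Q` would come arbitrarily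
close to `x` and enter the interior of `P`. -/
theorem eq_of_mem_interior (h : IsIdealTiling 𝒯) {P Q : Set H3} (hP : P ∈ 𝒯) (hQ : Q ∈ 𝒯) {x : H3}
    (hx : x ∈ interior P) (hxQ : x ∈ Q) : P = Q := by
  by_contra hne
  obtain ⟨y, hy, hy'⟩ := mem_closure_iff.1 (h.subset_closure_interior hQ hxQ) _ isOpen_interior hx
  exact Set.disjoint_left.1 (h.disjoint_interiors P hP Q hQ hne) hy hy'

theorem exists_mem (h : IsIdealTiling 𝒯) (x : H3) : ∃ P ∈ 𝒯, x ∈ P :=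
  Set.mem_sUnion.1 (h.cover ▸ Set.mem_univ x)

theorem exists_interior_inter (h : IsIdealTiling 𝒯) {O : Set H3} (hO : IsOpen O)
    (hne : O.Nonempty) : ∃ P ∈ 𝒯, ∃ x ∈ O, x ∈ interior P := by
  obtain ⟨y, hy⟩ := hne
  obtain ⟨P, hP, hyP⟩ := h.exists_mem y
  obtain ⟨x, hx, hx'⟩ := mem_closure_iff.1 (h.subset_closure_interior hP hyP) _ hO hy
  exact ⟨P, hP, x, hx, hx'⟩

theorem nonempty_interior (h : IsIdealTiling 𝒯) {P : Set H3} (hP : P ∈ 𝒯) :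
    (interior P).Nonempty := by
  rw [Set.nonempty_iff_ne_empty]
  intro he
  have h1 := h.subset_closure_interior hP
  rw [he, closure_empty, Set.subset_empty_iff] at h1
  refine (h.polyhedron P hP).2 ⟨⟨0, 1, one_pos⟩, ⟨0, 2, two_pos⟩, fun h => ?_, ?_⟩
  · have := congrArg H3.t h
    norm_num at this
  · rw [h1]
    exact Set.empty_subset _

theorem finite_of_isCompact (h : IsIdealTiling 𝒯) {K : Set H3} (hK : IsCompact K) :
    {P ∈ 𝒯 | (P ∩ K).Nonempty}.Finite := by
  choose U hU hfin using h.locallyFinite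
  obtain ⟨t, -, ht⟩ := hK.elim_nhds_subcover U fun x _ => hU x
  refine (t.finite_toSet.biUnion fun x _ => hfin x).subset ?_
  rintro P ⟨hP, x, hxP, hxK⟩
  obtain ⟨y, hy, hxy⟩ := Set.mem_iUnion₂.1 (ht hxK)
  exact Set.mem_biUnion hy ⟨hP, x, hxP, hxy⟩

end IsIdealTiling

/-- Fewer than four vectors span a proper subspace, which is closed with empty interior; Baire
applies. This supplies generic endpoints for paths that must miss every edge. -/
theorem exists_notMem_of_finite {S : Set (Finset Mink)} (hS : S.Finite)
    (h3 : ∀ s ∈ S, s.card < 4) {O : Set Mink} (hO : IsOpen O) (hne : O.Nonempty) :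
    ∃ u ∈ O, ∀ s ∈ S, u ∉ Submodule.span ℝ (s : Set Mink) := by
  have hd : Dense (⋂ s ∈ S, ((Submodule.span ℝ (s : Set Mink) : Set Mink))ᶜ) := by
    refine dense_biInter_of_isOpen (fun s _ => ?_) hS.countable fun s hs => ?_
    · exact (Submodule.closed_of_finiteDimensional _).isOpen_compl
    · rw [← interior_eq_empty_iff_dense_compl, ← Set.not_nonempty_iff_eq_empty]
      intro hi
      have := four_le_card_of_span (Submodule.eq_top_of_nonempty_interior' _ hi)
      exact absurd (h3 s hs) (by omega)
  obtain ⟨u, hu, hu'⟩ := hd.inter_open_nonempty O hO hne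
  refine ⟨u, hu, fun s hs => ?_⟩
  simp only [Set.mem_iInter] at hu'
  exact hu' s hs

theorem IsRegular.exists_mem_interior {V : Finset Mink} (hV : IsRegular V) {n : Mink}
    (hn : n ∈ V) {r : ℝ} (hr : 0 < r) : ∃ x ∈ interior (cell V), lor n (vec x) < r := by
  obtain ⟨τ, hτ, hb⟩ := hV.balanced
  have hN := hV.null n hn
  have hc : IsCausal (∑ m ∈ V, m) := by
    refine Finset.sum_induction _ IsCausal (fun _ _ => IsCausal.add) isCausal_zero
      fun m hm => (hV.null m hm).causal
  -- With this weight on the central vector, the product with `n` is `r²` while the squared length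
  -- is at least `2 r²`, so the normalized height is below `r`.
  have hε : 0 < r ^ 2 / τ := by positivity
  have hT : IsTime (n + (r ^ 2 / τ) • ∑ m ∈ V, m) := by
    apply isTime_add_of_lor_pos hN.causal (hc.smul hε.le)
    rw [lor_smul_right, hb n hn]
    positivity
  obtain ⟨q, hq, hq2, e⟩ := vec_nrm' hT
  refine ⟨nrm (n + (r ^ 2 / τ) • ∑ m ∈ V, m), ?_, ?_⟩
  · refine hV.mem_interior_of_add (u := q⁻¹ • n) (δ := q⁻¹ * (r ^ 2 / τ))
      (smul_mem_cone (mem_cone_of_mem hn) (by positivity)) (by positivity) ?_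
    rw [mul_smul, ← smul_add, e, inv_smul_smul₀ hq.ne', ← e]
  · have h1 : q * lor n (vec (nrm (n + (r ^ 2 / τ) • ∑ m ∈ V, m))) = r ^ 2 := by
      rw [← lor_smul_right, ← e, lor_add_right, hN.self, lor_smul_right, hb n hn]
      field_simp
      ring
    have h2 : 2 * r ^ 2 ≤ q ^ 2 := by
      rw [hq2]
      simp only [lor_add_left, lor_add_right, lor_smul_left, lor_smul_right, hN.self,
        lor_comm _ n, hb n hn]
      have := hc.2.2
      have e : r ^ 2 / τ * τ = r ^ 2 := by field_simp
      have : 0 ≤ r ^ 2 / τ * (r ^ 2 / τ * lor (∑ m ∈ V, m) (∑ m ∈ V, m)) := by positivity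
      linarith
    have h3 : r < q := by nlinarith
    by_contra! hle
    nlinarith

/-! ### Horoballs carried from tile to tile -/

namespace IsRegularTiling

variable {𝒯 : Set (Set H3)}

theorem isClosed (h : IsRegularTiling 𝒯) {P : Set H3} (hP : P ∈ 𝒯) : IsClosed P := by
  rw [← h.cell_verts P hP]
  exact isClosed_cell (h.regular P hP).null

theorem exists_nhds (h : IsRegularTiling 𝒯) (x : H3) :
    ∃ U, IsOpen U ∧ x ∈ U ∧ ∀ P ∈ 𝒯, (P ∩ U).Nonempty → x ∈ P := by
  obtain ⟨U, hU, hfin⟩ := h.tiling.locallyFinite x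
  have hfin' : ({P ∈ 𝒯 | (P ∩ U).Nonempty} ∩ {P | x ∉ P}).Finite := hfin.inter_of_left _
  refine ⟨interior U ∩ ⋂ P ∈ {P ∈ 𝒯 | (P ∩ U).Nonempty} ∩ {P | x ∉ P}, Pᶜ,
    isOpen_interior.inter (hfin'.isOpen_biInter fun P hP => (h.isClosed hP.1.1).isOpen_compl),
    ⟨mem_interior_iff_mem_nhds.2 hU, Set.mem_iInter₂.2 fun P hP => hP.2⟩, ?_⟩
  rintro P hP ⟨y, hyP, hyU, hy⟩
  by_contra hx
  exact Set.mem_iInter₂.1 hy P ⟨⟨hP, y, hyP, interior_subset hyU⟩, hx⟩ hyP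

theorem inter_eq_cell (h : IsRegularTiling 𝒯) {P Q : Set H3} (hP : P ∈ 𝒯) (hQ : Q ∈ 𝒯)
    (hne : P ≠ Q) (hPQ : (P ∩ Q).Nonempty) : ∃ S ⊆ verts P, IsClique S ∧ 1 < S.card ∧
      S.card ≤ 3 ∧ P ∩ Q = cell S := by
  have hF := (h.tiling.face_to_face P hP Q hQ hne hPQ).1
  have hV := h.regular P hP
  have hF' : IsFace (P ∩ Q) (cell (verts P)) := by rwa [h.cell_verts P hP]
  rcases hV.face_cases hF' with e | ⟨S, hS, hSV, cS, h1, e⟩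
  · rw [h.cell_verts P hP] at e
    obtain ⟨x, hx⟩ := h.tiling.nonempty_interior hP
    have : x ∈ P ∩ Q := by rw [e]; exact interior_subset hx
    exact absurd (h.tiling.eq_of_mem_interior hP hQ hx this.2) hne
  · obtain ⟨T, hST, -, -, h3⟩ := hV.extend S hS cS hSV
    exact ⟨S, hS, cS, h1, h3 ▸ Finset.card_le_card hST, e⟩

/-- The horoballs of the tiles propagate along generic paths. -/
theorem mem_verts_of_path (h : IsRegularTiling 𝒯) {P Q : Set H3} (hP : P ∈ 𝒯) (hQ : Q ∈ 𝒯)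
    {n : Mink} (hn : n ∈ verts P) {x y : H3} (hx : x ∈ interior P) (hxn : x ∈ hb n)
    (hy : y ∈ interior Q) (hyn : y ∈ interior (hb n)) : n ∈ verts Q := by
  obtain ⟨δ, hδ, hball⟩ : ∃ δ > 0, Metric.closedBall (vec y) δ ⊆
      {u | IsTime u} ∩ nrm ⁻¹' (interior Q ∩ interior (hb n)) := by
    have hopen := continuousOn_nrm.isOpen_inter_preimage isOpen_isTime
      ((isOpen_interior (s := Q)).inter (isOpen_interior (s := hb n)))
    exact Metric.nhds_basis_closedBall.mem_iff.1
      (hopen.mem_nhds ⟨isTime_vec y, by rw [Set.mem_preimage, nrm_vec]; exact ⟨hy, hyn⟩⟩)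
  have hTime (s : unitInterval) {u : Mink} (hu : IsTime u) :
      IsTime ((1 - (s : ℝ)) • vec x + (s : ℝ) • u) := by
    rcases s.2.2.eq_or_lt with h1 | h1
    · rw [h1]
      simpa using hu
    · exact ((isTime_vec x).smul (by linarith)).add (hu.causal.smul s.2.1)
  let Φ : unitInterval × Mink → Mink := fun p => (1 - (p.1 : ℝ)) • vec x + (p.1 : ℝ) • p.2
  have hΦ : Continuous Φ := by fun_prop
  -- The union of all segments from `x` to a small ball about `y` is compact, so only finitely many
  -- tiles matter before the endpoint is chosen.
  have hK : IsCompact ((fun p => nrm (Φ p)) '' (Set.univ ×ˢ Metric.closedBall (vec y) δ)) := by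
    refine (isCompact_univ.prod (isCompact_closedBall _ _)).image_of_continuousOn ?_
    exact continuousOn_nrm.comp hΦ.continuousOn fun p hp => hTime p.1 (hball hp.2).1
  have hfin := h.tiling.finite_of_isCompact hK
  set 𝒦 := {R ∈ 𝒯 | (R ∩ (fun p => nrm (Φ p)) ''
    (Set.univ ×ˢ Metric.closedBall (vec y) δ)).Nonempty} with h𝒦
  -- The segment from `x` to `u` can meet the edge spanned by `a`, `b` beyond its start only if `u`
  -- is in the span of `vec x`, `a`, `b`. The endpoint is chosen outside all these spans.
  let 𝒮 : Set (Finset Mink) := ⋃ R ∈ 𝒦, (fun p : Mink × Mink => ({vec x, p.1, p.2} : Finset Mink)) ''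
    (verts R ×ˢ verts R : Finset (Mink × Mink))
  have h𝒮 : 𝒮.Finite := hfin.biUnion fun R _ => (Finset.finite_toSet _).image _
  obtain ⟨u, hu, hu𝒮⟩ := exists_notMem_of_finite h𝒮 (by
    intro s hs
    obtain ⟨R, -, p, -, rfl⟩ := Set.mem_iUnion₂.1 hs
    exact Nat.lt_succ_of_le Finset.card_le_three) Metric.isOpen_ball ⟨vec y, Metric.mem_ball_self hδ⟩
  have huB := Metric.ball_subset_closedBall hu
  obtain ⟨huT, huQ, hun⟩ := hball huB
  let σ : unitInterval → H3 := fun s => nrm (Φ (s, u))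
  have hσ : Continuous σ := by
    rw [← continuousOn_univ]
    exact continuousOn_nrm.comp (hΦ.comp (by fun_prop : Continuous fun s : unitInterval =>
      (s, u))).continuousOn fun s _ => hTime s huT
  have hσK (s) {R : Set H3} (hR : R ∈ 𝒯) (hs : σ s ∈ R) : R ∈ 𝒦 :=
    ⟨hR, σ s, hs, (s, u), ⟨trivial, huB⟩, rfl⟩
  have hσ0 : σ 0 = x := by simp [σ, Φ, nrm_vec]
  have hσ1 : σ 1 = nrm u := by simp [σ, Φ]
  have hσn (s) : σ s ∈ hb n := by
    obtain ⟨r, hr, -, e⟩ := vec_nrm' (hTime s huT)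
    obtain ⟨q, hq, -, e'⟩ := vec_nrm' huT
    refine (isConvex_hb n).mem_of_smul hxn (interior_subset hun) hr
      (sub_nonneg.2 s.2.2) (mul_nonneg s.2.1 hq.le) (e.symm.trans ?_)
    rw [mul_smul, ← e']
  have hedge (s : unitInterval) (hs : s ≠ 0) {R : Set H3} (hR : R ∈ 𝒯) {S : Finset Mink}
      (hS : S ⊆ verts R) (hSR : cell S ⊆ R) (hsS : σ s ∈ cell S) (h2 : S.card = 2) : False := by
    obtain ⟨a, b, hab, rfl⟩ := Finset.card_eq_two.1 h2
    obtain ⟨α, β, -, -, e⟩ := (mem_cone_pair hab).1 hsS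
    obtain ⟨r, hr, -, e'⟩ := vec_nrm' (hTime s huT)
    have hs0 : (s : ℝ) ≠ 0 := fun h => hs (Subtype.ext h)
    refine hu𝒮 {vec x, a, b} (Set.mem_iUnion₂.2 ⟨R, hσK s hR (hSR hsS), (a, b), ?_, rfl⟩) ?_
    · exact Finset.mem_coe.2 (Finset.mem_product.2 ⟨hS (by simp), hS (by simp)⟩)
    · have hm (v) (hv : v ∈ ({vec x, a, b} : Finset Mink)) :
          v ∈ Submodule.span ℝ (({vec x, a, b} : Finset Mink) : Set Mink) :=
        Submodule.subset_span hv
      change vec (nrm ((1 - (s : ℝ)) • vec x + (s : ℝ) • u)) = _ at e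
      rw [e] at e'
      have : u = (s : ℝ)⁻¹ • (r • (α • a + β • b) - (1 - (s : ℝ)) • vec x) := by
        rw [← e', add_sub_cancel_left, inv_smul_smul₀ hs0]
      rw [this]
      exact Submodule.smul_mem _ _ (Submodule.sub_mem _ (Submodule.smul_mem _ _
        (Submodule.add_mem _ (Submodule.smul_mem _ _ (hm _ (by simp)))
          (Submodule.smul_mem _ _ (hm _ (by simp))))) (Submodule.smul_mem _ _ (hm _ (by simp))))
  -- Two distinct tiles meeting at a point of the path share a triangle there, not an edge. The
  -- triangle carries the same null vectors in both tiles, and `n` is one of them since the path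
  -- stays in `hb n`. At time 0 the path is inside `P`, where no two tiles meet.
  have hcons (s) {R R' : Set H3} (hR : R ∈ 𝒯) (hR' : R' ∈ 𝒯) (hs : σ s ∈ R) (hs' : σ s ∈ R')
      (hnR : n ∈ verts R) : n ∈ verts R' := by
    rcases eq_or_ne R R' with rfl | hne
    · exact hnR
    rcases eq_or_ne s 0 with rfl | hs0
    · rw [hσ0] at hs hs'
      exact absurd ((h.tiling.eq_of_mem_interior hP hR hx hs).symm.trans
        (h.tiling.eq_of_mem_interior hP hR' hx hs')) hne
    obtain ⟨S, hS, cS, h1, h3, e⟩ := h.inter_eq_cell hR hR' hne ⟨_, hs, hs'⟩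
    obtain ⟨S', hS', cS', h1', h3', e'⟩ := h.inter_eq_cell hR' hR hne.symm ⟨_, hs', hs⟩
    have hsS : σ s ∈ cell S := e ▸ ⟨hs, hs'⟩
    have hsS' : σ s ∈ cell S' := e' ▸ ⟨hs', hs⟩
    have hcard : S.card ≠ 2 := fun h2 =>
      hedge s hs0 hR hS (e ▸ Set.inter_subset_left) hsS h2
    have hVR := h.regular R hR
    have hVR' := h.regular R' hR'
    have hSS' : S = S' := cS.eq_of_cell_eq (hVR.raySet.mono hS) (hVR'.raySet.mono hS') cS'
      (by omega) (by rw [← e, ← e', Set.inter_comm])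
    rw [hSS'] at hS hsS cS
    exact hS' (hSS' ▸ hVR.mem_of_hb_inter hS cS hnR hsS (hσn s))
  have hclosed (𝒜 : Set (Set H3)) (h𝒜 : 𝒜 ⊆ 𝒦) : IsClosed (⋃ R ∈ 𝒜, σ ⁻¹' R) :=
    (hfin.subset h𝒜).isClosed_biUnion fun R hR => (h.isClosed (h𝒜 hR).1).preimage hσ
  have hcompl : (⋃ R ∈ {R ∈ 𝒦 | n ∈ verts R}, σ ⁻¹' R)ᶜ =
      ⋃ R ∈ {R ∈ 𝒦 | n ∉ verts R}, σ ⁻¹' R := by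
    ext s
    simp only [Set.mem_compl_iff, Set.mem_iUnion, not_exists]
    constructor
    · intro hs
      obtain ⟨R, hR, hsR⟩ := h.tiling.exists_mem (σ s)
      exact ⟨R, ⟨hσK s hR hsR, fun hnR => hs R ⟨hσK s hR hsR, hnR⟩ hsR⟩, hsR⟩
    · rintro ⟨R', hR', hs'⟩ R hR hs
      exact hR'.2 (hcons s hR.1.1 hR'.1.1 hs hs' hR.2)
  -- The times spent in tiles with `n` and those spent in tiles without it are complementary finite
  -- unions of closed sets; connectedness of the interval leaves only one kind.
  have hclopen : IsClopen (⋃ R ∈ {R ∈ 𝒦 | n ∈ verts R}, σ ⁻¹' R) :=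
    ⟨hclosed _ fun R hR => hR.1, by
      rw [← isClosed_compl_iff, hcompl]
      exact hclosed _ fun R hR => hR.1⟩
  rcases isClopen_iff.1 hclopen with h0 | h1
  · have : (0 : unitInterval) ∈ (⋃ R ∈ {R ∈ 𝒦 | n ∈ verts R}, σ ⁻¹' R) := by
      have hs : σ 0 ∈ P := by rw [hσ0]; exact interior_subset hx
      exact Set.mem_iUnion₂.2 ⟨P, ⟨hσK 0 hP hs, hn⟩, hs⟩
    rw [h0] at this
    exact this.elim
  · have : (1 : unitInterval) ∈ (⋃ R ∈ {R ∈ 𝒦 | n ∈ verts R}, σ ⁻¹' R) := by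
      rw [h1]; trivial
    obtain ⟨R, hR, hs⟩ := Set.mem_iUnion₂.1 this
    rw [Set.mem_preimage, hσ1] at hs
    rw [h.tiling.eq_of_mem_interior hQ hR.1.1 huQ hs]
    exact hR.2

/-- The horoballs of all tiles with a given ideal vertex agree. -/
theorem eq_of_parallel (h : IsRegularTiling 𝒯) {P Q : Set H3} (hP : P ∈ 𝒯) (hQ : Q ∈ 𝒯)
    {n m : Mink} (hn : n ∈ verts P) (hm : m ∈ verts Q) {r : ℝ} (hr : 0 < r) (e : m = r • n) :
    m = n := by
  obtain ⟨x, hx, hxn⟩ := (h.regular P hP).exists_mem_interior hn one_pos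
  -- Height below `r` over `m = r • n` is height below 1 over `n`, so the path can end in the
  -- interior of `hb n`.
  obtain ⟨y, hy, hyn⟩ := (h.regular Q hQ).exists_mem_interior hm hr
  rw [h.cell_verts P hP] at hx
  rw [h.cell_verts Q hQ] at hy
  have hN := (h.regular P hP).null n hn
  have := h.mem_verts_of_path hP hQ hn hx hxn.le hy (by
    rw [hN.interior_hb]
    rw [e, lor_smul_left] at hyn
    change lor n (vec y) < 1
    nlinarith)
  exact (h.regular Q hQ).eq_of_parallel hm this e

/-- The horoballs of the tiles only meet the tiles at their centers. -/
theorem mem_verts_of_mem_hb (h : IsRegularTiling 𝒯) {P Q : Set H3} (hP : P ∈ 𝒯) (hQ : Q ∈ 𝒯)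
    {n : Mink} (hn : n ∈ verts P) {w : H3} (hwQ : w ∈ Q) (hwn : w ∈ hb n) : n ∈ verts Q := by
  have hN := (h.regular P hP).null n hn
  obtain ⟨U, hU, hwU, hUw⟩ := h.exists_nhds w
  -- Adding a small multiple of `n` preserves the product with `n` and lengthens the vector, so
  -- normalization moves `w` into the open horoball. A tile `R` with interior points there contains
  -- `w` and is reachable by a path.
  have hne : (U ∩ interior (hb n)).Nonempty := by
    obtain ⟨ε, hε, -, y, hy, r, hr, hr2, e⟩ := exists_perturb (hU.mem_nhds hwU) n one_pos
    refine ⟨y, hy, ?_⟩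
    rw [hN.interior_hb]
    change lor n (vec y) < 1
    have h1 := congrArg (lor n) e
    rw [lor_add_right, lor_smul_right, lor_smul_right, hN.self, mul_zero, add_zero] at h1
    have h2 : lor n (vec w) ≤ 1 := hwn
    have h0 := hN.lor_vec_pos w
    have h3 : 1 < r ^ 2 := by
      rw [hr2]
      simp only [lor_add_left, lor_add_right, lor_smul_left, lor_smul_right, hN.self,
        lor_vec_self, lor_comm _ n]
      nlinarith
    have h4 : 1 < r := by nlinarith
    by_contra! hle
    nlinarith
  obtain ⟨R, hR, y, hyO, hyR⟩ :=
    h.tiling.exists_interior_inter (hU.inter isOpen_interior) hne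
  have hwR := hUw R hR ⟨y, interior_subset hyR, hyO.1⟩
  obtain ⟨x, hx, hxn⟩ := (h.regular P hP).exists_mem_interior hn one_pos
  rw [h.cell_verts P hP] at hx
  have hnR := h.mem_verts_of_path hP hR hn hx hxn.le hyR hyO.2
  rcases eq_or_ne R Q with rfl | hne
  · exact hnR
  -- The common face of `R` and `Q` contains `w`, hence has `n` as a vertex. Thus `Q` has a vertex
  -- on the same ray, and the normalizations agree.
  obtain ⟨S, hS, cS, h1, -, e⟩ := h.inter_eq_cell hR hQ hne ⟨w, hwR, hwQ⟩
  have hVR := h.regular R hR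
  have hVQ := h.regular Q hQ
  have hnS := hVR.mem_of_hb_inter hS cS hnR (e ▸ ⟨hwR, hwQ⟩ : w ∈ cell S) hwn
  obtain ⟨m, hm, hmn⟩ := Finset.exists_mem_ne h1 n
  obtain ⟨n', hn', r, hr, e'⟩ := (hVR.raySet.mono hS).exists_parallel_of_cell_subset hVQ.null
    (by rw [← e, h.cell_verts Q hQ]; exact Set.inter_subset_right) hnS hm hmn.symm
  rwa [h.eq_of_parallel hQ hP hn' hn hr e']

end IsRegularTiling

/-! ### Symmetric packings of the tiles -/

theorem IsHoroballPacking.eq_or_two_le {𝓗 : Set (Set H3)} (h : IsHoroballPacking 𝓗) {n m : Mink}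
    (hn : IsNull n) (hm : IsNull m) (hn𝓗 : hb n ∈ 𝓗) (hm𝓗 : hb m ∈ 𝓗) : n = m ∨ 2 ≤ lor n m := by
  by_cases he : hb n = hb m
  · exact Or.inl (hn.hb_injective hm he)
  · exact Or.inr ((hn.disjoint_interior_iff hm).1 (h.2 _ hn𝓗 _ hm𝓗 he))

theorem IsHoroballPacking.exists_eq_hb {𝓗 : Set (Set H3)} (h : IsHoroballPacking 𝓗) {B : Set H3}
    (hB : B ∈ 𝓗) : ∃ n, IsNull n ∧ B = hb n := by
  obtain ⟨p, hp⟩ := h.1 B hB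
  obtain ⟨r, hr, rfl⟩ := isHoroballAt_iff.1 hp
  exact ⟨_, (isNull_nv p).smul hr, rfl⟩

theorem isHoroballPacking_of {𝒱 : Set Mink} (h0 : ∀ n ∈ 𝒱, IsNull n)
    (h2 : ∀ n ∈ 𝒱, ∀ m ∈ 𝒱, n ≠ m → 2 ≤ lor n m) : IsHoroballPacking (hb '' 𝒱) := by
  constructor
  · rintro _ ⟨n, hn, rfl⟩
    obtain ⟨p, hp⟩ := (h0 n hn).exists_nv
    exact ⟨p, (isHoroballAt_hb_iff (h0 n hn)).2 hp⟩
  · rintro _ ⟨n, hn, rfl⟩ _ ⟨m, hm, rfl⟩ hne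
    exact ((h0 n hn).disjoint_interior_iff (h0 m hm)).2 (h2 n hn m hm fun h => hne (by rw [h]))

/-- Tangent horoballs cannot both be enlarged. -/
theorem IsHoroballPacking.hb_mem_of_tangent {𝓗 : Set (Set H3)} (h : IsHoroballPacking 𝓗)
    {n m : Mink} (hn : IsNull n) (hm : IsNull m) (hnm : lor n m = 2)
    (hn𝓗 : ∃ B ∈ 𝓗, hb n ⊆ B) (hm𝓗 : ∃ B ∈ 𝓗, hb m ⊆ B) : hb n ∈ 𝓗 := by
  obtain ⟨B, hB, hnB⟩ := hn𝓗
  obtain ⟨B', hB', hmB'⟩ := hm𝓗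
  obtain ⟨n', hn', rfl⟩ := h.exists_eq_hb hB
  obtain ⟨m', hm', rfl⟩ := h.exists_eq_hb hB'
  obtain ⟨r, hr, hr1, rfl⟩ := hn.of_hb_subset hn' hnB
  obtain ⟨s, hs, hs1, rfl⟩ := hm.of_hb_subset hm' hmB'
  rcases h.eq_or_two_le hn' hm' hB hB' with e | h2
  · have : lor (r • n) (s • m) = 0 := by rw [e, hm'.self]
    rw [lor_smul_left, lor_smul_right, hnm] at this
    have : 0 < r * (s * 2) := by positivity
    linarith
  · rw [lor_smul_left, lor_smul_right, hnm] at h2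
    -- Enlarging a horoball means a factor at most 1, so `2 r s ≥ 2` leaves no room.
    have : r = 1 := by nlinarith
    rwa [this, one_smul] at hB

namespace IsRegular

variable {V W : Finset Mink}

theorem exists_adjacent (hV : IsRegular V) {n : Mink} (hn : n ∈ V) : ∃ m ∈ V, lor n m = 2 := by
  obtain ⟨T, hT, cT, h3, hnT⟩ := hV.exists_triangle_mem hn
  obtain ⟨m, hm, hne⟩ := Finset.exists_mem_ne (by omega : 1 < T.card) n
  exact ⟨m, hT hm, cT n hnT m hm hne.symm⟩

/-- Isometries between tiles match their symmetric packings. -/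
theorem map_mem (hV : IsRegular V) (hW : IsRegular W) {g : H3 ≃ᵢ H3} {L : Mink ≃ₗ[ℝ] Mink}
    (hL : Induces g L) (h : g '' cell V = cell W) {n : Mink} (hn : n ∈ V) : L n ∈ W := by
  rw [hL.image_cell] at h
  -- It suffices to follow one triangular face through `n`: its image is a proper face of the
  -- target, and a triangle determines its null vectors.
  obtain ⟨T, hT, cT, h3, hnT⟩ := hV.exists_triangle_mem hn
  have hR : IsRaySet (T.image L) := by
    constructor
    · intro k₀ hk₀
      obtain ⟨k, hk, rfl⟩ := Finset.mem_image.1 hk₀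
      exact hL.isNull (hV.null k (hT hk))
    · intro k₀ hk₀ j₀ hj₀ hne
      obtain ⟨k, hk, rfl⟩ := Finset.mem_image.1 hk₀
      obtain ⟨j, hj, rfl⟩ := Finset.mem_image.1 hj₀
      rw [hL.2]
      exact hV.raySet.2 k (hT hk) j (hT hj) fun h => hne (by rw [h])
  have cT' : IsClique (T.image L) := by
    intro k₀ hk₀ j₀ hj₀ hne
    obtain ⟨k, hk, rfl⟩ := Finset.mem_image.1 hk₀
    obtain ⟨j, hj, rfl⟩ := Finset.mem_image.1 hj₀
    rw [hL.2]
    exact cT k hk j hj fun h => hne (by rw [h])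
  have hcard : (T.image L).card = 3 := by rw [Finset.card_image_of_injective _ L.injective, h3]
  obtain ⟨e, h0, h1⟩ := hV.exists_functional hT cT
  have hF : IsFace (cell (T.image L)) (cell (V.image L)) := by
    refine isFace_cell_of_functional (e := L e) (Finset.image_subset_image hT)
      (hR.cell_nonempty (by omega)) ?_ ?_
    · intro k₀ hk₀
      obtain ⟨k, hk, rfl⟩ := Finset.mem_image.1 hk₀
      rw [hL.2, h0 k hk]
    · intro k₀ hk₀ hkT
      obtain ⟨k, hk, rfl⟩ := Finset.mem_image.1 hk₀
      rw [hL.2]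
      exact h1 k hk fun h => hkT (Finset.mem_image_of_mem _ h)
  have hne : cell (T.image L) ≠ cell W := by
    rw [← h, ← hL.image_cell, ← hL.image_cell]
    exact fun h => hV.cell_ne_of_card_lt hT (by have := hV.four_le; omega)
      (g.injective.image_injective h)
  rw [h] at hF
  rcases hW.face_cases hF with h' | ⟨S, hS, -, cS, -, e⟩
  · exact absurd h' hne
  · have := cT'.eq_of_cell_eq hR (hW.raySet.mono hS) cS (by omega) e
    exact hS (this ▸ Finset.mem_image_of_mem _ hnT)

theorem isHoroballPacking (hV : IsRegular V) : IsHoroballPacking (hb '' (V : Set Mink)) :=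
  isHoroballPacking_of hV.null hV.two_le

theorem isCenteredAt (hV : IsRegular V) : IsCenteredAtVerticesOf (cell V) (hb '' (V : Set Mink)) := by
  rintro _ ⟨n, hn, rfl⟩
  obtain ⟨p, r, hr, e⟩ := (hV.null n hn).exists_nv
  exact ⟨p, hV.isIdealVertex_iff.2 ⟨n, hn, r, hr, e⟩,
    (isHoroballAt_hb_iff (hV.null n hn)).2 ⟨r, hr, e⟩⟩

theorem exists_smul_of_isCenteredAt (hV : IsRegular V) {𝓗 : Set (Set H3)}
    (h : IsCenteredAtVerticesOf (cell V) 𝓗) {B : Set H3} (hB : B ∈ 𝓗) :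
    ∃ n ∈ V, ∃ c : ℝ, 0 < c ∧ B = hb (c • n) := by
  obtain ⟨p, hp, hB⟩ := h B hB
  obtain ⟨n, hn, r, hr, e⟩ := hV.isIdealVertex_iff.1 hp
  obtain ⟨s, hs, rfl⟩ := isHoroballAt_iff.1 hB
  refine ⟨n, hn, s * r⁻¹, by positivity, ?_⟩
  rw [mul_smul, e, inv_smul_smul₀ hr.ne']

/-- Invariance holds because the null vectors are determined by the tile. Maximality holds because
every vertex has a tangent neighbor, so no horoball can grow. -/
theorem isSymmetricPackingOf (hV : IsRegular V) :
    IsSymmetricPackingOf (cell V) (hb '' (V : Set Mink)) := by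
  refine ⟨hV.isHoroballPacking, hV.isCenteredAt, ?_, ?_⟩
  · rintro g hg _ ⟨n, hn, rfl⟩
    obtain ⟨L, hL⟩ := exists_induces g
    exact ⟨L n, hV.map_mem hV hL hg hn, (hL.image_hb n).symm⟩
  · intro 𝓗 h𝓗 hc hd
    have hmem : ∀ n ∈ V, hb n ∈ 𝓗 := by
      intro n hn
      obtain ⟨m, hm, h2⟩ := hV.exists_adjacent hn
      exact h𝓗.hb_mem_of_tangent (hV.null n hn) (hV.null m hm) h2 (hd _ ⟨n, hn, rfl⟩)
        (hd _ ⟨m, hm, rfl⟩)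
    apply Set.Subset.antisymm
    · intro B hB
      obtain ⟨n, hn, c, hc, rfl⟩ := hV.exists_smul_of_isCenteredAt hc hB
      have hN := hV.null n hn
      rcases h𝓗.eq_or_two_le (hN.smul hc) hN hB (hmem n hn) with e | h2
      · exact ⟨n, hn, by rw [e]⟩
      · rw [lor_smul_left, hN.self] at h2
        linarith
    · rintro _ ⟨n, hn, rfl⟩
      exact hmem n hn

/-- Symmetries act transitively on the vertices, so one member `hb (c • n₀)` brings all `hb (c • n)`
with the same `c`. Disjointness at adjacent vertices gives `c ≥ 1`. Every member is then contained
in a member of the standard packing, and maximality gives equality. -/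
theorem eq_of_isSymmetricPackingOf (hV : IsRegular V) {𝓗 : Set (Set H3)}
    (h : IsSymmetricPackingOf (cell V) 𝓗) : 𝓗 = hb '' (V : Set Mink) := by
  obtain ⟨hp, hc, hi, hm⟩ := h
  have hne : 𝓗.Nonempty := by
    rw [Set.nonempty_iff_ne_empty]
    -- The empty packing is not maximal: a single horoball at a vertex dominates it vacuously.
    rintro rfl
    obtain ⟨n, hn⟩ : V.Nonempty := Finset.card_pos.1 (by have := hV.four_le; omega)
    have h1 : IsHoroballPacking {hb n} := by
      rw [← Set.image_singleton]
      refine isHoroballPacking_of (by rintro _ rfl; exact hV.null _ hn) ?_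
      rintro _ rfl _ rfl hne
      exact absurd rfl hne
    have h2 : IsCenteredAtVerticesOf (cell V) {hb n} := by
      rintro _ rfl
      exact hV.isCenteredAt _ ⟨n, hn, rfl⟩
    exact Set.singleton_ne_empty _ (hm _ h1 h2 fun B hB => hB.elim)
  obtain ⟨B, hB⟩ := hne
  obtain ⟨n₀, hn₀, c, hc0, rfl⟩ := hV.exists_smul_of_isCenteredAt hc hB
  have hall : ∀ n ∈ V, hb (c • n) ∈ 𝓗 := by
    intro n hn
    obtain ⟨g, hg, L, hL, e⟩ := hV.exists_symmetry hn₀ hn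
    have := hi g hg _ hB
    rwa [hL.image_hb, map_smul, e] at this
  have hc1 : 1 ≤ c := by
    obtain ⟨m, hm', h2⟩ := hV.exists_adjacent hn₀
    rcases hp.eq_or_two_le ((hV.null _ hn₀).smul hc0) ((hV.null m hm').smul hc0) hB (hall m hm')
      with e | h
    · have := smul_right_injective _ hc0.ne' e
      exact absurd this (ne_of_lor_eq_two (hV.null _ hn₀) h2)
    · rw [lor_smul_left, lor_smul_right, h2] at h
      nlinarith
  refine (hm _ hV.isHoroballPacking hV.isCenteredAt fun B' hB' => ?_).symm
  obtain ⟨n, hn, d, hd, rfl⟩ := hV.exists_smul_of_isCenteredAt hc hB'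
  have hN := hV.null n hn
  refine ⟨hb n, ⟨n, hn, rfl⟩, ?_⟩
  rcases hp.eq_or_two_le (hN.smul hd) (hN.smul hc0) hB' (hall n hn) with e | h
  · rw [e]
    intro x hx
    change lor (c • n) (vec x) ≤ 1 at hx
    rw [lor_smul_left] at hx
    change lor n (vec x) ≤ 1
    have := hN.lor_vec_pos x
    nlinarith
  · rw [lor_smul_left, lor_smul_right, hN.self] at h
    linarith

end IsRegular

/-! ### The packing of a tiling -/

/-- The null vectors of the horoballs of all tiles. -/
def allVerts (𝒯 : Set (Set H3)) : Set Mink := {n | ∃ P ∈ 𝒯, n ∈ verts P}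

/-- The union of the symmetric packings of the tiles. -/
def tilePacking (𝒯 : Set (Set H3)) : Set (Set H3) := hb '' allVerts 𝒯

namespace IsRegularTiling

variable {𝒯 : Set (Set H3)} {Γ : Subgroup (H3 ≃ᵢ H3)}

theorem null (h : IsRegularTiling 𝒯) {n : Mink} (hn : n ∈ allVerts 𝒯) : IsNull n := by
  obtain ⟨P, hP, hn⟩ := hn
  exact (h.regular P hP).null n hn

theorem isIdealVertex_iff (h : IsRegularTiling 𝒯) {P : Set H3} (hP : P ∈ 𝒯) {p : IdealPoint} :
    IsIdealVertex p P ↔ ∃ n ∈ verts P, ∃ r : ℝ, 0 < r ∧ n = r • nv p := by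
  have := (h.regular P hP).isIdealVertex_iff (p := p)
  rwa [h.cell_verts P hP] at this

theorem mem_verts (h : IsRegularTiling 𝒯) {n : Mink} (hn : n ∈ allVerts 𝒯) {P : Set H3}
    (hP : P ∈ 𝒯) {x : H3} (hx : x ∈ P) (hxn : x ∈ hb n) : n ∈ verts P := by
  obtain ⟨Q, hQ, hn⟩ := hn
  exact h.mem_verts_of_mem_hb hQ hP hn hx hxn

theorem eq_of_smul (h : IsRegularTiling 𝒯) {n m : Mink} (hn : n ∈ allVerts 𝒯)
    (hm : m ∈ allVerts 𝒯) {p : IdealPoint} (en : ∃ r : ℝ, 0 < r ∧ n = r • nv p)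
    (em : ∃ r : ℝ, 0 < r ∧ m = r • nv p) : m = n := by
  obtain ⟨P, hP, hn⟩ := hn
  obtain ⟨Q, hQ, hm⟩ := hm
  obtain ⟨r, hr, en⟩ := en
  obtain ⟨s, hs, em⟩ := em
  refine h.eq_of_parallel hP hQ hn hm (r := s * r⁻¹) (by positivity) ?_
  rw [mul_smul, en, inv_smul_smul₀ hr.ne', em]

/-- A point common to two horoballs lies in some tile, which has both null vectors among its own;
within one tile the horoballs do not overlap. -/
theorem isHoroballPacking (h : IsRegularTiling 𝒯) : IsHoroballPacking (tilePacking 𝒯) := by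
  refine isHoroballPacking_of (fun n hn => h.null hn) fun n hn m hm hne => ?_
  have hN := h.null hn
  have hM := h.null hm
  by_contra! hlt
  have hnd := mt (hN.disjoint_interior_iff hM).1 (not_le.2 hlt)
  obtain ⟨x, hx, hx'⟩ := Set.not_disjoint_iff.1 hnd
  obtain ⟨P, hP, hxP⟩ := h.tiling.exists_mem x
  exact absurd ((h.regular P hP).two_le n (h.mem_verts hn hP hxP (interior_subset hx)) m
    (h.mem_verts hm hP hxP (interior_subset hx')) hne) (not_le.2 hlt)

theorem two_le (h : IsRegularTiling 𝒯) {n m : Mink} (hn : n ∈ allVerts 𝒯) (hm : m ∈ allVerts 𝒯)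
    (hne : n ≠ m) : 2 ≤ lor n m :=
  (h.isHoroballPacking.eq_or_two_le (h.null hn) (h.null hm) ⟨n, hn, rfl⟩ ⟨m, hm, rfl⟩).resolve_left
    hne

theorem existsUnique_isSymmetricPackingOf (h : IsRegularTiling 𝒯) {P : Set H3} (hP : P ∈ 𝒯) :
    ∃! 𝓗P, IsSymmetricPackingOf P 𝓗P := by
  rw [← h.cell_verts P hP]
  exact ⟨_, (h.regular P hP).isSymmetricPackingOf,
    fun _ h' => (h.regular P hP).eq_of_isSymmetricPackingOf h'⟩

theorem isSymmetricPackingOf_iff (h : IsRegularTiling 𝒯) {P : Set H3} (hP : P ∈ 𝒯)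
    {𝓗 : Set (Set H3)} : IsSymmetricPackingOf P 𝓗 ↔ 𝓗 = hb '' (verts P : Set Mink) := by
  have hV := h.regular P hP
  constructor
  · intro h'
    rw [← h.cell_verts P hP] at h'
    rw [hV.eq_of_isSymmetricPackingOf h']
  · rintro rfl
    have := hV.isSymmetricPackingOf
    rwa [h.cell_verts P hP] at this

theorem centers_tilePacking (h : IsRegularTiling 𝒯) :
    {p | ∃ B ∈ tilePacking 𝒯, IsHoroballAt p B} = {p | ∃ P ∈ 𝒯, IsIdealVertex p P} := by
  ext p
  constructor
  · rintro ⟨_, ⟨n, ⟨P, hP, hn⟩, rfl⟩, hp⟩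
    exact ⟨P, hP, (h.isIdealVertex_iff hP).2
      ⟨n, hn, (isHoroballAt_hb_iff ((h.regular P hP).null n hn)).1 hp⟩⟩
  · rintro ⟨P, hP, hp⟩
    obtain ⟨n, hn, hr⟩ := (h.isIdealVertex_iff hP).1 hp
    exact ⟨hb n, ⟨n, ⟨P, hP, hn⟩, rfl⟩, (isHoroballAt_hb_iff ((h.regular P hP).null n hn)).2 hr⟩

theorem isPackingOfTiling (h : IsRegularTiling 𝒯) (hΓ : IsInvariant Γ 𝒯) :
    IsPackingOfTiling Γ 𝒯 (tilePacking 𝒯) := by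
  refine ⟨h.isHoroballPacking, ?_, h.centers_tilePacking, ?_⟩
  · rintro γ hγ _ ⟨n, ⟨P, hP, hn⟩, rfl⟩
    obtain ⟨L, hL⟩ := exists_induces γ
    have hP' := hΓ γ hγ P hP
    refine ⟨L n, ⟨_, hP', (h.regular P hP).map_mem (h.regular _ hP') hL ?_ hn⟩,
      (hL.image_hb n).symm⟩
    rw [h.cell_verts P hP, h.cell_verts _ hP']
  · rintro P hP p hp _ ⟨m, hm, rfl⟩ hB
    obtain ⟨n, hn, hr⟩ := (h.isIdealVertex_iff hP).1 hp
    have e := h.eq_of_smul ⟨P, hP, hn⟩ hm hr ((isHoroballAt_hb_iff (h.null hm)).1 hB)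
    exact ⟨_, (h.isSymmetricPackingOf_iff hP).2 rfl, n, hn, by rw [e]⟩

theorem eq_tilePacking (h : IsRegularTiling 𝒯) {𝓗 : Set (Set H3)}
    (h𝓗 : IsPackingOfTiling Γ 𝒯 𝓗) : 𝓗 = tilePacking 𝒯 := by
  have key {p : IdealPoint} {B : Set H3} (hB : B ∈ 𝓗) (hp : IsHoroballAt p B) :
      ∃ n ∈ allVerts 𝒯, B = hb n := by
    have : p ∈ {p | ∃ B ∈ 𝓗, IsHoroballAt p B} := ⟨B, hB, hp⟩
    rw [h𝓗.centers] at this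
    obtain ⟨P, hP, hpP⟩ := this
    obtain ⟨𝓗P, h1, h2⟩ := h𝓗.agrees P hP p hpP B hB hp
    rw [(h.isSymmetricPackingOf_iff hP).1 h1] at h2
    obtain ⟨n, hn, rfl⟩ := h2
    exact ⟨n, ⟨P, hP, hn⟩, rfl⟩
  apply Set.Subset.antisymm
  · intro B hB
    obtain ⟨p, hp⟩ := h𝓗.packing.1 B hB
    obtain ⟨n, hn, rfl⟩ := key hB hp
    exact ⟨n, hn, rfl⟩
  · rintro _ ⟨n, hn, rfl⟩
    obtain ⟨p, hp⟩ := (h.null hn).exists_nv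
    have : p ∈ {p | ∃ P ∈ 𝒯, IsIdealVertex p P} := by
      obtain ⟨P, hP, hnP⟩ := hn
      exact ⟨P, hP, (h.isIdealVertex_iff hP).2 ⟨n, hnP, hp⟩⟩
    rw [← h𝓗.centers] at this
    obtain ⟨B, hB, hpB⟩ := this
    obtain ⟨m, hm, rfl⟩ := key hB hpB
    rwa [← h.eq_of_smul hn hm hp ((isHoroballAt_hb_iff (h.null hm)).1 hpB)]

theorem isMaximalPacking (h : IsRegularTiling 𝒯) : IsMaximalPacking (tilePacking 𝒯) := by
  refine ⟨h.isHoroballPacking, fun 𝓗 h𝓗 hd => ?_⟩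
  have hmem : ∀ n ∈ allVerts 𝒯, hb n ∈ 𝓗 := by
    rintro n ⟨P, hP, hn⟩
    have hV := h.regular P hP
    obtain ⟨m, hm, h2⟩ := hV.exists_adjacent hn
    exact h𝓗.hb_mem_of_tangent (hV.null n hn) (hV.null m hm) h2 (hd _ ⟨n, ⟨P, hP, hn⟩, rfl⟩)
      (hd _ ⟨m, ⟨P, hP, hm⟩, rfl⟩)
  apply Set.Subset.antisymm
  · intro B hB
    obtain ⟨m, hm, rfl⟩ := h𝓗.exists_eq_hb hB
    -- A point deep in a hypothetical new horoball has height at most 2 over some vertex of its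
    -- tile, so the product of the two null vectors is at most `2 * (1/4) * 2 = 1`, below the 2
    -- required for disjointness.
    obtain ⟨x, hx⟩ := hm.exists_lor_eq (s := 1 / 4) (by norm_num)
    obtain ⟨P, hP, hxP⟩ := h.tiling.exists_mem x
    rw [← h.cell_verts P hP] at hxP
    obtain ⟨n, hn, hn2⟩ := (h.regular P hP).exists_lor_le_two hxP
    have hN := (h.regular P hP).null n hn
    have hn' : n ∈ allVerts 𝒯 := ⟨P, hP, hn⟩
    rcases h𝓗.eq_or_two_le hm hN hB (hmem n hn') with rfl | h2
    · exact ⟨m, hn', rfl⟩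
    · have := hm.lor_le hN x
      rw [hx] at this
      linarith
  · rintro _ ⟨n, hn, rfl⟩
    exact hmem n hn

theorem inter_nonempty_iff (h : IsRegularTiling 𝒯) {B : Set H3} (hB : B ∈ tilePacking 𝒯)
    {p : IdealPoint} (hp : IsHoroballAt p B) {P : Set H3} (hP : P ∈ 𝒯) :
    (B ∩ P).Nonempty ↔ IsIdealVertex p P := by
  obtain ⟨n, hn, rfl⟩ := hB
  have hr := (isHoroballAt_hb_iff (h.null hn)).1 hp
  rw [h.isIdealVertex_iff hP]
  constructor
  · rintro ⟨x, hxn, hxP⟩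
    exact ⟨n, h.mem_verts hn hP hxP hxn, hr⟩
  · rintro ⟨m, hm, hr'⟩
    rw [← h.eq_of_smul hn ⟨P, hP, hm⟩ hr hr']
    obtain ⟨x, hx, hxm⟩ := (h.regular P hP).exists_mem_interior hm one_pos
    rw [h.cell_verts P hP] at hx
    exact ⟨x, hxm.le, interior_subset hx⟩

theorem horoball_infty_mem_tilePacking
    (h' : stdTetrahedron ∈ 𝒯 ∨ stdOctahedron ∈ 𝒯) :
    horoball OnePoint.infty 1 ∈ tilePacking 𝒯 := by
  rw [horoball_eq_hb, mul_one]
  rcases h' with hP | hP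
  · obtain ⟨V, hV, e, hm⟩ := stdTetrahedron_eq
    exact ⟨_, ⟨_, hP, by rwa [e, hV.isRegular.verts_cell]⟩, rfl⟩
  · obtain ⟨V, hV, e, hm⟩ := stdOctahedron_eq
    exact ⟨_, ⟨_, hP, by rwa [e, hV.isRegular.verts_cell]⟩, rfl⟩

/-! ### Edges and faces of the tiling -/

/-- Any tile through the point of tangency works, since a horoball meets only tiles that have its
center as a vertex. Both heights there are at most 1, which bounds the product above by 2. -/
theorem exists_tile_of_tangent (h : IsRegularTiling 𝒯) {n m : Mink} (hn : n ∈ allVerts 𝒯)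
    (hm : m ∈ allVerts 𝒯) (ht : AreTangent (hb n) (hb m)) :
    lor n m = 2 ∧ ∃ P ∈ 𝒯, n ∈ verts P ∧ m ∈ verts P := by
  have hN := h.null hn
  have hM := h.null hm
  have hne : n ≠ m := by
    rintro rfl
    exact hN.not_areTangent_self ht
  obtain ⟨x, hx⟩ := ht
  obtain ⟨hxn, hxm⟩ : x ∈ hb n ∩ hb m := by rw [hx]; rfl
  obtain ⟨P, hP, hxP⟩ := h.tiling.exists_mem x
  refine ⟨le_antisymm ?_ (h.two_le hn hm hne), P, hP, h.mem_verts hn hP hxP hxn,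
    h.mem_verts hm hP hxP hxm⟩
  have h1 : lor n (vec x) ≤ 1 := hxn
  have h2 : lor m (vec x) ≤ 1 := hxm
  have := hN.lor_le hM x
  have := hN.lor_vec_pos x
  have := hM.lor_vec_pos x
  nlinarith

theorem isEdge_iff (h : IsRegularTiling 𝒯) {P : Set H3} (hP : P ∈ 𝒯) {e : Set H3} :
    IsEdge e P ↔ ∃ n ∈ verts P, ∃ m ∈ verts P, lor n m = 2 ∧ e = cell {n, m} := by
  have := (h.regular P hP).isEdge_iff (e := e)
  rwa [h.cell_verts P hP] at this

theorem isTwoFace_iff (h : IsRegularTiling 𝒯) {P : Set H3} (hP : P ∈ 𝒯) {f : Set H3} :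
    IsTwoFace f P ↔ ∃ T ⊆ verts P, IsClique T ∧ T.card = 3 ∧ f = cell T := by
  have := (h.regular P hP).isTwoFace_iff (f := f)
  rwa [h.cell_verts P hP] at this

theorem ne_of_lor_eq_two {n m : Mink} {p q : IdealPoint} {r s : ℝ} (hnm : lor n m = 2)
    (hn : n = r • nv p) (hm : m = s • nv q) : p ≠ q := by
  rintro rfl
  rw [hn, hm, lor_smul_left, lor_smul_right, (isNull_nv p).self] at hnm
  norm_num at hnm

theorem edgeSet_eq (h : IsRegularTiling 𝒯) :
    edgeSet 𝒯 = tangencyGeodesics (tilePacking 𝒯) := by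
  ext e
  constructor
  · rintro ⟨P, hP, he⟩
    obtain ⟨n, hn, m, hm, h2, rfl⟩ := (h.isEdge_iff hP).1 he
    have hN := (h.regular P hP).null n hn
    have hM := (h.regular P hP).null m hm
    obtain ⟨p, r, hr, en⟩ := hN.exists_nv
    obtain ⟨q, s, hs, em⟩ := hM.exists_nv
    refine ⟨_, ⟨n, ⟨P, hP, hn⟩, rfl⟩, _, ⟨m, ⟨P, hP, hm⟩, rfl⟩, hN.areTangent hM h2, p, q,
      (isHoroballAt_hb_iff hN).2 ⟨r, hr, en⟩, (isHoroballAt_hb_iff hM).2 ⟨s, hs, em⟩, ?_⟩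
    exact (geodesicLine_eq_cell hr hs en em (ne_of_lor_eq_two h2 en em)).symm
  · rintro ⟨_, ⟨n, hn, rfl⟩, _, ⟨m, hm, rfl⟩, ht, p, q, hp, hq, rfl⟩
    obtain ⟨h2, P, hP, hnP, hmP⟩ := h.exists_tile_of_tangent hn hm ht
    obtain ⟨r, hr, en⟩ := (isHoroballAt_hb_iff (h.null hn)).1 hp
    obtain ⟨s, hs, em⟩ := (isHoroballAt_hb_iff (h.null hm)).1 hq
    exact ⟨P, hP, (h.isEdge_iff hP).2 ⟨n, hnP, m, hmP, h2,
      geodesicLine_eq_cell hr hs en em (ne_of_lor_eq_two h2 en em)⟩⟩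

/-- Three pairwise tangent horoballs of the packing belong to a common tile. -/
theorem exists_tile_of_triple (h : IsRegularTiling 𝒯) {n m k : Mink} (hn : n ∈ allVerts 𝒯)
    (hm : m ∈ allVerts 𝒯) (hk : k ∈ allVerts 𝒯) (hnm : lor n m = 2) (hnk : lor n k = 2)
    (hmk : lor m k = 2) : ∃ P ∈ 𝒯, n ∈ verts P ∧ m ∈ verts P ∧ k ∈ verts P := by
  have hN := h.null hn
  have hM := h.null hm
  have hK := h.null hk
  obtain ⟨q, hq, hq2, e⟩ := vec_nrm' (isTime_add_of_lor_pos hN.causal hM.causal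
    (by rw [hnm]; exact two_pos))
  set x := nrm (n + m)
  have hq2 : q = 2 := by
    have : q ^ 2 = 4 := by
      rw [hq2]
      simp only [lor_add_left, lor_add_right, hN.self, hM.self, lor_comm m n, hnm]
      norm_num
    nlinarith
  subst hq2
  have hxn : lor n (vec x) = 1 := by
    have := congrArg (lor n) e
    rw [lor_add_right, hN.self, hnm, lor_smul_right] at this
    linarith
  have hxm : lor m (vec x) = 1 := by
    have := congrArg (lor m) e
    rw [lor_add_right, hM.self, lor_comm, hnm, lor_smul_right] at this
    linarith
  obtain ⟨U, hU, hxU, hUx⟩ := h.exists_nhds x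
  -- From the tangency point `x` of `n` and `m`, a short move in the direction of `k` ends in a tile
  -- that still contains `x`.
  obtain ⟨ε, hε, -, y, hy, r, hr, -, e'⟩ := exists_perturb (hU.mem_nhds hxU) k one_pos
  obtain ⟨P, hP, hyP⟩ := h.tiling.exists_mem y
  have hxP := hUx P hP ⟨y, hyP, hy⟩
  have hnP := h.mem_verts hn hP hxP hxn.le
  have hmP := h.mem_verts hm hP hxP hxm.le
  refine ⟨P, hP, hnP, hmP, ?_⟩
  rw [← h.cell_verts P hP] at hyP
  obtain ⟨c, hc, hyc⟩ := hyP
  have hne : n ≠ m := by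
    rintro rfl
    rw [hN.self] at hnm
    norm_num at hnm
  -- Since `x` is half of `n + m`, solving for `k` gives a combination of vertices in which only `n`
  -- and `m` can have negative coefficients, as required by the field `triangle`.
  have hkc : k = ∑ j ∈ verts P, (ε⁻¹ * (r * c j - (if j = n then 1 / 2 else 0) -
      (if j = m then 1 / 2 else 0))) • j := by
    have h1 : ε • k = r • vec y - (1 / 2 : ℝ) • n - (1 / 2 : ℝ) • m := by
      rw [← e', sub_sub, ← smul_add, e, smul_smul]
      module
    rw [← inv_smul_smul₀ hε.ne' k, h1, hyc]
    simp only [mul_smul, ← Finset.smul_sum, sub_smul, Finset.sum_sub_distrib, ite_smul, zero_smul,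
      Finset.sum_ite_eq', hnP, hmP, if_true]
  obtain ⟨a, ha, -, -, hlt⟩ := (h.regular P hP).triangle n hnP m hmP hnm k hK hnk hmk
    ⟨_, fun j _ hjn hjm => by
      rw [if_neg hjn, if_neg hjm]
      have := hc j
      simp only [sub_zero]
      positivity, hkc⟩
  have : k = a := by
    by_contra hka
    exact absurd (h.two_le hk ⟨P, hP, ha⟩ hka) (not_le.2 hlt)
  rwa [this]

theorem hull_triangle_eq_cell {T : Finset Mink} (hT : IsRaySet T) {n₁ n₂ n₃ : Mink}
    {p₁ p₂ p₃ : IdealPoint} {r₁ r₂ r₃ : ℝ} (h₁ : 0 < r₁) (h₂ : 0 < r₂) (h₃ : 0 < r₃)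
    (e₁ : n₁ = r₁ • nv p₁) (e₂ : n₂ = r₂ • nv p₂) (e₃ : n₃ = r₃ • nv p₃) (h12 : p₁ ≠ p₂)
    (h13 : p₁ ≠ p₃) (h23 : p₂ ≠ p₃) (h : T = {n₁, n₂, n₃}) :
    hull (geodesicLine p₁ p₂ ∪ geodesicLine p₁ p₃ ∪ geodesicLine p₂ p₃) = cell T := by
  rw [geodesicLine_eq_cell h₁ h₂ e₁ e₂ h12, geodesicLine_eq_cell h₁ h₃ e₁ e₃ h13,
    geodesicLine_eq_cell h₂ h₃ e₂ e₃ h23]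
  apply hT.hull_eq_cell
  · subst h
    intro a ha b hb hab x hx
    simp only [Finset.mem_insert, Finset.mem_singleton] at ha hb
    rcases ha with rfl | rfl | rfl <;> rcases hb with rfl | rfl | rfl <;>
      first | exact absurd rfl hab | skip
    · exact Or.inl (Or.inl hx)
    · exact Or.inl (Or.inr hx)
    · rw [Finset.pair_comm] at hx; exact Or.inl (Or.inl hx)
    · exact Or.inr hx
    · rw [Finset.pair_comm] at hx; exact Or.inl (Or.inr hx)
    · rw [Finset.pair_comm] at hx; exact Or.inr hx
  · subst h
    refine Set.union_subset (Set.union_subset ?_ ?_) ?_ <;> apply cell_mono <;> intro k hk <;>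
      simp only [Finset.mem_insert, Finset.mem_singleton] at hk ⊢ <;> tauto

theorem faceSet_eq (h : IsRegularTiling 𝒯) :
    faceSet 𝒯 = tangencyTriangles (tilePacking 𝒯) := by
  ext f
  constructor
  · rintro ⟨P, hP, hf⟩
    obtain ⟨T, hT, cT, h3, rfl⟩ := (h.isTwoFace_iff hP).1 hf
    obtain ⟨n, m, k, hnm, hnk, hmk, rfl⟩ := Finset.card_eq_three.1 h3
    have hn : n ∈ verts P := hT (by simp)
    have hm : m ∈ verts P := hT (by simp)
    have hk : k ∈ verts P := hT (by simp)
    have hV := h.regular P hP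
    have hN := hV.null n hn
    have hM := hV.null m hm
    have hK := hV.null k hk
    have l1 := cT n (by simp) m (by simp) hnm
    have l2 := cT n (by simp) k (by simp) hnk
    have l3 := cT m (by simp) k (by simp) hmk
    obtain ⟨p₁, r₁, h₁, e₁⟩ := hN.exists_nv
    obtain ⟨p₂, r₂, h₂, e₂⟩ := hM.exists_nv
    obtain ⟨p₃, r₃, h₃, e₃⟩ := hK.exists_nv
    refine ⟨_, ⟨n, ⟨P, hP, hn⟩, rfl⟩, _, ⟨m, ⟨P, hP, hm⟩, rfl⟩, _, ⟨k, ⟨P, hP, hk⟩, rfl⟩,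
      hN.areTangent hM l1, hN.areTangent hK l2, hM.areTangent hK l3, p₁, p₂, p₃,
      (isHoroballAt_hb_iff hN).2 ⟨r₁, h₁, e₁⟩, (isHoroballAt_hb_iff hM).2 ⟨r₂, h₂, e₂⟩,
      (isHoroballAt_hb_iff hK).2 ⟨r₃, h₃, e₃⟩, ?_⟩
    exact (hull_triangle_eq_cell (hV.raySet.mono hT) h₁ h₂ h₃ e₁ e₂ e₃ (ne_of_lor_eq_two l1 e₁ e₂)
      (ne_of_lor_eq_two l2 e₁ e₃) (ne_of_lor_eq_two l3 e₂ e₃) rfl).symm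
  · rintro ⟨_, ⟨n, hn, rfl⟩, _, ⟨m, hm, rfl⟩, _, ⟨k, hk, rfl⟩, t1, t2, t3, p₁, p₂, p₃, b1, b2, b3,
      rfl⟩
    obtain ⟨l1, -⟩ := h.exists_tile_of_tangent hn hm t1
    obtain ⟨l2, -⟩ := h.exists_tile_of_tangent hn hk t2
    obtain ⟨l3, -⟩ := h.exists_tile_of_tangent hm hk t3
    obtain ⟨r₁, h₁, e₁⟩ := (isHoroballAt_hb_iff (h.null hn)).1 b1
    obtain ⟨r₂, h₂, e₂⟩ := (isHoroballAt_hb_iff (h.null hm)).1 b2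
    obtain ⟨r₃, h₃, e₃⟩ := (isHoroballAt_hb_iff (h.null hk)).1 b3
    obtain ⟨P, hP, hnP, hmP, hkP⟩ := h.exists_tile_of_triple hn hm hk l1 l2 l3
    have hT : ({n, m, k} : Finset Mink) ⊆ verts P := by
      intro j hj
      simp only [Finset.mem_insert, Finset.mem_singleton] at hj
      rcases hj with rfl | rfl | rfl <;> assumption
    have hV := h.regular P hP
    refine ⟨P, hP, (h.isTwoFace_iff hP).2 ⟨{n, m, k}, hT, ?_, ?_,
      hull_triangle_eq_cell (hV.raySet.mono hT) h₁ h₂ h₃ e₁ e₂ e₃ (ne_of_lor_eq_two l1 e₁ e₂)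
      (ne_of_lor_eq_two l2 e₁ e₃) (ne_of_lor_eq_two l3 e₂ e₃) rfl⟩⟩
    · intro a ha b hb hab
      simp only [Finset.mem_insert, Finset.mem_singleton] at ha hb
      rcases ha with rfl | rfl | rfl <;> rcases hb with rfl | rfl | rfl <;>
        first | exact absurd rfl hab | assumption | (rw [lor_comm]; assumption)
    · exact Finset.card_eq_three.2 ⟨n, m, k, H3.ne_of_lor_eq_two (h.null hn) l1,
        H3.ne_of_lor_eq_two (h.null hn) l2, H3.ne_of_lor_eq_two (h.null hm) l3, rfl⟩

end IsRegularTiling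

/-! ### The tiling is determined by its faces -/

/-- With `y` and the coefficients fixed, a point near `w` is the same combination of `y` and a
vector near `vec x`, whose normalization is still in `P`. -/
theorem IsConvex.mem_interior {P : Set H3} (hP : IsConvex P) {x y w : H3} (hx : x ∈ interior P)
    (hy : y ∈ P) {α β : ℝ} (hα : 0 < α) (hβ : 0 ≤ β) (h : vec w = α • vec x + β • vec y) :
    w ∈ interior P := by
  have hu : (fun w' : H3 => α⁻¹ • (vec w' - β • vec y)) w = vec x := by
    simp only [h, add_sub_cancel_right, inv_smul_smul₀ hα.ne']
  have hcont : Continuous fun w' : H3 => α⁻¹ • (vec w' - β • vec y) := by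
    have := continuous_vec
    fun_prop
  have hopen := continuousOn_nrm.isOpen_inter_preimage isOpen_isTime (isOpen_interior (s := P))
  refine _root_.mem_interior.2 ⟨_, ?_, hopen.preimage hcont, ?_⟩
  · rintro w' ⟨hT, hi⟩
    obtain ⟨r, hr, -, e⟩ := vec_nrm' hT
    refine hP.mem_of_smul (interior_subset hi) hy one_pos (mul_pos hα hr).le hβ ?_
    rw [mul_smul, ← e, smul_inv_smul₀ hα.ne', one_smul, sub_add_cancel]
  · rw [Set.mem_preimage]; beta_reduce at hu; rw [hu]
    exact ⟨isTime_vec x, by rwa [Set.mem_preimage, nrm_vec]⟩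

/-- A segment that leaves a closed set does so at a frontier point. -/
theorem exists_exit {Q : Set H3} (hQ : IsClosed Q) {x y : H3} (hx : x ∈ Q) (hy : y ∉ Q) :
    ∃ w ∈ Q, w ∉ interior Q ∧ ∃ α β : ℝ, 0 < α ∧ 0 ≤ β ∧ vec w = α • vec x + β • vec y := by
  have hT (s : unitInterval) : IsTime ((1 - (s : ℝ)) • vec x + (s : ℝ) • vec y) := by
    rcases s.2.2.eq_or_lt with h1 | h1
    · rw [h1]
      simpa using isTime_vec y
    · exact ((isTime_vec x).smul (by linarith)).add ((isTime_vec y).causal.smul s.2.1)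
  let σ : unitInterval → H3 := fun s => nrm ((1 - (s : ℝ)) • vec x + (s : ℝ) • vec y)
  have hσ : Continuous σ := by
    rw [← continuousOn_univ]
    exact continuousOn_nrm.comp (by fun_prop : Continuous fun s : unitInterval =>
      (1 - (s : ℝ)) • vec x + (s : ℝ) • vec y).continuousOn fun s _ => hT s
  have hσ0 : σ 0 = x := by simp [σ, nrm_vec]
  have hσ1 : σ 1 = y := by simp [σ, nrm_vec]
  -- Otherwise the times spent in `Q` would form a clopen set containing 0 but not 1.
  obtain ⟨s, hs, hs'⟩ : ∃ s, σ s ∈ Q ∧ σ s ∉ interior Q := by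
    by_contra! hcon
    have hcl : IsClopen (σ ⁻¹' Q) := by
      refine ⟨hQ.preimage hσ, ?_⟩
      rw [show σ ⁻¹' Q = σ ⁻¹' interior Q from
        Set.Subset.antisymm hcon fun _ (hs : _ ∈ interior Q) => (interior_subset : interior Q ⊆ Q) hs]
      exact isOpen_interior.preimage hσ
    rcases isClopen_iff.1 hcl with h | h
    · have : (0 : unitInterval) ∈ σ ⁻¹' Q := by rw [Set.mem_preimage, hσ0]; exact hx
      rw [h] at this
      exact this
    · have : (1 : unitInterval) ∈ σ ⁻¹' Q := by rw [h]; trivial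
      rw [Set.mem_preimage, hσ1] at this
      exact hy this
  have hs1 : (s : ℝ) < 1 := s.2.2.lt_of_ne fun h1 => hy (by
    have : s = 1 := Subtype.ext h1
    rwa [this, hσ1] at hs)
  obtain ⟨r, hr, -, e⟩ := vec_nrm' (hT s)
  refine ⟨σ s, hs, hs', r⁻¹ * (1 - s), r⁻¹ * s, mul_pos (inv_pos.2 hr) (by linarith),
    mul_nonneg (inv_pos.2 hr).le s.2.1, ?_⟩
  rw [mul_smul, mul_smul, ← smul_add, e, inv_smul_smul₀ hr.ne']

namespace IsRegularTiling

variable {𝒯 𝒯' : Set (Set H3)}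

/-- A segment inside the interior of `P` that leaves `Q` crosses a triangle of `Q`. That triangle is
also a face of some tile of `𝒯'`, necessarily `P`; but a face through an interior point is all of
`P`, and `P` is not planar. -/
theorem subset_of_faceSet_eq (h : IsRegularTiling 𝒯) (h' : IsIdealTiling 𝒯')
    (hf : faceSet 𝒯' = faceSet 𝒯) {P Q : Set H3} (hP : P ∈ 𝒯') (hQ : Q ∈ 𝒯) {x : H3}
    (hxP : x ∈ interior P) (hxQ : x ∈ interior Q) : P ⊆ Q := by
  have hcl := h.isClosed hQ
  suffices interior P ⊆ Q from (h'.subset_closure_interior hP).trans (closure_minimal this hcl)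
  intro y hy
  by_contra hyQ
  obtain ⟨w, hw, hwi, α, β, hα, hβ, e⟩ := exists_exit hcl (interior_subset hxQ) hyQ
  have hconv : IsConvex P := by
    obtain ⟨V, rfl, -⟩ := (h'.polyhedron P hP).exists_eq_cell
    exact isConvex_cell V
  have hwP := hconv.mem_interior hxP (interior_subset hy) hα hβ e
  rw [← h.cell_verts Q hQ] at hw hwi
  obtain ⟨T, hT, cT, h3, hwT⟩ := (h.regular Q hQ).exists_triangle_of_notMem_interior hw hwi
  have hTf : cell T ∈ faceSet 𝒯' := by
    rw [hf]
    exact ⟨Q, hQ, (h.isTwoFace_iff hQ).2 ⟨T, hT, cT, h3, rfl⟩⟩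
  obtain ⟨P', hP', hF⟩ := hTf
  obtain rfl := h'.eq_of_mem_interior hP hP' hwP (hF.1.2.1 hwT)
  have := hF.1.eq_of_mem_interior hwT hwP
  exact (h'.polyhedron P hP).2 (this ▸ hF.2.1)

/-- Since `P` is contained in `Q`, its vertices are among those of `Q`. If some were missing, `P`
would have a face containing a diagonal of `Q`; this face would pass through the interior of `Q`,
which no face of `𝒯` does. -/
theorem eq_of_faceSet_eq_of_interior (h : IsRegularTiling 𝒯) (h' : IsIdealTiling 𝒯')
    (hf : faceSet 𝒯' = faceSet 𝒯) {P Q : Set H3} (hP : P ∈ 𝒯') (hQ : Q ∈ 𝒯) {x : H3}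
    (hxP : x ∈ interior P) (hxQ : x ∈ interior Q) : P = Q := by
  classical
  have hPQ := h.subset_of_faceSet_eq h' hf hP hQ hxP hxQ
  obtain ⟨V, rfl, hV, hsp⟩ := (h'.polyhedron P hP).exists_eq_cell
  have hW := h.regular Q hQ
  have hcell := h.cell_verts Q hQ
  have hV4 := four_le_card_of_span hsp
  have hpar : ∀ n ∈ V, ∃ n' ∈ verts Q, ∃ r : ℝ, 0 < r ∧ n = r • n' := by
    intro n hn
    obtain ⟨m, hm, hne⟩ := Finset.exists_mem_ne (by omega : 1 < V.card) n
    exact hV.exists_parallel_of_cell_subset hW.null (by rwa [hcell]) hn hm hne.symm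
  set S := (verts Q).filter fun n' => ∃ r : ℝ, 0 < r ∧ r • n' ∈ V with hS
  have hSQ : S ⊆ verts Q := Finset.filter_subset _ _
  have hVS : cell V = cell S := by
    apply Set.Subset.antisymm <;> apply cell_subset
    · intro n hn
      obtain ⟨n', hn', r, hr, rfl⟩ := hpar n hn
      exact smul_mem_cone (mem_cone_of_mem (Finset.mem_filter.2 ⟨hn', r, hr, hn⟩)) hr.le
    · intro n' hn'
      obtain ⟨-, r, hr, hn⟩ := Finset.mem_filter.1 hn'
      rw [← inv_smul_smul₀ hr.ne' n']
      exact smul_mem_cone (mem_cone_of_mem hn) (inv_pos.2 hr).le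
  rcases eq_or_ne S (verts Q) with hSe | hSne
  · rw [hVS, hSe, hcell]
  exfalso
  have hSsp : Submodule.span ℝ (S : Set Mink) = ⊤ := by
    rw [eq_top_iff, ← hsp, Submodule.span_le]
    intro n hn
    obtain ⟨n', hn', r, hr, rfl⟩ := hpar n hn
    exact Submodule.smul_mem _ _ (Submodule.subset_span
      (Finset.mem_coe.2 (Finset.mem_filter.2 ⟨hn', r, hr, hn⟩)))
  obtain ⟨e, he, hnn, n, hn, m, hm, k, hk, hnm, hkn, hkm, h2, en, em, ek⟩ :=
    hW.subspan S hSQ hSne hSsp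
  -- All vertices on the supporting plane are needed for a face, not just the three that are
  -- exhibited.
  set S₀ := S.filter fun j => lor j e = 0 with hS₀
  have hS₀S : S₀ ⊆ S := Finset.filter_subset _ _
  have hn₀ : n ∈ S₀ := Finset.mem_filter.2 ⟨hn, en⟩
  have hm₀ : m ∈ S₀ := Finset.mem_filter.2 ⟨hm, em⟩
  have hk₀ : k ∈ S₀ := Finset.mem_filter.2 ⟨hk, ek⟩
  have hcard : 2 < S₀.card := Finset.two_lt_card.2 ⟨n, hn₀, m, hm₀, k, hk₀, hnm, hkn.symm, hkm.symm⟩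
  have hR : IsRaySet S₀ := hW.raySet.mono (hS₀S.trans hSQ)
  have h0 : ∀ j ∈ S₀, lor j e = 0 := fun j hj => (Finset.mem_filter.1 hj).2
  have hne := hR.cell_nonempty (by omega)
  have hface : IsTwoFace (cell S₀) (cell V) := by
    refine ⟨?_, ?_, hR.not_subset_geodesicLine hcard⟩
    · rw [hVS]
      exact isFace_cell_of_functional hS₀S hne h0 fun j hj hj₀ =>
        (hnn j hj).lt_of_ne fun h => hj₀ (Finset.mem_filter.2 ⟨hj, h.symm⟩)
    · obtain ⟨x₀, hx₀⟩ := hne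
      obtain ⟨a, b, hab, hb⟩ := exists_bisector he (lor_eq_zero_of_mem_cell h0 hx₀)
      exact ⟨a, b, hab, fun y hy => hb y (lor_eq_zero_of_mem_cell h0 hy)⟩
  have hmem : cell S₀ ∈ faceSet 𝒯 := by
    rw [← hf]
    exact ⟨_, hP, hface⟩
  obtain ⟨Q', hQ', hF⟩ := hmem
  obtain ⟨l, hl, hl'⟩ := hW.opposite n (hSQ hn) m (hSQ hm) hnm h2
  obtain ⟨r, hr, -, er⟩ := vec_nrm' (isTime_add_of_lor_pos (hR.1 n hn₀).causal
    (hR.1 m hm₀).causal (hR.2 n hn₀ m hm₀ hnm))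
  have hw : nrm (n + m) ∈ cell S₀ := by
    apply mem_cell_of_smul hr
    rw [← er]
    exact add_mem_cone (mem_cone_of_mem hn₀) (mem_cone_of_mem hm₀)
  -- The midpoint of the diagonal is the center of the tile.
  have hwi : nrm (n + m) ∈ interior Q := by
    rw [← hcell]
    refine hW.mem_interior_of_add (zero_mem_cone _) (δ := r⁻¹ * l⁻¹) (by positivity) ?_
    rw [hl', zero_add, mul_smul, inv_smul_smul₀ hl.ne', er, inv_smul_smul₀ hr.ne', ← er]
  obtain rfl := h.tiling.eq_of_mem_interior hQ hQ' hwi (hF.1.2.1 hw)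
  have := hF.1.eq_of_mem_interior hw hwi
  exact not_planar_of_interior ⟨_, hwi⟩ (this ▸ hF.2.1)

theorem eq_of_faceSet_eq (h : IsRegularTiling 𝒯) (h' : IsIdealTiling 𝒯')
    (hf : faceSet 𝒯' = faceSet 𝒯) : 𝒯' = 𝒯 := by
  apply Set.Subset.antisymm
  · intro P hP
    obtain ⟨Q, hQ, x, hxP, hxQ⟩ :=
      h.tiling.exists_interior_inter isOpen_interior (h'.nonempty_interior hP)
    rwa [h.eq_of_faceSet_eq_of_interior h' hf hP hQ hxP hxQ]
  · intro Q hQ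
    obtain ⟨P, hP, x, hxQ, hxP⟩ :=
      h'.exists_interior_inter isOpen_interior (h.tiling.nonempty_interior hQ)
    rwa [← h.eq_of_faceSet_eq_of_interior h' hf hP hQ hxP hxQ]

end IsRegularTiling

end H3
end

/-! ### The main theorem -/

theorem mainTheorem8 (Γ : Subgroup (H3 ≃ᵢ H3)) (𝒯 : Set (Set H3))
    (h_tiling : H3.IsIdealTiling 𝒯)
    (h_regular : ∀ P ∈ 𝒯, H3.IsRegularIdealTetrahedron P ∨ H3.IsRegularIdealOctahedron P)
    (h_inv : H3.IsInvariant Γ 𝒯) :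
    (∀ P ∈ 𝒯, ∃! 𝓗P, H3.IsSymmetricPackingOf P 𝓗P) ∧
    (∃! 𝓗, H3.IsPackingOfTiling Γ 𝒯 𝓗) ∧
    ∀ 𝓗, H3.IsPackingOfTiling Γ 𝒯 𝓗 →
      H3.IsMaximalPacking 𝓗 ∧
      (∀ B ∈ 𝓗, ∀ p, H3.IsHoroballAt p B →
        ∀ P ∈ 𝒯, (B ∩ P).Nonempty ↔ H3.IsIdealVertex p P) ∧
      ((H3.stdTetrahedron ∈ 𝒯 ∨ H3.stdOctahedron ∈ 𝒯) →
        H3.horoball OnePoint.infty 1 ∈ 𝓗) ∧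
      (∀ 𝒯' : Set (Set H3),
        (H3.IsIdealTiling 𝒯' ∧ H3.edgeSet 𝒯' = H3.tangencyGeodesics 𝓗 ∧
          H3.faceSet 𝒯' = H3.tangencyTriangles 𝓗) ↔ 𝒯' = 𝒯) := by
  have h := h_tiling.isRegularTiling h_regular
  refine ⟨fun P hP => h.existsUnique_isSymmetricPackingOf hP,
    ⟨_, h.isPackingOfTiling h_inv, fun _ h𝓗 => h.eq_tilePacking h𝓗⟩, fun 𝓗 h𝓗 => ?_⟩
  obtain rfl := h.eq_tilePacking h𝓗
  refine ⟨h.isMaximalPacking, fun B hB p hp P hP => h.inter_nonempty_iff hB hp hP,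
    H3.IsRegularTiling.horoball_infty_mem_tilePacking, fun 𝒯' => ⟨fun ⟨h1, _, h3⟩ => ?_, ?_⟩⟩
  · exact h.eq_of_faceSet_eq h1 (h3.trans h.faceSet_eq.symm)
  · rintro rfl
    exact ⟨h_tiling, h.edgeSet_eq, h.faceSet_eq⟩
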